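/- For $\beta\in(-1,1)$ consider the two-player game with payoff matrices $$A=\begin{pmatrix}1&0&\beta\\ \beta&1&0\\ 0&\beta&1\end{pmatrix},\qquad B=\begin{pmatrix}-\beta&1&0\\ 0&-\beta&1\\ 1&0&-\beta\end{pmatrix},$$ and its best response dynamics (continuous time fictitious play) $\dot p^A\in BR_A(p^B)-p^A$, $\dot p^B\in BR_B(p^A)-p^B$ on the product $\Sigma\subset\mathbb R^3\times\mathbb R^3$ of two probability simplices, where $BR_A(p^B)$ and $BR_B(p^A)$ are the sets of mixed best responses with respect to the utilities $v^A=Ap^B$ and $v^B=p^AB$. Let $E=(E^A,E^B)$ with $E^A=E^B=(\frac13,\frac13,\frac13)$, and let $\sigma=(\sqrt5-1)/2$. Let $S_{ij}\subset\Sigma$ be the region in which $i$ and $j$ are the unique best responses of A and B. A periodic orbit is called symmetric if it is invariant under the simultaneous cyclic relabelling of the strategies of both players, and attracting if it is asymptotically stable. 1. For $\beta\in[0,\sigma)$ there is a symmetric periodic orbit (the clockwise Shapley orbit) which, in one period, consists of six legs that lie successively in $S_{12},S_{22},S_{23},S_{33},S_{31},S_{11}$. It can be chosen to depend continuously on $\beta\in[0,\sigma)$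 (so that it is a continuous deformation of Shapley's orbit for $\beta=0$), it is stable and attracting for all $\beta\in[0,\sigma)$, and as $\beta\uparrow\sigma$ it shrinks in diameter to zero and tends to $E$. 2. For $\beta\in(\sigma,1)$ there is a unique symmetric periodic orbit (the anticlockwise or anti-Shapley orbit) which, in one period, consists of six legs that lie successively in $S_{13},S_{12},S_{32},S_{31},S_{21},S_{23}$. As $\beta\downarrow\sigma$ it shrinks in diameter to zero and tends to $E$. For $\beta\in(-1,\sigma)$ no periodic orbit (symmetric or not) visits these regions cyclically in this order. 3. There is $\tau\approx0.915$ (more precisely $0.915<\tau<0.9155$) such that the anticlockwise orbit is attracting for $\beta\in(\tau,1)$ and of saddle type for $\beta\in(\sigma,\tau)$, i.e. the derivative of a Poincaré return map at its fixed point on the orbit has no eigenvalue of modulus $1$, and has eigenvalues of modulus greater than $1$ as well as of modulus less than $1$. The number $\tau$ is the unique root in $(\sigma,1)$ of the equation $\lambda(\beta)=-1$, where $$\lambda(\beta)=\frac{n_2\left(-2n_1\beta-n_1-2n_2-n_2\beta+2\beta^2-\sqrt{\Delta}\right)}{2n_1\beta},$$ \begin{align*}\Delta={}&10n_1n_2\beta+4n_1n_2-4n_2\beta^2-4n_2\beta^3-8n_1\beta^3+4\beta^4+4n_2^2+4n_2^2\beta+4n_1^2\beta^2+4n_1^2\beta\\&+n_2^2\beta^2+4n_1n_2\beta^2-8n_1\beta^2+n_1^2-4n_2\beta-8n_1\beta+4\beta^2+4\beta^3,\end{align*}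 $$n_1=\beta-\mu\beta,\qquad n_2=\frac{2\beta^2+1-3\mu\beta^3-5\mu\beta^2-2\mu\beta-2\mu+3\mu^2\beta^2+3\mu^2\beta+3\mu^2\beta^3}{1+\beta+\beta^2},$$ and $\mu=\mu(\beta)$ is the root in $(0,\frac13)$ of $$(3\beta^3+3\beta^2+3\beta)Z^3-(5\beta^3+7\beta^2+4\beta+2)Z^2+(2\beta^3+5\beta^2+\beta+1)Z-\beta^2 .$$ Here $n_1=v^A_1$, $n_2=v^A_2$ and $\mu=v^B_2=v^B_3$ at the point of the anticlockwise orbit where player B switches from strategy 3 to strategy 2. -/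

import Mathlib

open Set Filter Topology MeasureTheory
open scoped Matrix NNReal

namespace ShapleyGame

/-- Pairs `(p^A, p^B)` of vectors in `ℝ³`, with indices `0, 1, 2` for the strategies `1, 2, 3`. -/
abbrev State : Type := (Fin 3 → ℝ) × (Fin 3 → ℝ)

/-- The number `(√5 - 1) / 2 ≈ 0.618`. -/
noncomputable def σ : ℝ := (Real.sqrt 5 - 1) / 2

/-- Payoff matrix of player A. -/
def matA (β : ℝ) : Matrix (Fin 3) (Fin 3) ℝ := !![1, 0, β; β, 1, 0; 0, β, 1]

/-- Payoff matrix of player B. -/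
def matB (β : ℝ) : Matrix (Fin 3) (Fin 3) ℝ := !![-β, 1, 0; 0, -β, 1; 1, 0, -β]

/-- The phase space: pairs of probability vectors. -/
def phaseSpace : Set State := stdSimplex ℝ (Fin 3) ×ˢ stdSimplex ℝ (Fin 3)

/-- The interior equilibrium. -/
noncomputable def E : State := (fun _ => 1 / 3, fun _ => 1 / 3)

/-- The utilities `v^A = A p^B` of player A. -/
def vA (β : ℝ) (x : State) : Fin 3 → ℝ := matA β *ᵥ x.2

/-- The utilities `v^B = p^A B` of player B. -/
def vB (β : ℝ) (x : State) : Fin 3 → ℝ := x.1 ᵥ* matB β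

/-- The set of (mixed) best responses of player A. -/
def bestA (β : ℝ) (x : State) : Set (Fin 3 → ℝ) :=
  {a | a ∈ stdSimplex ℝ (Fin 3) ∧ ∀ a' ∈ stdSimplex ℝ (Fin 3), a' ⬝ᵥ vA β x ≤ a ⬝ᵥ vA β x}

/-- The set of (mixed) best responses of player B. -/
def bestB (β : ℝ) (x : State) : Set (Fin 3 → ℝ) :=
  {b | b ∈ stdSimplex ℝ (Fin 3) ∧ ∀ b' ∈ stdSimplex ℝ (Fin 3), vB β x ⬝ᵥ b' ≤ vB β x ⬝ᵥ b}

/-- The region in which `i` is the only best response of A and `j` the only one of B. -/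
def region (β : ℝ) (i j : Fin 3) : Set State :=
  {x | x ∈ phaseSpace ∧ (∀ k, k ≠ i → vA β x k < vA β x i) ∧ (∀ k, k ≠ j → vB β x k < vB β x j)}

/-- `p` solves, on the interval `I`, the differential inclusion
`dp^A/dt ∈ BR_A(p^B) - p^A`, `dp^B/dt ∈ BR_B(p^A) - p^B`. The right-hand side is bounded, so that
the absolutely continuous solutions are the Lipschitz ones. -/
def IsSolutionOn (β : ℝ) (I : Set ℝ) (p : ℝ → State) : Prop :=
  (∀ t ∈ I, p t ∈ phaseSpace) ∧ (∃ K : ℝ≥0, LipschitzOnWith K p I) ∧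
    ∀ᵐ t ∂(volume.restrict I),
      ∃ a ∈ bestA β (p t), ∃ b ∈ bestB β (p t), HasDerivAt p ((a, b) - p t) t

/-- `γ` is a periodic solution with period `T > 0`; the orbit is `range γ`. -/
def IsPeriodicSolution (β : ℝ) (γ : ℝ → State) (T : ℝ) : Prop :=
  0 < T ∧ IsSolutionOn β univ γ ∧ ∀ t, γ (t + T) = γ t

/-- During one period, `γ` has six consecutive legs; on leg `k` the players strictly prefer the
strategies `a k` and `b k`. -/
def FollowsPattern (β : ℝ) (γ : ℝ → State) (T : ℝ) (a b : Fin 6 → Fin 3) : Prop :=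
  ∃ t : Fin 7 → ℝ, StrictMono t ∧ t (Fin.last 6) = t 0 + T ∧
    ∀ k : Fin 6, ∀ s ∈ Ioo (t k.castSucc) (t k.succ), γ s ∈ region β (a k) (b k)

/-- `γ` is a periodic solution of period `T` with the clockwise (Shapley) pattern. -/
def IsShapley (β : ℝ) (γ : ℝ → State) (T : ℝ) : Prop :=
  IsPeriodicSolution β γ T ∧ FollowsPattern β γ T ![0, 1, 1, 2, 2, 0] ![1, 1, 2, 2, 0, 0]

/-- `γ` is a periodic solution of period `T` with the anticlockwise (anti-Shapley) pattern. -/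
def IsAntiShapley (β : ℝ) (γ : ℝ → State) (T : ℝ) : Prop :=
  IsPeriodicSolution β γ T ∧ FollowsPattern β γ T ![0, 0, 2, 2, 1, 1] ![2, 1, 1, 0, 0, 2]

/-- Cyclic relabelling of the strategies of both players. -/
def rot (x : State) : State := (fun i => x.1 (i + 1), fun i => x.2 (i + 1))

/-- Invariance under cyclic relabelling of the strategies. -/
def IsSymmetric (Γ : Set State) : Prop := rot '' Γ = Γ

/-- The sets `F β` shrink to the point `x` along the filter `l`: they are eventually contained in
every neighbourhood of `x`, and their diameters tend to `0`. -/
def ShrinksTo (F : ℝ → Set State) (l : Filter ℝ) (x : State) : Prop :=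
  (∀ U ∈ 𝓝 x, ∀ᶠ β in l, F β ⊆ U) ∧ Tendsto (fun β => Metric.diam (F β)) l (𝓝 0)

/-- Lyapunov stability of the set `Γ`. -/
def IsStable (β : ℝ) (Γ : Set State) : Prop :=
  ∀ U ∈ 𝓝ˢ Γ, ∃ V ∈ 𝓝ˢ Γ, ∀ p, IsSolutionOn β (Ici 0) p → p 0 ∈ V → ∀ t, 0 ≤ t → p t ∈ U

/-- Asymptotic stability of the set `Γ`: it is stable, and all solutions that start in some
neighbourhood of `Γ` tend to `Γ`. -/
def IsAttracting (β : ℝ) (Γ : Set State) : Prop :=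
  IsStable β Γ ∧ ∃ V ∈ 𝓝ˢ Γ, ∀ p, IsSolutionOn β (Ici 0) p → p 0 ∈ V →
    Tendsto (fun t => Metric.infDist (p t) Γ) atTop (𝓝 0)

/-- The section of the phase space through `x₀` by a level set of the linear form `l`. -/
def crossSection (l : State →L[ℝ] ℝ) (x₀ : State) : Set State := {x | x ∈ phaseSpace ∧ l x = l x₀}

/-- The (three-dimensional, if `l` is transversal to the flow) space of directions of the section. -/
def sectionDirections (l : State →L[ℝ] ℝ) : Submodule ℝ State where
  carrier := {v | ∑ i, v.1 i = 0 ∧ ∑ i, v.2 i = 0 ∧ l v = 0}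
  add_mem' := by
    rintro v w ⟨h1, h2, h3⟩ ⟨k1, k2, k3⟩
    simp [Finset.sum_add_distrib, h1, h2, h3, k1, k2, k3]
  zero_mem' := by simp
  smul_mem' := by
    rintro c v ⟨h1, h2, h3⟩
    simp [← Finset.mul_sum, h1, h2, h3]

/-- `x₀` is a point of `Γ` in the interior of the phase space and of a region of constant
preferences, where the level set of `l` is transversal to the motion, and `P` is, near `x₀`, the
first return map to the part of this section that lies in the neighbourhood `W` of `x₀`. -/
structure IsReturnMap (β : ℝ) (Γ : Set State) (x₀ : State) (l : State →L[ℝ] ℝ) (W : Set State)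
    (P : State → State) : Prop where
  mem : x₀ ∈ Γ
  pos : ∀ i, 0 < x₀.1 i ∧ 0 < x₀.2 i
  transversal : ∃ i j, x₀ ∈ region β i j ∧ l ((Pi.single i 1, Pi.single j 1) - x₀) ≠ 0
  isOpen : IsOpen W
  inter : Γ ∩ crossSection l x₀ ∩ W = {x₀}
  fixed : P x₀ = x₀
  returns : ∀ᶠ x in 𝓝[crossSection l x₀] x₀, ∃ T > 0, ∃ p : ℝ → State,
    IsSolutionOn β (Icc 0 T) p ∧ p 0 = x ∧
    (∀ q, IsSolutionOn β (Icc 0 T) q → q 0 = x → EqOn q p (Icc 0 T)) ∧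
    p T = P x ∧ P x ∈ crossSection l x₀ ∩ W ∧ ∀ s ∈ Ioo 0 T, p s ∉ crossSection l x₀ ∩ W

/-- The periodic orbit `Γ` is (hyperbolic) of saddle type: the derivative at a fixed point on `Γ` of
a Poincaré return map has no eigenvalue of modulus `1`, and has eigenvalues of modulus `> 1` and
eigenvalues of modulus `< 1`. -/
def IsSaddleType (β : ℝ) (Γ : Set State) : Prop :=
  ∃ (x₀ : State) (l : State →L[ℝ] ℝ) (W : Set State) (P : State → State),
    IsReturnMap β Γ x₀ l W P ∧
    ∃ (L : State →L[ℝ] State)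
      (hL : ∀ v ∈ sectionDirections l, L.toLinearMap v ∈ sectionDirections l),
      HasFDerivWithinAt P L (crossSection l x₀) x₀ ∧
      (∀ z : ℂ, Polynomial.aeval z (L.toLinearMap.restrict hL).charpoly = 0 → ‖z‖ ≠ 1) ∧
      (∃ z : ℂ, Polynomial.aeval z (L.toLinearMap.restrict hL).charpoly = 0 ∧ 1 < ‖z‖) ∧
      (∃ z : ℂ, Polynomial.aeval z (L.toLinearMap.restrict hL).charpoly = 0 ∧ ‖z‖ < 1)

/-- The cubic polynomial whose root in `(0, 1/3)` determines the anticlockwise orbit. -/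
def antiCubic (β z : ℝ) : ℝ :=
  (3 * β ^ 3 + 3 * β ^ 2 + 3 * β) * z ^ 3 + (-5 * β ^ 3 - 7 * β ^ 2 - 4 * β - 2) * z ^ 2 +
    (2 * β ^ 3 + 5 * β ^ 2 + β + 1) * z - β ^ 2

/-- The first utility of A, at the moment when B switches from strategy 3 to strategy 2. -/
def antiN₁ (β μ : ℝ) : ℝ := β - μ * β

/-- The second utility of A, at the moment when B switches from strategy 3 to strategy 2. -/
noncomputable def antiN₂ (β μ : ℝ) : ℝ :=
  (2 * β ^ 2 + 1 - 3 * μ * β ^ 3 - 5 * μ * β ^ 2 - 2 * μ * β - 2 * μ + 3 * μ ^ 2 * β ^ 2 +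
    3 * μ ^ 2 * β + 3 * μ ^ 2 * β ^ 3) / (1 + β + β ^ 2)

/-- The discriminant in the eigenvalue expression. -/
def eigDisc (β n₁ n₂ : ℝ) : ℝ :=
  10 * n₁ * n₂ * β + 4 * n₁ * n₂ - 4 * n₂ * β ^ 2 - 4 * n₂ * β ^ 3 - 8 * n₁ * β ^ 3 + 4 * β ^ 4 +
    4 * n₂ ^ 2 + 4 * n₂ ^ 2 * β + 4 * n₁ ^ 2 * β ^ 2 + 4 * n₁ ^ 2 * β + n₂ ^ 2 * β ^ 2 +
    4 * n₂ * β ^ 2 * n₁ - 8 * n₁ * β ^ 2 + n₁ ^ 2 - 4 * n₂ * β - 8 * n₁ * β + 4 * β ^ 2 + 4 * β ^ 3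

/-- The most negative eigenvalue of the linearised transition map of the anticlockwise orbit over
one third of its period. -/
noncomputable def eigMinus (β n₁ n₂ : ℝ) : ℝ :=
  n₂ * (-2 * n₁ * β - n₁ - 2 * n₂ - n₂ * β + 2 * β ^ 2 - Real.sqrt (eigDisc β n₁ n₂)) / (2 * n₁ * β)

end ShapleyGame

open ShapleyGame

/-!
While the best responses of both players are constant, the state moves towards a vertex of the
phase space. Multiplied by the exponential of the time, it moves on a straight line; in these
homogeneous coordinates all switching conditions are linear. Both orbits of the theorem have the
same structure: after a renumbering of the strategies (`Orient`), player A switches from strategy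
`0` to `1`, then player B does, and after a relabelling (`turn`) everything starts again.

*Existence.* An orbit is self-similar if the homogeneous coordinates are multiplied by a constant
`1 / z` in each third of a revolution. This is a cubic equation for the ratio `z` (`IsRatio`,
`cwCubic`, `acwCubic`), and the orbit can be written down (`orbit`): each weight is a periodic
function of time, and the period is `-3 * log z`. The cubics have exactly one root in `(0, 1)` for
`β < σ` and `β > σ`, respectively; it depends continuously on `β` (`exists_continuousOn_root`) and
tends to `1` at `β = σ`, where `σ ^ 2 = 1 - σ`. An orbit with ratio `z` has distance at most
`1 - z` from the equilibrium (`range_orbit_subset`).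

*Stability.* On the section on which B is indifferent, the transition over one third of a
revolution is a linear map `nextV` of `ℝ⁴` in homogeneous coordinates. The eigenvalues of
`z • nextV` are `1`, with the orbit as eigenvector, `z`, and the roots of
`X ^ 2 - slope * X + z ^ 3`. If `|slope| < 1 + z ^ 3`, these roots are in the open unit disc
(Jury's criterion), and the orbit attracts all solutions that start near it
(`IsRatio.isAttracting`). This also needs solutions from points off the section, at which one
player may be indifferent: they are unique, because the other player, whose preference is strict,
determines how the utilities of the indifferent one change (`IsSolutionOn.eq_toward`). If
`1 + z ^ 3 + slope < 0`, the roots are real, and one of them is smaller than `-1`; the derivative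
of the return map has the cubes of the roots and `z ^ 3` as eigenvalues, and the orbit is of
saddle type (`IsRatio.isSaddleType`). For the anticlockwise orbit,
`(1 + z ^ 3 + slope) * (z + 2) = z ^ 4 - 6 * z ^ 2 + 2`; this vanishes at `z ^ 2 = 3 - √7`. Since
`z` decreases in `β`, this determines `τ` (`exists_critical`). The number `μ` and the formula for
`λ` are expressed by `z` in `mu_props` and `eigMinus_eq_neg_one_iff`.

*Uniqueness and non-existence.* Let a periodic solution have the anticlockwise pattern. The
exponentials of its six switching times satisfy linear equations (`IsAntiShapley.equations`). The
elimination of the switching times of A leaves a recurrence for the increments between those of B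
whose characteristic roots are the reciprocals of the roots of `acwCubic`
(`switching_recurrence`). The increments are positive and `β > 0`, which is impossible for `β < σ`
by the signs of the coefficients (`not_isAntiShapley`); for `β > σ`, the other two characteristic
roots are incompatible with periodicity, so that the increments are geometric
(`ratio_of_recurrence`), and the solution passes through the base point of the self-similar orbit
(`IsAntiShapley.range_eq`).
-/


namespace ShapleyGame

/-! ### Motion along one leg -/

/-- A Lipschitz function with derivative `c - f` almost everywhere is the exponential relaxation
towards `c`. -/
theorem eq_of_ae_hasDerivAt_relax {F : Type*} [NormedAddCommGroup F] [NormedSpace ℝ F]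
    {f : ℝ → F} {c : F} {a b : ℝ} {K : ℝ≥0} (hab : a ≤ b) (hf : LipschitzOnWith K f (Icc a b))
    (hd : ∀ᵐ t ∂(volume.restrict (Icc a b)), HasDerivAt f (c - f t) t) :
    f b = c + Real.exp (a - b) • (f a - c) := by
  have hu : uIcc a b = Icc a b := uIcc_of_le hab
  have h1 : AbsolutelyContinuousOnInterval f a b :=
    LipschitzOnWith.absolutelyContinuousOnInterval (by rwa [hu])
  have h2 : AbsolutelyContinuousOnInterval (fun t => f t - c) a b := by
    refine LipschitzOnWith.absolutelyContinuousOnInterval (K := K) ?_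
    rw [hu]
    exact fun x hx y hy => by simpa using hf hx hy
  have h3 : AbsolutelyContinuousOnInterval (fun t => Real.exp t) a b :=
    ContDiffOn.absolutelyContinuousOnInterval (Real.contDiff_exp.contDiffOn)
  have h4 : AbsolutelyContinuousOnInterval (fun t => Real.exp t • (f t - c)) a b := h3.smul h2
  have h5 := h4.const_of_ae_hasDerivAt_zero (by
    rw [ae_restrict_iff' measurableSet_Icc] at hd
    filter_upwards [hd] with t ht htI
    have h := (Real.hasDerivAt_exp t).smul ((ht (hu ▸ htI)).sub_const c)
    have h0 : Real.exp t • (c - f t) + Real.exp t • (f t - c) = 0 := by rw [← smul_add]; simp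
    rw [h0] at h
    exact h)
  obtain ⟨C, hC⟩ := h5
  have ha := hC a left_mem_uIcc
  have hb := hC b right_mem_uIcc
  have h6 : Real.exp b • (f b - c) = Real.exp a • (f a - c) := by
    rw [ha, hb]
  have h7 : f b - c = Real.exp (a - b) • (f a - c) := by
    have : Real.exp (-b) • (Real.exp b • (f b - c)) = Real.exp (-b) • (Real.exp a • (f a - c)) := by
      rw [h6]
    rw [smul_smul, smul_smul, ← Real.exp_add, ← Real.exp_add] at this
    simpa [sub_eq_add_neg, add_comm] using this
  rw [← h7]; abel

/-- The vertex of the phase space at which A plays `i` and B plays `j`. -/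
def vtx (i j : Fin 3) : State := (Pi.single i 1, Pi.single j 1)

/-- The point on the way from `x` to the vertex `(i, j)`, parametrised by the growth
`δ = exp t - 1` of the homogenising coordinate. In this parameter the state, multiplied by `1 + δ`,
moves on a straight line with unit speed, so that no exponentials appear. -/
noncomputable def toward (i j : Fin 3) (x : State) (δ : ℝ) : State :=
  (1 + δ)⁻¹ • (x + δ • vtx i j)

/-- Strategy `i` is the only best response of A. -/
def StrictA (β : ℝ) (i : Fin 3) (x : State) : Prop := ∀ k, k ≠ i → vA β x k < vA β x i

/-- Strategy `j` is the only best response of B. -/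
def StrictB (β : ℝ) (j : Fin 3) (x : State) : Prop := ∀ k, k ≠ j → vB β x k < vB β x j

theorem continuous_vA (β : ℝ) (k : Fin 3) : Continuous fun x : State => vA β x k := by
  simp only [vA, Matrix.mulVec, dotProduct]
  fun_prop

theorem continuous_vB (β : ℝ) (k : Fin 3) : Continuous fun x : State => vB β x k := by
  simp only [vB, Matrix.vecMul, dotProduct]
  fun_prop

theorem isOpen_strictA (β : ℝ) (i : Fin 3) : IsOpen {x | StrictA β i x} := by
  simp only [StrictA, ofPred_forall]
  refine isOpen_iInter_of_finite fun k => isOpen_iInter_of_finite fun _ => ?_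
  exact isOpen_lt (continuous_vA β k) (continuous_vA β i)

theorem isOpen_strictB (β : ℝ) (i : Fin 3) : IsOpen {x | StrictB β i x} := by
  simp only [StrictB, ofPred_forall]
  refine isOpen_iInter_of_finite fun k => isOpen_iInter_of_finite fun _ => ?_
  exact isOpen_lt (continuous_vB β k) (continuous_vB β i)

/-- If one strategy is strictly best, the pure strategy is the only mixed best response. -/
theorem eq_single_of_dotProduct_le {u a : Fin 3 → ℝ} {i : Fin 3} (hu : ∀ k, k ≠ i → u k < u i)
    (ha : a ∈ stdSimplex ℝ (Fin 3)) (h : u i ≤ a ⬝ᵥ u) : a = Pi.single i 1 := by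
  obtain ⟨h0, h1⟩ := ha
  have h2 : ∑ k, a k * (u i - u k) ≤ 0 := by
    simp only [mul_sub, Finset.sum_sub_distrib, ← Finset.sum_mul, h1]
    simpa [dotProduct] using h
  have h3 : ∀ k ∈ Finset.univ, 0 ≤ a k * (u i - u k) := fun k _ => by
    rcases eq_or_ne k i with rfl | hk
    · simp
    · exact mul_nonneg (h0 k) (sub_nonneg.2 (hu k hk).le)
  have h4 := (Finset.sum_eq_zero_iff_of_nonneg h3).1 (le_antisymm h2 (Finset.sum_nonneg h3))
  have h5 : ∀ k, k ≠ i → a k = 0 := fun k hk => by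
    have := h4 k (Finset.mem_univ k)
    exact (mul_eq_zero.1 this).resolve_right (sub_pos.2 (hu k hk)).ne'
  have h6 : a i = 1 := by
    rw [← h1, Finset.sum_eq_single i (fun k _ hk => h5 k hk) (by simp)]
  funext k
  rcases eq_or_ne k i with rfl | hk
  · simp [h6]
  · simp [hk, h5 k hk]

theorem eq_single_of_mem_bestA {β : ℝ} {x : State} {i : Fin 3} {a : Fin 3 → ℝ}
    (hx : StrictA β i x) (ha : a ∈ bestA β x) : a = Pi.single i 1 := by
  refine eq_single_of_dotProduct_le hx ha.1 ?_
  simpa using ha.2 (Pi.single i 1) (single_mem_stdSimplex ℝ i)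

theorem eq_single_of_mem_bestB {β : ℝ} {x : State} {i : Fin 3} {a : Fin 3 → ℝ}
    (hx : StrictB β i x) (ha : a ∈ bestB β x) : a = Pi.single i 1 := by
  refine eq_single_of_dotProduct_le hx ha.1 ?_
  rw [dotProduct_comm]
  simpa using ha.2 (Pi.single i 1) (single_mem_stdSimplex ℝ i)

theorem dotProduct_le_of_strict {u a : Fin 3 → ℝ} {i : Fin 3} (hu : ∀ k, k ≠ i → u k < u i)
    (ha : a ∈ stdSimplex ℝ (Fin 3)) : a ⬝ᵥ u ≤ u i := by
  calc a ⬝ᵥ u ≤ ∑ k, a k * u i := Finset.sum_le_sum fun k _ => by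
        rcases eq_or_ne k i with rfl | hk
        · exact le_rfl
        · exact mul_le_mul_of_nonneg_left (hu k hk).le (ha.1 k)
    _ = u i := by rw [← Finset.sum_mul, ha.2, one_mul]

theorem single_mem_bestA {β : ℝ} {x : State} {i : Fin 3} (hx : StrictA β i x) :
    Pi.single i 1 ∈ bestA β x :=
  ⟨single_mem_stdSimplex ℝ i, fun a' ha' => by simpa using dotProduct_le_of_strict hx ha'⟩

theorem single_mem_bestB {β : ℝ} {x : State} {i : Fin 3} (hx : StrictB β i x) :
    Pi.single i 1 ∈ bestB β x :=
  ⟨single_mem_stdSimplex ℝ i, fun a' ha' => by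
    rw [dotProduct_comm]
    simpa using dotProduct_le_of_strict hx ha'⟩

theorem IsSolutionOn.mono {β : ℝ} {I J : Set ℝ} {p : ℝ → State} (h : IsSolutionOn β I p)
    (hJ : J ⊆ I) : IsSolutionOn β J p :=
  ⟨fun t ht => h.1 t (hJ ht), h.2.1.imp fun _ hK => hK.mono hJ,
    ae_restrict_of_ae_restrict_of_subset hJ h.2.2⟩

theorem IsSolutionOn.continuousOn {β : ℝ} {I : Set ℝ} {p : ℝ → State} (h : IsSolutionOn β I p) :
    ContinuousOn p I := h.2.1.choose_spec.continuousOn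

theorem IsSolutionOn.comp_add {β : ℝ} {I J : Set ℝ} {p : ℝ → State} (h : IsSolutionOn β I p)
    (c : ℝ) (hI : MeasurableSet I) (hm : MeasurableSet J) (hJ : ∀ t ∈ J, t + c ∈ I) :
    IsSolutionOn β J (fun t => p (t + c)) := by
  obtain ⟨h1, ⟨K, hK⟩, h3⟩ := h
  refine ⟨fun t ht => h1 _ (hJ t ht), ⟨K, fun x hx y hy => ?_⟩, ?_⟩
  · simpa using hK (hJ x hx) (hJ y hy)
  · rw [ae_restrict_iff' hI] at h3
    rw [ae_restrict_iff' hm]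
    have h4 := (measurePreserving_add_right volume c).quasiMeasurePreserving.ae h3
    filter_upwards [h4] with t ht htJ
    obtain ⟨a, ha, b, hb, hd⟩ := ht (hJ t htJ)
    exact ⟨a, ha, b, hb, hd.comp_add_const t c⟩

theorem toward_exp (i j : Fin 3) (x : State) (t : ℝ) :
    toward i j x (Real.exp t - 1) = vtx i j + Real.exp (-t) • (x - vtx i j) := by
  have h : Real.exp t ≠ 0 := (Real.exp_pos t).ne'
  rw [toward, Real.exp_neg, show 1 + (Real.exp t - 1) = Real.exp t by ring, smul_add, smul_sub,
    sub_smul, smul_sub, smul_smul, inv_mul_cancel₀ h]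
  simp only [one_smul]
  abel

/-- As long as A has a single best response, the mixed strategy of A relaxes to it, whatever B
does. -/
theorem IsSolutionOn.fst_eq {β : ℝ} {p : ℝ → State} {a b : ℝ} {i : Fin 3} (hab : a ≤ b)
    (h : IsSolutionOn β (Icc a b) p) (hs : ∀ t ∈ Ioo a b, StrictA β i (p t)) :
    (p b).1 = Pi.single i 1 + Real.exp (a - b) • ((p a).1 - Pi.single i 1) := by
  obtain ⟨h1, ⟨K, hK⟩, h3⟩ := h
  refine eq_of_ae_hasDerivAt_relax (f := fun t => (p t).1) hab
    (LipschitzWith.prod_fst.comp_lipschitzOnWith hK) ?_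
  rw [← Measure.restrict_congr_set Ioo_ae_eq_Icc, ae_restrict_iff' measurableSet_Ioo] at h3 ⊢
  filter_upwards [h3] with t ht hI
  obtain ⟨u, hu, w, -, hd⟩ := ht hI
  rw [← eq_single_of_mem_bestA (hs t hI) hu]
  exact hd.hasFDerivAt.fst.hasDerivAt.congr_deriv (by simp)

theorem IsSolutionOn.snd_eq {β : ℝ} {p : ℝ → State} {a b : ℝ} {i : Fin 3} (hab : a ≤ b)
    (h : IsSolutionOn β (Icc a b) p) (hs : ∀ t ∈ Ioo a b, StrictB β i (p t)) :
    (p b).2 = Pi.single i 1 + Real.exp (a - b) • ((p a).2 - Pi.single i 1) := by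
  obtain ⟨h1, ⟨K, hK⟩, h3⟩ := h
  refine eq_of_ae_hasDerivAt_relax (f := fun t => (p t).2) hab
    (LipschitzWith.prod_snd.comp_lipschitzOnWith hK) ?_
  rw [← Measure.restrict_congr_set Ioo_ae_eq_Icc, ae_restrict_iff' measurableSet_Ioo] at h3 ⊢
  filter_upwards [h3] with t ht hI
  obtain ⟨u, -, w, hw, hd⟩ := ht hI
  rw [← eq_single_of_mem_bestB (hs t hI) hw]
  exact hd.hasFDerivAt.snd.hasDerivAt.congr_deriv (by simp)

theorem mem_region_iff {β : ℝ} {i j : Fin 3} {x : State} :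
    x ∈ region β i j ↔ x ∈ phaseSpace ∧ StrictA β i x ∧ StrictB β j x := Iff.rfl

theorem vA_congr {β : ℝ} {x y : State} (h : x.2 = y.2) : vA β x = vA β y := by
  simp [vA, h]

theorem vB_congr {β : ℝ} {x y : State} (h : x.1 = y.1) : vB β x = vB β y := by
  simp [vB, h]

/-- The relaxation towards the vertex `(i, j)`, in real time. -/
theorem toward_exp_exp (i j : Fin 3) (x : State) (a b : ℝ) :
    toward i j x (Real.exp b - 1) =
      vtx i j + Real.exp (a - b) • (toward i j x (Real.exp a - 1) - vtx i j) := by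
  rw [toward_exp, toward_exp, add_sub_cancel_left, smul_smul, ← Real.exp_add]
  ring_nf

/-- While the state moves towards the vertex `(i, j)` through the region of this vertex, it is the
only solution of the differential inclusion, also from a starting point at which one player is
indifferent: the other player then determines the utilities of the indifferent one. -/
theorem IsSolutionOn.eq_toward {β : ℝ} {p : ℝ → State} {i j : Fin 3} {δ : ℝ} (hδ : 0 ≤ δ)
    {x : State} (hx : StrictA β i x ∨ StrictB β j x)
    (hreg : ∀ ε ∈ Ioo 0 δ, toward i j x ε ∈ region β i j)
    (hp : IsSolutionOn β (Icc 0 (Real.log (1 + δ))) p) (h0 : p 0 = x) :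
    ∀ t ∈ Icc 0 (Real.log (1 + δ)), p t = toward i j x (Real.exp t - 1) := by
  set L := Real.log (1 + δ) with hL
  set c : ℝ → State := fun t => toward i j x (Real.exp t - 1) with hc
  have hc0 : c 0 = x := by simp [hc, toward]
  have hcreg : ∀ t ∈ Ioo 0 L, c t ∈ region β i j := fun t ht => by
    refine hreg _ ⟨by simpa using ht.1, ?_⟩
    have := (Real.lt_log_iff_exp_lt (by linarith)).1 ht.2
    linarith
  have hcont : Continuous c := by
    simp only [hc, toward_exp]; fun_prop
  have key : Icc 0 L ⊆ {t | p t = c t} := by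
    refine IsClosed.Icc_subset_of_forall_exists_gt ?_ (by simp [hc0, h0]) ?_
    · have h1 : ContinuousOn (fun t => p t - c t) (Icc 0 L) :=
        hp.continuousOn.sub hcont.continuousOn
      have h2 := h1.preimage_isClosed_of_isClosed isClosed_Icc
        (isClosed_singleton (x := (0 : State)))
      convert h2 using 1
      ext t
      simp [sub_eq_zero, and_comm]
    · rintro t ⟨ht, ht0, htL⟩ y hy
      have ht' : p t = c t := ht
      have hst : StrictA β i (c t) ∨ StrictB β j (c t) := by
        rcases ht0.eq_or_lt with rfl | h
        · rwa [hc0]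
        · exact Or.inl (hcreg t ⟨h, htL⟩).2.1
      have hpc : ContinuousWithinAt p (Icc 0 L) t := hp.continuousOn t ⟨ht0, htL.le⟩
      -- an open condition at time `t` persists for a short time
      have loc : ∀ S : Set State, IsOpen S → c t ∈ S → ∃ η, t < η ∧ η ≤ y ∧ η ≤ L ∧
          ∀ r ∈ Icc t η, p r ∈ S := by
        intro S hS hcS
        have h1 : ∀ᶠ r in 𝓝[Icc 0 L] t, p r ∈ S := hpc (hS.mem_nhds (by rw [ht']; exact hcS))
        have h2 : ∀ᶠ r in 𝓝[≥] t, p r ∈ S := by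
          rw [← nhdsWithin_Icc_eq_nhdsGE htL]
          exact nhdsWithin_mono _ (Icc_subset_Icc_left ht0) h1
        obtain ⟨u, hu, hsub⟩ := (mem_nhdsGE_iff_exists_Icc_subset).1 h2
        refine ⟨min u (min y L), lt_min hu (lt_min hy htL),
          (min_le_right _ _).trans (min_le_left _ _), (min_le_right _ _).trans (min_le_right _ _),
          fun r hr => hsub ⟨hr.1, hr.2.trans (min_le_left _ _)⟩⟩
      rcases hst with hst | hst
      · obtain ⟨η, hη, hηy, hηL, hS⟩ := loc _ (isOpen_strictA β i) hst
        have hsub : ∀ r ∈ Icc t η, IsSolutionOn β (Icc t r) p := fun r hr =>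
          hp.mono (Icc_subset_Icc ht0 (hr.2.trans hηL))
        have h1 : ∀ r ∈ Icc t η, (p r).1 = (c r).1 := fun r hr => by
          rw [(hsub r hr).fst_eq hr.1 fun s hs => hS s ⟨hs.1.le, hs.2.le.trans hr.2⟩, ht']
          simp only [hc, toward_exp_exp i j x t r]; rfl
        have h2 : (p η).2 = (c η).2 := by
          rw [(hsub η ⟨hη.le, le_rfl⟩).snd_eq (i := j) hη.le, ht']
          · simp only [hc, toward_exp_exp i j x t η]; rfl
          · intro s hs
            have := (hcreg s ⟨ht0.trans_lt hs.1, hs.2.trans_le hηL⟩).2.2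
            simpa only [StrictB, vB_congr (h1 s ⟨hs.1.le, hs.2.le⟩)] using this
        exact ⟨η, Prod.ext (h1 η ⟨hη.le, le_rfl⟩) h2, hη, hηy⟩
      · obtain ⟨η, hη, hηy, hηL, hS⟩ := loc _ (isOpen_strictB β j) hst
        have hsub : ∀ r ∈ Icc t η, IsSolutionOn β (Icc t r) p := fun r hr =>
          hp.mono (Icc_subset_Icc ht0 (hr.2.trans hηL))
        have h1 : ∀ r ∈ Icc t η, (p r).2 = (c r).2 := fun r hr => by
          rw [(hsub r hr).snd_eq hr.1 fun s hs => hS s ⟨hs.1.le, hs.2.le.trans hr.2⟩, ht']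
          simp only [hc, toward_exp_exp i j x t r]; rfl
        have h2 : (p η).1 = (c η).1 := by
          rw [(hsub η ⟨hη.le, le_rfl⟩).fst_eq (i := i) hη.le, ht']
          · simp only [hc, toward_exp_exp i j x t η]; rfl
          · intro s hs
            have := (hcreg s ⟨ht0.trans_lt hs.1, hs.2.trans_le hηL⟩).2.1
            simpa only [StrictA, vA_congr (h1 s ⟨hs.1.le, hs.2.le⟩)] using this
        exact ⟨η, Prod.ext h2 (h1 η ⟨hη.le, le_rfl⟩), hη, hηy⟩
  exact fun t ht => key ht

theorem vtx_mem (i j : Fin 3) : vtx i j ∈ phaseSpace :=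
  ⟨single_mem_stdSimplex ℝ i, single_mem_stdSimplex ℝ j⟩

theorem convex_phaseSpace : Convex ℝ phaseSpace :=
  (convex_stdSimplex ℝ (Fin 3)).prod (convex_stdSimplex ℝ (Fin 3))

theorem toward_mem {i j : Fin 3} {x : State} (hx : x ∈ phaseSpace) {δ : ℝ} (hδ : 0 ≤ δ) :
    toward i j x δ ∈ phaseSpace := by
  have h : toward i j x δ = (1 + δ)⁻¹ • x + ((1 + δ)⁻¹ * δ) • vtx i j := by
    rw [toward, smul_add, smul_smul]
  rw [h]
  refine convex_phaseSpace hx (vtx_mem i j) (by positivity) (by positivity) ?_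
  field_simp

theorem hasDerivAt_toward_exp (i j : Fin 3) (x : State) (t : ℝ) :
    HasDerivAt (fun t => toward i j x (Real.exp t - 1))
      (vtx i j - toward i j x (Real.exp t - 1)) t := by
  simp only [toward_exp]
  have h := (((hasDerivAt_neg t).exp).smul_const (x - vtx i j)).const_add (vtx i j)
  exact h.congr_deriv (by rw [sub_add_cancel_left]; simp)

theorem dist_le_one_of_mem_phaseSpace {x y : State} (hx : x ∈ phaseSpace) (hy : y ∈ phaseSpace) :
    ‖x - y‖ ≤ 1 := by
  have h : ∀ {a b : Fin 3 → ℝ}, a ∈ stdSimplex ℝ (Fin 3) → b ∈ stdSimplex ℝ (Fin 3) →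
      ‖a - b‖ ≤ 1 := by
    intro a b ha hb
    rw [pi_norm_le_iff_of_nonneg zero_le_one]
    intro k
    have h1 := mem_Icc_of_mem_stdSimplex ha k
    have h2 := mem_Icc_of_mem_stdSimplex hb k
    rw [Pi.sub_apply, Real.norm_eq_abs, abs_le]
    exact ⟨by linarith [h1.1, h2.2], by linarith [h1.2, h2.1]⟩
  exact max_le (h hx.1 hy.1) (h hx.2 hy.2)

theorem lipschitzOnWith_toward (i j : Fin 3) {x : State} (hx : x ∈ phaseSpace) :
    LipschitzOnWith 1 (fun t => toward i j x (Real.exp t - 1)) (Ici 0) := by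
  refine (convex_Ici _).lipschitzOnWith_of_nnnorm_hasDerivWithin_le
    (fun t _ => (hasDerivAt_toward_exp i j x t).hasDerivWithinAt) fun t ht => ?_
  exact_mod_cast dist_le_one_of_mem_phaseSpace (vtx_mem i j) (toward_mem hx (by simpa using ht))

/-- The motion towards a vertex, through the region of this vertex, is a solution. -/
theorem isSolutionOn_toward {β : ℝ} {i j : Fin 3} {δ : ℝ} (hδ : 0 ≤ δ)
    {x : State} (hx : x ∈ phaseSpace) (hreg : ∀ ε ∈ Ioo 0 δ, toward i j x ε ∈ region β i j) :
    IsSolutionOn β (Icc 0 (Real.log (1 + δ))) (fun t => toward i j x (Real.exp t - 1)) := by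
  have hmem : ∀ t ∈ Icc 0 (Real.log (1 + δ)), toward i j x (Real.exp t - 1) ∈ phaseSpace :=
    fun t ht => toward_mem hx (by simpa using ht.1)
  refine ⟨hmem, ⟨1, (lipschitzOnWith_toward i j hx).mono fun t ht => ht.1⟩, ?_⟩
  · rw [← Measure.restrict_congr_set Ioo_ae_eq_Icc, ae_restrict_iff' measurableSet_Ioo]
    refine Eventually.of_forall fun t ht => ?_
    have hr := hreg (Real.exp t - 1) ⟨by simpa using ht.1, by
      have := (Real.lt_log_iff_exp_lt (by linarith)).1 ht.2
      linarith⟩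
    exact ⟨_, single_mem_bestA hr.2.1, _, single_mem_bestB hr.2.2, hasDerivAt_toward_exp i j x t⟩

theorem _root_.LipschitzOnWith.union_Icc {α : Type*} [PseudoMetricSpace α] {f : ℝ → α}
    {K : ℝ≥0} {a b c : ℝ} (h1 : LipschitzOnWith K f (Icc a b))
    (h2 : LipschitzOnWith K f (Icc b c)) :
    LipschitzOnWith K f (Icc a c) := by
  refine LipschitzOnWith.of_dist_le_mul fun x hx y hy => ?_
  wlog hxy : x ≤ y generalizing x y
  · rw [dist_comm, dist_comm x]
    exact this y hy x hx (le_of_not_ge hxy)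
  rcases le_total y b with hyb | hyb
  · exact h1.dist_le_mul x ⟨hx.1, hxy.trans hyb⟩ y ⟨hy.1, hyb⟩
  rcases le_total b x with hbx | hbx
  · exact h2.dist_le_mul x ⟨hbx, hx.2⟩ y ⟨hyb, hy.2⟩
  · have e1 := h1.dist_le_mul x ⟨hx.1, hbx⟩ b ⟨hx.1.trans hbx, le_rfl⟩
    have e2 := h2.dist_le_mul b ⟨le_rfl, hyb.trans hy.2⟩ y ⟨hyb, hy.2⟩
    refine (dist_triangle _ (f b) _).trans ((add_le_add e1 e2).trans_eq ?_)
    rw [Real.dist_eq, Real.dist_eq, Real.dist_eq, abs_of_nonpos (by linarith),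
      abs_of_nonpos (by linarith), abs_of_nonpos (by linarith)]
    ring

theorem IsSolutionOn.union_Icc {β : ℝ} {p : ℝ → State} {a b c : ℝ} (h1 : IsSolutionOn β (Icc a b) p)
    (h2 : IsSolutionOn β (Icc b c) p) : IsSolutionOn β (Icc a c) p := by
  obtain ⟨p1, ⟨K, hK⟩, d1⟩ := h1
  obtain ⟨p2, ⟨M, hM⟩, d2⟩ := h2
  refine ⟨fun t ht => ?_, ⟨max K M, ?_⟩, ?_⟩
  · exact (le_total t b).elim (fun h => p1 t ⟨ht.1, h⟩) fun h => p2 t ⟨h, ht.2⟩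
  · exact (hK.weaken (le_max_left _ _)).union_Icc (hM.weaken (le_max_right _ _))
  · rw [ae_restrict_iff' measurableSet_Icc] at d1 d2 ⊢
    filter_upwards [d1, d2] with t h1 h2 ht
    exact (le_total t b).elim (fun h => h1 ⟨ht.1, h⟩) fun h => h2 ⟨h, ht.2⟩

theorem IsSolutionOn.congr_Icc {β : ℝ} {p q : ℝ → State} {a b : ℝ} (h : IsSolutionOn β (Icc a b) p)
    (hpq : EqOn q p (Icc a b)) : IsSolutionOn β (Icc a b) q := by
  obtain ⟨p1, ⟨K, hK⟩, d1⟩ := h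
  refine ⟨fun t ht => hpq ht ▸ p1 t ht, ⟨K, fun x hx y hy => ?_⟩, ?_⟩
  · rw [hpq hx, hpq hy]; exact hK hx hy
  · rw [← Measure.restrict_congr_set Ioo_ae_eq_Icc, ae_restrict_iff' measurableSet_Ioo] at d1 ⊢
    filter_upwards [d1] with t h1 ht
    obtain ⟨u, hu, w, hw, hd⟩ := h1 ht
    rw [hpq (Ioo_subset_Icc_self ht)]
    exact ⟨u, hu, w, hw, hd.congr_of_eventuallyEq
      (hpq.eventuallyEq_of_mem (Icc_mem_nhds ht.1 ht.2))⟩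

/-- The points on the way to a vertex form a segment. -/
theorem image_toward_Icc (i j : Fin 3) (x : State) {δ : ℝ} (hδ : 0 ≤ δ) :
    toward i j x '' Icc 0 δ = segment ℝ x (toward i j x δ) := by
  have h (ε : ℝ) (hε : 0 ≤ ε) : toward i j x ε = AffineMap.lineMap (vtx i j) x (1 + ε)⁻¹ := by
    have : (1 + ε) ≠ 0 := by positivity
    rw [toward, AffineMap.lineMap_apply_module, smul_add, smul_smul, add_comm]
    congr 2
    field_simp
    ring
  have h0 : segment ℝ x (toward i j x δ) = segment ℝ (AffineMap.lineMap (vtx i j) x (1 : ℝ))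
      (AffineMap.lineMap (vtx i j) x (1 + δ)⁻¹) := by
    rw [h δ hδ, AffineMap.lineMap_apply_one]
  rw [h0, ← image_segment, segment_symm, segment_eq_Icc (by
    rw [inv_le_one₀ (by positivity)]; linarith)]
  ext y
  constructor
  · rintro ⟨ε, hε, rfl⟩
    refine ⟨(1 + ε)⁻¹, ⟨?_, ?_⟩, (h ε hε.1).symm⟩
    · have := hε.1
      gcongr; exact hε.2
    · rw [inv_le_one₀ (by linarith [hε.1])]; linarith [hε.1]
  · rintro ⟨r, hr, rfl⟩
    have hr0 : 0 < r := lt_of_lt_of_le (by positivity) hr.1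
    have h1 : 1 ≤ r⁻¹ := (one_le_inv₀ hr0).2 hr.2
    refine ⟨r⁻¹ - 1, ⟨by linarith, ?_⟩, ?_⟩
    · have := inv_anti₀ (by positivity) hr.1
      rw [inv_inv] at this
      linarith
    · rw [h _ (by linarith)]; simp

end ShapleyGame

namespace ShapleyGame

/-! ### Numbering of the strategies by orientation -/

/-- The two orientations of the orbits: clockwise (Shapley) and anticlockwise. The strategies of
both players are renumbered according to the orientation, so that both orbits repeat one and the
same sequence of switches: first A switches from `0` to `1`, then B does, and after a relabelling
by one everything starts again. -/
inductive Orient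
  | cw
  | acw

namespace Orient

/-- The strategy number `m` of A is `step * m`, and that of B is `1 + step * m`. -/
def step : Orient → Fin 3
  | cw => 1
  | acw => 2

/-- In the new numbering, the utility of strategy `m` of A is `α₁` times the weight of strategy
`m + 2` of B plus `α₂` times that of strategy `m + 1` of B. -/
def α₁ : Orient → ℝ → ℝ
  | cw, _ => 1
  | acw, β => β

/-- The second coefficient in the utilities of A, see `uA_eq`. -/
def α₂ : Orient → ℝ → ℝ
  | cw, β => β
  | acw, _ => 1

/-- In the new numbering, the utility of strategy `m` of B is the weight of strategy `m` of A plus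
`c₁` times that of `m + 1` and `c₂` times that of `m + 2`. -/
def c₁ : Orient → ℝ → ℝ
  | cw, β => -β
  | acw, _ => 0

/-- The second coefficient in the utilities of B, see `uB_eq`. -/
def c₂ : Orient → ℝ → ℝ
  | cw, _ => 0
  | acw, β => -β

end Orient

variable (o : Orient) (β : ℝ)

/-- The weight of strategy number `m` in the mixed strategy of A. -/
def wA (m : Fin 3) (x : State) : ℝ := x.1 (o.step * m)

/-- The weight of strategy number `m` in the mixed strategy of B. -/
def wB (m : Fin 3) (x : State) : ℝ := x.2 (1 + o.step * m)

/-- The utility of strategy number `m` of A. -/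
def uA (m : Fin 3) (x : State) : ℝ := vA β x (o.step * m)

/-- The utility of strategy number `m` of B. -/
def uB (m : Fin 3) (x : State) : ℝ := vB β x (1 + o.step * m)

/-- The relabelling that lowers the numbers of all strategies by one. -/
def turn (x : State) : State := (fun i => x.1 (i + o.step), fun i => x.2 (i + o.step))

/-- The motion towards the vertex at which A plays number `m` and B plays number `k`, in the
parametrisation of `toward`. -/
noncomputable def go (m k : Fin 3) (x : State) (δ : ℝ) : State :=
  toward (o.step * m) (1 + o.step * k) x δ

/-- The region in which number `m` is the only best response of A, and number `k` that of B. -/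
def zone (m k : Fin 3) : Set State := region β (o.step * m) (1 + o.step * k)

variable {o β}

theorem uA_eq (m : Fin 3) (x : State) :
    uA o β m x = o.α₁ β * wB o (m + 2) x + o.α₂ β * wB o (m + 1) x := by
  cases o <;> fin_cases m <;>
    simp [uA, vA, matA, wB, Orient.step, Orient.α₁, Orient.α₂, Matrix.mulVec, dotProduct,
      Fin.sum_univ_three] <;> ring_nf

theorem uB_eq (m : Fin 3) (x : State) :
    uB o β m x = wA o m x + o.c₁ β * wA o (m + 1) x + o.c₂ β * wA o (m + 2) x := by
  cases o <;> fin_cases m <;>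
    simp [uB, vB, matB, wA, Orient.step, Orient.c₁, Orient.c₂, Matrix.vecMul, dotProduct,
      Fin.sum_univ_three] <;> ring_nf

theorem strictA_iff {m : Fin 3} {x : State} :
    StrictA β (o.step * m) x ↔ uA o β (m + 1) x < uA o β m x ∧ uA o β (m + 2) x < uA o β m x := by
  cases o <;> fin_cases m <;> simp [StrictA, uA, Orient.step, Fin.forall_fin_succ, and_comm] <;>
    exact and_comm

theorem strictB_iff {m : Fin 3} {x : State} :
    StrictB β (1 + o.step * m) x ↔
      uB o β (m + 1) x < uB o β m x ∧ uB o β (m + 2) x < uB o β m x := by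
  cases o <;> fin_cases m <;> simp [StrictB, uB, Orient.step, Fin.forall_fin_succ, and_comm] <;>
    exact and_comm

theorem state_ext {x y : State} (h1 : ∀ m, wA o m x = wA o m y) (h2 : ∀ m, wB o m x = wB o m y) :
    x = y := by
  refine Prod.ext (funext fun i => ?_) (funext fun j => ?_)
  · have := h1 (o.step * i)
    rwa [wA, wA, ← mul_assoc, show o.step * o.step = 1 by cases o <;> rfl, one_mul] at this
  · have := h2 (o.step * (j - 1))
    rwa [wB, wB, ← mul_assoc, show o.step * o.step = 1 by cases o <;> rfl, one_mul,
      add_sub_cancel] at this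

theorem mem_phaseSpace_iff {x : State} : x ∈ phaseSpace ↔
    (∀ m, 0 ≤ wA o m x) ∧ (∀ m, 0 ≤ wB o m x) ∧ wA o 0 x + wA o 1 x + wA o 2 x = 1 ∧
      wB o 0 x + wB o 1 x + wB o 2 x = 1 := by
  have h : x ∈ phaseSpace ↔ ((∀ i, 0 ≤ x.1 i) ∧ ∑ i, x.1 i = 1) ∧ ((∀ i, 0 ≤ x.2 i) ∧
    ∑ i, x.2 i = 1) := Iff.rfl
  rw [h]
  cases o <;> simp [wA, wB, Orient.step, Fin.forall_fin_succ, Fin.sum_univ_three] <;> grind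

theorem wA_turn (m : Fin 3) (x : State) : wA o m (turn o x) = wA o (m + 1) x := by
  simp only [wA, turn, mul_add, mul_one]

theorem wB_turn (m : Fin 3) (x : State) : wB o m (turn o x) = wB o (m + 1) x := by
  simp only [wB, turn, mul_add, mul_one, add_assoc]

theorem uA_turn (m : Fin 3) (x : State) : uA o β m (turn o x) = uA o β (m + 1) x := by
  simp only [uA_eq, wB_turn, add_right_comm]

theorem uB_turn (m : Fin 3) (x : State) : uB o β m (turn o x) = uB o β (m + 1) x := by
  simp only [uB_eq, wA_turn, add_right_comm]

theorem turn_turn_turn (x : State) : turn o (turn o (turn o x)) = x := by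
  have h (m : Fin 3) : m + 1 + 1 + 1 = m := by omega
  refine state_ext (o := o) (fun m => ?_) (fun m => ?_)
  · rw [wA_turn, wA_turn, wA_turn, h]
  · rw [wB_turn, wB_turn, wB_turn, h]

theorem continuous_turn : Continuous (turn o) := by
  unfold turn; fun_prop

theorem turn_mem_iff {x : State} : turn o x ∈ phaseSpace ↔ x ∈ phaseSpace := by
  rw [mem_phaseSpace_iff (o := o), mem_phaseSpace_iff (o := o)]
  simp only [wA_turn, wB_turn, Fin.forall_fin_succ, Fin.forall_fin_zero]
  simp
  grind

theorem strictA_turn {m : Fin 3} {x : State} :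
    StrictA β (o.step * m) (turn o x) ↔ StrictA β (o.step * (m + 1)) x := by
  simp only [strictA_iff, uA_turn, add_right_comm _ _ (1 : Fin 3)]

theorem strictB_turn {m : Fin 3} {x : State} :
    StrictB β (1 + o.step * m) (turn o x) ↔ StrictB β (1 + o.step * (m + 1)) x := by
  simp only [strictB_iff, uB_turn, add_right_comm _ _ (1 : Fin 3)]

theorem turn_mem_zone {m k : Fin 3} {x : State} :
    turn o x ∈ zone o β m k ↔ x ∈ zone o β (m + 1) (k + 1) := by
  rw [zone, zone, mem_region_iff, mem_region_iff, turn_mem_iff, strictA_turn, strictB_turn]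

theorem dist_turn (x y : State) : dist (turn o x) (turn o y) = dist x y := by
  have h (f g : Fin 3 → ℝ) (c : Fin 3) : dist (fun i => f (i + c)) (fun i => g (i + c)) =
      dist f g := by
    refine le_antisymm ?_ ?_
    · rw [dist_pi_le_iff dist_nonneg]
      exact fun i => dist_le_pi_dist f g (i + c)
    · rw [dist_pi_le_iff dist_nonneg]
      intro i
      simpa using dist_le_pi_dist (fun i => f (i + c)) (fun i => g (i + c)) (i - c)
  rw [Prod.dist_eq, Prod.dist_eq, turn, turn, h, h]

theorem shift_mem_stdSimplex {a : Fin 3 → ℝ} (c : Fin 3) (ha : a ∈ stdSimplex ℝ (Fin 3)) :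
    (fun i => a (i + c)) ∈ stdSimplex ℝ (Fin 3) :=
  ⟨fun i => ha.1 _, by rw [← ha.2]; exact Equiv.sum_comp (Equiv.addRight c) a⟩

theorem vA_turn (x : State) (i : Fin 3) : vA β (turn o x) i = vA β x (i + o.step) := by
  cases o <;> fin_cases i <;>
    simp [vA, matA, turn, Orient.step, Matrix.mulVec, dotProduct, Fin.sum_univ_three] <;> ring

theorem vB_turn (x : State) (i : Fin 3) : vB β (turn o x) i = vB β x (i + o.step) := by
  cases o <;> fin_cases i <;>
    simp [vB, matB, turn, Orient.step, Matrix.vecMul, dotProduct, Fin.sum_univ_three] <;> ring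

theorem shift_dotProduct (a b : Fin 3 → ℝ) (c : Fin 3) :
    (fun i => a (i + c)) ⬝ᵥ (fun i => b (i + c)) = a ⬝ᵥ b :=
  Equiv.sum_comp (Equiv.addRight c) fun i => a i * b i

theorem IsSolutionOn.turn {I : Set ℝ} {p : ℝ → State} (h : IsSolutionOn β I p) :
    IsSolutionOn β I (fun t => turn o (p t)) := by
  obtain ⟨h1, ⟨K, hK⟩, h3⟩ := h
  refine ⟨fun t ht => turn_mem_iff.2 (h1 t ht), ⟨K, fun x hx y hy => ?_⟩, ?_⟩
  · rw [edist_dist, dist_turn, ← edist_dist]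
    exact hK hx hy
  · filter_upwards [h3] with t ⟨a, ha, b, hb, hd⟩
    refine ⟨fun i => a (i + o.step), ⟨shift_mem_stdSimplex _ ha.1, fun a' ha' => ?_⟩,
      fun i => b (i + o.step), ⟨shift_mem_stdSimplex _ hb.1, fun b' hb' => ?_⟩, ?_⟩
    · have e : vA β (ShapleyGame.turn o (p t)) = fun i => vA β (p t) (i + o.step) :=
        funext (vA_turn _)
      rw [e, shift_dotProduct]
      have h4 := ha.2 _ (shift_mem_stdSimplex (-o.step) ha')
      rw [← shift_dotProduct _ _ o.step] at h4
      simpa using h4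
    · have e : vB β (ShapleyGame.turn o (p t)) = fun i => vB β (p t) (i + o.step) :=
        funext (vB_turn _)
      rw [e, shift_dotProduct]
      have h4 := hb.2 _ (shift_mem_stdSimplex (-o.step) hb')
      rw [← shift_dotProduct _ _ o.step] at h4
      simpa using h4
    · have h5 := hasDerivAt_pi.1 (hd.hasFDerivAt.fst.hasDerivAt)
      have h6 := hasDerivAt_pi.1 (hd.hasFDerivAt.snd.hasDerivAt)
      refine HasDerivAt.prodMk ?_ ?_
      · refine hasDerivAt_pi.2 fun i => (h5 (i + o.step)).congr_deriv ?_
        simp [ShapleyGame.turn]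
      · refine hasDerivAt_pi.2 fun i => (h6 (i + o.step)).congr_deriv ?_
        simp [ShapleyGame.turn]

theorem wA_go (i m k : Fin 3) (x : State) (δ : ℝ) :
    wA o i (go o m k x δ) = (wA o i x + if i = m then δ else 0) / (1 + δ) := by
  have h : o.step * i = o.step * m ↔ i = m := by
    cases o <;> revert i m <;> decide
  simp [wA, go, toward, vtx, Pi.single_apply, h, div_eq_inv_mul]
  split_ifs <;> ring

theorem wB_go (i m k : Fin 3) (x : State) (δ : ℝ) :
    wB o i (go o m k x δ) = (wB o i x + if i = k then δ else 0) / (1 + δ) := by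
  have h : o.step * i = o.step * k ↔ i = k := by
    cases o <;> revert i k <;> decide
  simp [wB, go, toward, vtx, Pi.single_apply, h, div_eq_inv_mul]
  split_ifs <;> ring

theorem go_zero (m k : Fin 3) (x : State) : go o m k x 0 = x := by
  simp [go, toward]

theorem go_mem {m k : Fin 3} {x : State} (hx : x ∈ phaseSpace) {δ : ℝ} (hδ : 0 ≤ δ) :
    go o m k x δ ∈ phaseSpace := toward_mem hx hδ

end ShapleyGame

namespace ShapleyGame

/-! ### Legs, waiting times, and homogeneous coordinates -/

variable {o : Orient} {β : ℝ}

theorem uA_go_zero (m : Fin 3) (x : State) (δ : ℝ) :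
    uA o β 0 (go o m 0 x δ) = uA o β 0 x / (1 + δ) ∧
    uA o β 1 (go o m 0 x δ) = (uA o β 1 x + o.α₁ β * δ) / (1 + δ) ∧
    uA o β 2 (go o m 0 x δ) = (uA o β 2 x + o.α₂ β * δ) / (1 + δ) := by
  simp [uA_eq, wB_go]
  refine ⟨?_, ?_, ?_⟩ <;> ring

theorem uB_go_zero (k : Fin 3) (x : State) (δ : ℝ) :
    uB o β 0 (go o 0 k x δ) = (uB o β 0 x + δ) / (1 + δ) ∧
    uB o β 1 (go o 0 k x δ) = (uB o β 1 x + o.c₂ β * δ) / (1 + δ) ∧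
    uB o β 2 (go o 0 k x δ) = (uB o β 2 x + o.c₁ β * δ) / (1 + δ) := by
  simp [uB_eq, wA_go]
  refine ⟨?_, ?_, ?_⟩ <;> ring

theorem uB_go_one (k : Fin 3) (x : State) (δ : ℝ) :
    uB o β 0 (go o 1 k x δ) = (uB o β 0 x + o.c₁ β * δ) / (1 + δ) ∧
    uB o β 1 (go o 1 k x δ) = (uB o β 1 x + δ) / (1 + δ) ∧
    uB o β 2 (go o 1 k x δ) = (uB o β 2 x + o.c₂ β * δ) / (1 + δ) := by
  simp [uB_eq, wA_go]
  refine ⟨?_, ?_, ?_⟩ <;> ring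

theorem lt_of_affine {a b c d : ℝ} {ε δ : ℝ} (h0 : a < b) (h1 : a + c * δ ≤ b + d * δ)
    (hε : ε ∈ Ioo 0 δ) : a + c * ε < b + d * ε := by
  obtain ⟨h2, h3⟩ := hε
  nlinarith

variable (o β) in
/-- Time (in the scale in which the state is `(x + δ • vertex) / (1 + δ)`) until player A is
indifferent between `0` and `1`, while B plays `0`. -/
noncomputable def waitA (x : State) : ℝ := (uA o β 0 x - uA o β 1 x) / o.α₁ β

variable (o β) in
/-- Time, in the same scale, until player B is indifferent between `0` and `1`, while A plays `1`.
-/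
noncomputable def waitB (x : State) : ℝ := (uB o β 0 x - uB o β 1 x) / (1 - o.c₁ β)

/-- The first leg of a third of a revolution, from a state at which B may be indifferent between
`2` and `0`: the strict preferences persist until A becomes indifferent between `0` and `1`.
Utilities are affine along the leg, hence only its ends have to be checked. -/
theorem go_mem_zone_zero {x : State} (hα : 0 < o.α₁ β) (hc : o.c₁ β < 1) (hx : x ∈ phaseSpace)
    {δ : ℝ} (hδ : δ ≤ waitA o β x)
    (hA : uA o β 2 x < uA o β 0 x) (hA' : uA o β 2 x + o.α₂ β * δ ≤ uA o β 0 x)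
    (hB2 : uB o β 2 x ≤ uB o β 0 x) (hB : uB o β 1 x < uB o β 0 x)
    (hB' : uB o β 1 x + o.c₂ β * δ ≤ uB o β 0 x + δ) :
    ∀ ε ∈ Ioo 0 δ, go o 0 0 x ε ∈ zone o β 0 0 := by
  intro ε hε
  have hε0 := hε.1
  have hpos : 0 < 1 + ε := by linarith
  have hw : o.α₁ β * waitA o β x = uA o β 0 x - uA o β 1 x := by
    rw [waitA]; field_simp
  have hlt : o.α₁ β * ε < uA o β 0 x - uA o β 1 x := by
    rw [← hw]; exact mul_lt_mul_of_pos_left (hε.2.trans_le hδ) hα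
  refine mem_region_iff.2 ⟨go_mem hx hε.1.le, strictA_iff.2 ?_, strictB_iff.2 ?_⟩
  · obtain ⟨e0, e1, e2⟩ := uA_go_zero (o := o) (β := β) 0 x ε
    simp only [zero_add]
    rw [e0, e1, e2]
    refine ⟨by gcongr; linarith, ?_⟩
    have := lt_of_affine (c := o.α₂ β) (d := 0) hA (by linarith) hε
    gcongr; linarith
  · obtain ⟨e0, e1, e2⟩ := uB_go_zero (o := o) (β := β) 0 x ε
    simp only [zero_add]
    rw [e0, e1, e2]
    have := lt_of_affine (c := o.c₂ β) (d := 1) hB (by linarith) hε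
    exact ⟨div_lt_div_of_pos_right (by linarith) hpos,
      div_lt_div_of_pos_right (by nlinarith) hpos⟩

/-- The second leg of a third of a revolution, from a state at which A may be indifferent between
`0` and `1`, until B becomes indifferent between `0` and `1`. -/
theorem go_mem_zone_one {x : State} (hα : 0 < o.α₁ β) (hc : o.c₁ β < 1) (hx : x ∈ phaseSpace)
    {δ : ℝ} (hδ : δ ≤ waitB o β x)
    (hB : uB o β 2 x < uB o β 0 x) (hB' : uB o β 2 x + o.c₂ β * δ ≤ uB o β 0 x + o.c₁ β * δ)
    (hA0 : uA o β 0 x ≤ uA o β 1 x) (hA : uA o β 2 x < uA o β 1 x)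
    (hA' : uA o β 2 x + o.α₂ β * δ ≤ uA o β 1 x + o.α₁ β * δ) :
    ∀ ε ∈ Ioo 0 δ, go o 1 0 x ε ∈ zone o β 1 0 := by
  intro ε hε
  have hε0 := hε.1
  have hpos : 0 < 1 + ε := by linarith
  have hb : 0 < 1 - o.c₁ β := by linarith
  have hw : (1 - o.c₁ β) * waitB o β x = uB o β 0 x - uB o β 1 x := by
    rw [waitB]; field_simp
  have hlt : (1 - o.c₁ β) * ε < uB o β 0 x - uB o β 1 x := by
    rw [← hw]; exact mul_lt_mul_of_pos_left (hε.2.trans_le hδ) hb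
  refine mem_region_iff.2 ⟨go_mem hx hε.1.le, strictA_iff.2 ?_, strictB_iff.2 ?_⟩
  · obtain ⟨e0, e1, e2⟩ := uA_go_zero (o := o) (β := β) 1 x ε
    simp only [show (1 : Fin 3) + 1 = 2 from rfl, show (1 : Fin 3) + 2 = 0 from rfl]
    rw [e0, e1, e2]
    have := lt_of_affine hA hA' hε
    refine ⟨by gcongr, ?_⟩
    gcongr
    nlinarith
  · obtain ⟨e0, e1, e2⟩ := uB_go_one (o := o) (β := β) 0 x ε
    simp only [zero_add]
    rw [e0, e1, e2]
    have := lt_of_affine hB hB' hε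
    exact ⟨div_lt_div_of_pos_right (by linarith) hpos, div_lt_div_of_pos_right this hpos⟩

variable (o) in
/-- The state with weights `u₁`, `u₂` of the strategies `2`, `1` of B, and `y₁`, `y₂` of the
strategies `2`, `1` of A; the weights of the strategies `0` are the remaining ones. -/
def pt (u₁ u₂ y₁ y₂ : ℝ) : State :=
  (fun i => ![1 - y₁ - y₂, y₂, y₁] (o.step * i), fun j => ![1 - u₁ - u₂, u₂, u₁] (o.step * (j - 1)))

theorem wA_pt (m : Fin 3) (u₁ u₂ y₁ y₂ : ℝ) :
    wA o m (pt o u₁ u₂ y₁ y₂) = ![1 - y₁ - y₂, y₂, y₁] m := by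
  simp only [wA, pt, ← mul_assoc]
  rw [show o.step * o.step = 1 by cases o <;> rfl, one_mul]

theorem wB_pt (m : Fin 3) (u₁ u₂ y₁ y₂ : ℝ) :
    wB o m (pt o u₁ u₂ y₁ y₂) = ![1 - u₁ - u₂, u₂, u₁] m := by
  simp only [wB, pt, add_sub_cancel_left, ← mul_assoc]
  rw [show o.step * o.step = 1 by cases o <;> rfl, one_mul]

theorem eq_pt {x : State} (hx : x ∈ phaseSpace) :
    x = pt o (wB o 2 x) (wB o 1 x) (wA o 2 x) (wA o 1 x) := by
  obtain ⟨-, -, h1, h2⟩ := (mem_phaseSpace_iff (o := o)).1 hx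
  refine state_ext (o := o) (fun m => ?_) (fun m => ?_)
  · rw [wA_pt]; fin_cases m <;> simp; linarith
  · rw [wB_pt]; fin_cases m <;> simp; linarith

variable (o β) in
/-- The factor by which the homogenising coordinate grows on the first leg, which starts at
`pt u₁ u₂ y₁ y₂` and ends when A is indifferent. -/
noncomputable def nextG (u₁ u₂ : ℝ) : ℝ :=
  ((2 * o.α₁ β - o.α₂ β) * u₁ + (o.α₁ β + o.α₂ β) * u₂) / o.α₁ β

variable (o β) in
/-- The weight of strategy `0` of A at the end of the first leg, in homogeneous coordinates. -/
noncomputable def nextY (u₁ u₂ y₁ y₂ : ℝ) : ℝ := nextG o β u₁ u₂ - y₁ - y₂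

variable (o β) in
/-- The factor by which the homogenising coordinate grows on both legs together. It is determined
by the indifference of B at the end of the second leg. -/
noncomputable def nextH (u₁ u₂ y₁ y₂ : ℝ) : ℝ :=
  ((2 - o.c₁ β - o.c₂ β) * nextY o β u₁ u₂ y₁ y₂ + (1 - 2 * o.c₁ β + o.c₂ β) * y₁) / (1 - o.c₁ β)

variable (o β) in
/-- The weight of strategy `0` of B at the end of the second leg, in homogeneous coordinates. -/
noncomputable def nextU (u₁ u₂ y₁ y₂ : ℝ) : ℝ := nextH o β u₁ u₂ y₁ y₂ - u₁ - u₂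

theorem waitA_pt (hα : 0 < o.α₁ β) (u₁ u₂ y₁ y₂ : ℝ) :
    1 + waitA o β (pt o u₁ u₂ y₁ y₂) = nextG o β u₁ u₂ := by
  simp only [waitA, nextG, uA_eq, wB_pt]
  simp
  field_simp
  ring

theorem waitB_go_pt (hc : o.c₁ β < 1) {u₁ u₂ y₁ y₂ : ℝ}
    {g : ℝ} (hg : g = nextG o β u₁ u₂) (hg0 : 0 < g) :
    1 + waitB o β (go o 0 0 (pt o u₁ u₂ y₁ y₂) (g - 1)) = nextH o β u₁ u₂ y₁ y₂ / g := by
  have hb : 1 - o.c₁ β ≠ 0 := by linarith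
  obtain ⟨e0, e1, -⟩ := uB_go_zero (o := o) (β := β) 0 (pt o u₁ u₂ y₁ y₂) (g - 1)
  simp only [waitB, nextH, nextY, ← hg]
  rw [e0, e1]
  simp only [uB_eq, wA_pt]
  simp
  field_simp
  ring

/-- Two legs followed by a relabelling: in homogeneous coordinates, the weights of `1` become those
of `2`, and those of `0` become those of `1`, for both players. -/
theorem turn_go_go_pt {u₁ u₂ y₁ y₂ : ℝ}
    {g h : ℝ} (hg : g = nextG o β u₁ u₂) (hg0 : 0 < g) (hh : h = nextH o β u₁ u₂ y₁ y₂)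
    (hh0 : 0 < h) :
    turn o (go o 1 0 (go o 0 0 (pt o u₁ u₂ y₁ y₂) (g - 1)) (h / g - 1)) =
      pt o (nextU o β u₁ u₂ y₁ y₂ / h) (u₁ / h) (nextY o β u₁ u₂ y₁ y₂ / h) (y₁ / h) := by
  refine state_ext (o := o) (fun m => ?_) (fun m => ?_)
  · rw [wA_pt, wA_turn, wA_go, wA_go, wA_pt, nextY, ← hg]
    fin_cases m <;> simp <;> field_simp <;> ring
  · rw [wB_pt, wB_turn, wB_go, wB_go, wB_pt, nextU, ← hh]
    fin_cases m <;> simp <;> field_simp <;> ring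

end ShapleyGame

namespace ShapleyGame

/-! ### The base point of a self-similar orbit -/

variable {o : Orient} {β z : ℝ}

variable (o β z) in
/-- The denominator of the weight of strategy `2` of A at the base point. -/
def denA : ℝ := 2 - o.c₁ β - o.c₂ β + (1 - 2 * o.c₁ β + o.c₂ β) * z

variable (o β z) in
/-- The weight of strategy `2` of A at the base point, obtained from the indifference of B. -/
noncomputable def frac : ℝ := (1 - o.c₁ β) / denA o β z

variable (o β z) in
/-- `z` is the ratio of a self-similar orbit: if the weights of successive strategies at the base
point form geometric progressions with ratio `z`, then after one third of a revolution and a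
relabelling the homogeneous coordinates are multiplied by `1 / z`. The field `root` is the
algebraic equation for this; `lower` and `upper` say that both legs take a positive time, and
`third` that B does not prefer strategy `1` at the base point. -/
structure IsRatio : Prop where
  α₁_pos : 0 < o.α₁ β
  α₂_nonneg : 0 ≤ o.α₂ β
  c₁_lt : o.c₁ β < 1
  c₂_lt : o.c₂ β < 1
  pos : 0 < z
  lt_one : z < 1
  den_pos : 0 < denA o β z
  root : o.α₁ β * (1 - o.c₁ β) * (1 + z + z ^ 2) ^ 2 =
    z * denA o β z * (2 * o.α₁ β - o.α₂ β + (o.α₁ β + o.α₂ β) * z)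
  lower : z * denA o β z < (1 - o.c₁ β) * (1 + z + z ^ 2)
  upper : (1 - o.c₁ β) * (1 + z + z ^ 2) < denA o β z
  third : 0 < (1 - o.c₁ β) ^ 2 + (o.c₁ β - o.c₂ β) * (denA o β z - (1 + z) * (1 - o.c₁ β)) +
    (o.c₂ β - 1) * z * (1 - o.c₁ β)

variable (o β z) in
/-- The base point of the orbit, at which B switches from `2` to `0`: a state whose weights of the
strategies `2`, `1` form geometric progressions with ratio `z`. -/
noncomputable def base : State :=
  pt o (1 / (1 + z + z ^ 2)) (z / (1 + z + z ^ 2)) (frac o β z) (z * frac o β z)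

variable (o β z) in
/-- The growth of the homogenising coordinate on the first leg from the base point; the first leg
takes the time `log gain`. -/
noncomputable def gain : ℝ := frac o β z * (1 + z + z ^ 2) / z

variable (o β z) in
/-- The end of the first leg, at which A switches from `0` to `1`. -/
noncomputable def mid : State := go o 0 0 (base o β z) (gain o β z - 1)

variable (o β z) in
/-- The end of the second leg, at which B switches from `0` to `1`. -/
noncomputable def endPt : State := go o 1 0 (mid o β z) (1 / z / gain o β z - 1)

namespace IsRatio

theorem quad_pos (h : IsRatio o β z) : 0 < 1 + z + z ^ 2 := by
  have := h.pos
  positivity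

theorem frac_pos (h : IsRatio o β z) : 0 < frac o β z :=
  div_pos (by linarith [h.c₁_lt]) h.den_pos

theorem frac_mul (h : IsRatio o β z) : frac o β z * denA o β z = 1 - o.c₁ β :=
  div_mul_cancel₀ _ h.den_pos.ne'

theorem lt_frac (h : IsRatio o β z) : z < frac o β z * (1 + z + z ^ 2) := by
  rw [frac, div_mul_eq_mul_div, lt_div_iff₀ h.den_pos]
  exact h.lower

theorem frac_lt (h : IsRatio o β z) : frac o β z * (1 + z + z ^ 2) < 1 := by
  rw [frac, div_mul_eq_mul_div, div_lt_one h.den_pos]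
  exact h.upper

theorem one_lt_gain (h : IsRatio o β z) : 1 < gain o β z := by
  rw [gain, lt_div_iff₀ h.pos, one_mul]
  exact h.lt_frac

theorem gain_lt (h : IsRatio o β z) : gain o β z < 1 / z := by
  rw [gain]
  exact div_lt_div_of_pos_right h.frac_lt h.pos

theorem gain_pos (h : IsRatio o β z) : 0 < gain o β z := zero_lt_one.trans h.one_lt_gain

theorem nextG_eq (h : IsRatio o β z) :
    nextG o β (1 / (1 + z + z ^ 2)) (z / (1 + z + z ^ 2)) = gain o β z := by
  have h1 := h.quad_pos.ne'
  have h2 := h.α₁_pos.ne'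
  have h3 := h.pos.ne'
  have h4 := h.den_pos.ne'
  rw [nextG, gain, frac]
  field_simp
  linear_combination -h.root

theorem nextY_eq (h : IsRatio o β z) : nextY o β (1 / (1 + z + z ^ 2)) (z / (1 + z + z ^ 2))
    (frac o β z) (z * frac o β z) = frac o β z / z := by
  have h3 := h.pos.ne'
  rw [nextY, h.nextG_eq, gain]
  field_simp
  ring

theorem nextH_eq (h : IsRatio o β z) : nextH o β (1 / (1 + z + z ^ 2)) (z / (1 + z + z ^ 2))
    (frac o β z) (z * frac o β z) = 1 / z := by
  have h3 := h.pos.ne'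
  have hc : 1 - o.c₁ β ≠ 0 := by linarith [h.c₁_lt]
  have h4 := h.frac_mul
  rw [denA] at h4
  rw [nextH, h.nextY_eq]
  field_simp
  linear_combination h4

theorem nextU_eq (h : IsRatio o β z) : nextU o β (1 / (1 + z + z ^ 2)) (z / (1 + z + z ^ 2))
    (frac o β z) (z * frac o β z) = 1 / (1 + z + z ^ 2) / z := by
  have h1 := h.quad_pos.ne'
  have h3 := h.pos.ne'
  rw [nextU, h.nextH_eq]
  field_simp
  ring

/-- After one third of a revolution, the base point is reached again, up to relabelling. -/
theorem turn_end (h : IsRatio o β z) :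
    turn o (endPt o β z) = base o β z := by
  have h1 := h.quad_pos.ne'
  have h3 := h.pos.ne'
  rw [endPt, mid, base, turn_go_go_pt h.nextG_eq.symm h.gain_pos h.nextH_eq.symm (by
    have := h.pos; positivity), h.nextU_eq, h.nextY_eq]
  congr 1 <;> field_simp

theorem waitA_base (h : IsRatio o β z) : waitA o β (base o β z) = gain o β z - 1 := by
  have := waitA_pt h.α₁_pos (1 / (1 + z + z ^ 2)) (z / (1 + z + z ^ 2)) (frac o β z)
    (z * frac o β z)
  rw [h.nextG_eq] at this
  rw [base]; linarith

theorem waitB_mid (h : IsRatio o β z) : waitB o β (mid o β z) = 1 / z / gain o β z - 1 := by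
  have := waitB_go_pt h.c₁_lt (y₁ := frac o β z) (y₂ := z * frac o β z) h.nextG_eq.symm h.gain_pos
  rw [h.nextH_eq] at this
  rw [mid, base]; linarith

theorem wA_pos (h : IsRatio o β z) (m : Fin 3) : 0 < wA o m (base o β z) := by
  have h1 := h.frac_lt
  have h2 := h.frac_pos
  have h3 := h.pos
  have h5 : 0 < frac o β z * z ^ 2 := by positivity
  have h6 : 0 < z * frac o β z := by positivity
  rw [base, wA_pt]
  fin_cases m <;> simp <;> nlinarith

theorem wB_pos (h : IsRatio o β z) (m : Fin 3) : 0 < wB o m (base o β z) := by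
  have h1 := h.quad_pos
  have h3 := h.pos
  have h4 : 1 - 1 / (1 + z + z ^ 2) - z / (1 + z + z ^ 2) = z ^ 2 / (1 + z + z ^ 2) := by
    field_simp; ring
  rw [base, wB_pt, h4]
  fin_cases m <;> simp <;> positivity

theorem base_mem (h : IsRatio o β z) : base o β z ∈ phaseSpace := by
  refine (mem_phaseSpace_iff (o := o)).2 ⟨fun m => (h.wA_pos m).le, fun m => (h.wB_pos m).le,
    ?_, ?_⟩
  · rw [base]; simp [wA_pt]
  · rw [base]; simp [wB_pt]

theorem mid_mem (h : IsRatio o β z) : mid o β z ∈ phaseSpace :=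
  go_mem h.base_mem (by linarith [h.one_lt_gain])

theorem uA_one_lt (h : IsRatio o β z) : uA o β 1 (base o β z) < uA o β 0 (base o β z) := by
  have h1 := h.waitA_base
  have h2 := h.α₁_pos
  rw [waitA, div_eq_iff h2.ne'] at h1
  nlinarith [h.one_lt_gain]

theorem uA_zero_sub (h : IsRatio o β z) : uA o β 0 (base o β z) - uA o β 2 (base o β z) =
    (1 - z) * (o.α₁ β + o.α₂ β * z) / (1 + z + z ^ 2) := by
  have h1 := h.quad_pos.ne'
  simp only [uA_eq, base, wB_pt]
  simp
  field_simp
  ring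

theorem uA_two_lt (h : IsRatio o β z) : uA o β 2 (base o β z) < uA o β 0 (base o β z) := by
  have h1 := h.uA_zero_sub
  have h2 : 0 < (1 - z) * (o.α₁ β + o.α₂ β * z) / (1 + z + z ^ 2) :=
    div_pos (mul_pos (by linarith [h.lt_one]) (add_pos_of_pos_of_nonneg h.α₁_pos
      (mul_nonneg h.α₂_nonneg h.pos.le))) h.quad_pos
  linarith

/-- A does not prefer strategy `2` at the end of the first leg. After clearing denominators this is
the positivity of `α₁² - α₁ α₂ + α₂²`. -/
theorem uA_two_lt' (h : IsRatio o β z) :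
    uA o β 2 (base o β z) + o.α₂ β * (gain o β z - 1) < uA o β 0 (base o β z) := by
  have h1 := h.uA_zero_sub
  have h2 := h.α₁_pos
  have h3 := h.quad_pos
  have h5 : o.α₁ β * (gain o β z - 1) =
      (1 - z) * (o.α₁ β * (1 + z) - o.α₂ β) / (1 + z + z ^ 2) := by
    rw [← h.nextG_eq, nextG]; field_simp; ring
  have h6 : o.α₁ β * (uA o β 0 (base o β z) - (uA o β 2 (base o β z) +
      o.α₂ β * (gain o β z - 1))) =
      (1 - z) * (o.α₁ β ^ 2 - o.α₁ β * o.α₂ β + o.α₂ β ^ 2) / (1 + z + z ^ 2) := by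
    rw [← sub_sub, mul_sub, h1, mul_left_comm, h5]; field_simp; ring
  have h7 : 0 < (1 - z) * (o.α₁ β ^ 2 - o.α₁ β * o.α₂ β + o.α₂ β ^ 2) / (1 + z + z ^ 2) := by
    refine div_pos (mul_pos (by linarith [h.lt_one]) ?_) h3
    nlinarith [sq_nonneg (o.α₁ β - 2 * o.α₂ β), sq_pos_of_pos h2]
  rw [← h6] at h7
  linarith [(mul_pos_iff_of_pos_left h2).1 h7]

theorem uB_two_eq (h : IsRatio o β z) : uB o β 2 (base o β z) = uB o β 0 (base o β z) := by
  have h1 := h.frac_mul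
  rw [denA] at h1
  simp only [uB_eq, base, wA_pt]
  simp
  linear_combination h1

theorem uB_one_lt (h : IsRatio o β z) : uB o β 1 (base o β z) < uB o β 0 (base o β z) := by
  have h1 := h.third
  have h2 := h.frac_pos
  have h3 : 0 < (1 - o.c₁ β) := by linarith [h.c₁_lt]
  have h4 : (uB o β 2 (base o β z) - uB o β 1 (base o β z)) * denA o β z = (1 - o.c₁ β) ^ 2 +
      (o.c₁ β - o.c₂ β) * (denA o β z - (1 + z) * (1 - o.c₁ β)) +
      (o.c₂ β - 1) * z * (1 - o.c₁ β) := by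
    have h5 := h.frac_mul
    simp only [uB_eq, base, wA_pt]
    simp
    linear_combination (1 - o.c₁ β - (1 + z) * (o.c₁ β - o.c₂ β) + (o.c₂ β - 1) * z) * h5
  rw [← h4] at h1
  have := (mul_pos_iff_of_pos_right h.den_pos).1 h1
  linarith [h.uB_two_eq]

theorem uA_mid (h : IsRatio o β z) : uA o β 1 (mid o β z) = uA o β 0 (mid o β z) ∧
    uA o β 2 (mid o β z) < uA o β 0 (mid o β z) := by
  obtain ⟨e0, e1, e2⟩ := uA_go_zero (o := o) (β := β) 0 (base o β z) (gain o β z - 1)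
  have h1 := h.waitA_base
  rw [waitA, div_eq_iff h.α₁_pos.ne'] at h1
  have hp : 0 < 1 + (gain o β z - 1) := by linarith [h.gain_pos]
  rw [mid, e0, e1, e2]
  exact ⟨by congr 1; linarith, div_lt_div_of_pos_right h.uA_two_lt' hp⟩

theorem uB_mid (h : IsRatio o β z) : uB o β 1 (mid o β z) < uB o β 0 (mid o β z) ∧
    uB o β 2 (mid o β z) < uB o β 0 (mid o β z) := by
  obtain ⟨e0, e1, e2⟩ := uB_go_zero (o := o) (β := β) 0 (base o β z) (gain o β z - 1)
  have hp : 0 < 1 + (gain o β z - 1) := by linarith [h.gain_pos]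
  have h1 := h.one_lt_gain
  rw [mid, e0, e1, e2]
  exact ⟨div_lt_div_of_pos_right (by nlinarith [h.c₂_lt, h.uB_one_lt]) hp,
    div_lt_div_of_pos_right (by nlinarith [h.c₁_lt, h.uB_two_eq]) hp⟩

theorem uA_endPt (h : IsRatio o β z) :
    uA o β 0 (endPt o β z) < uA o β 1 (endPt o β z) ∧
      uA o β 2 (endPt o β z) < uA o β 1 (endPt o β z) := by
  have h1 := h.uA_one_lt
  have h2 := h.uA_two_lt
  rw [← h.turn_end] at h1 h2
  simp only [uA_turn] at h1 h2
  exact ⟨h2, h1⟩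

theorem uB_endPt (h : IsRatio o β z) :
    uB o β 0 (endPt o β z) = uB o β 1 (endPt o β z) ∧
      uB o β 2 (endPt o β z) < uB o β 0 (endPt o β z) := by
  have h1 := h.uB_one_lt
  have h2 := h.uB_two_eq
  rw [← h.turn_end] at h1 h2
  simp only [uB_turn] at h1 h2
  exact ⟨h2, h1.trans_eq h2.symm⟩

end IsRatio

end ShapleyGame

namespace ShapleyGame

/-! ### The explicit periodic orbit -/

variable {o : Orient} {β z : ℝ}

/-- The weight of one strategy along the orbit, with period `-3 * log z`: on the first third of the
period the strategy is played and its weight rises, then it decays exponentially. The minimum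
selects the right branch. -/
noncomputable def wave (z t : ℝ) : ℝ :=
  min (1 - Real.exp (3 * Real.log z * Int.fract (t / (-3 * Real.log z))) *
      (1 + z) / (1 + z + z ^ 2))
    (Real.exp (3 * Real.log z * Int.fract (t / (-3 * Real.log z))) / (z * (1 + z + z ^ 2)))

theorem wave_periodic (hz0 : 0 < z) (hz1 : z < 1) (t : ℝ) :
    wave z (t - 3 * Real.log z) = wave z t := by
  have h : Real.log z < 0 := Real.log_neg hz0 hz1
  have h' := h.ne
  have : (t - 3 * Real.log z) / (-3 * Real.log z) = t / (-3 * Real.log z) + 1 := by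
    field_simp; ring
  rw [wave, wave, this, Int.fract_add_one]

theorem wave_eq (hz0 : 0 < z) (hz1 : z < 1) {t : ℝ} (h0 : 0 ≤ t) (h1 : t ≤ -3 * Real.log z) :
    wave z t = min (1 - Real.exp (-t) * (1 + z) / (1 + z + z ^ 2))
      (Real.exp (-t) / (z * (1 + z + z ^ 2))) := by
  have h : Real.log z < 0 := Real.log_neg hz0 hz1
  have h' := h.ne
  rcases h1.eq_or_lt with rfl | h1
  · have e1 : Real.exp (3 * Real.log z) = z ^ 3 := by
      rw [show 3 * Real.log z = Real.log z + Real.log z + Real.log z by ring, Real.exp_add,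
        Real.exp_add, Real.exp_log hz0]; ring
    have e2 : -3 * Real.log z / (-3 * Real.log z) = 1 := by field_simp
    rw [wave, e2, Int.fract_one, mul_zero, Real.exp_zero, neg_mul, neg_neg, e1, min_eq_left,
      min_eq_right]
    · field_simp; ring
    · rw [div_le_iff₀ (by positivity), sub_mul, div_mul_eq_mul_div, le_sub_iff_add_le]
      have : z ^ 3 * (1 + z) * (z * (1 + z + z ^ 2)) / (1 + z + z ^ 2) = z ^ 4 * (1 + z) := by
        field_simp
      rw [this]
      have h2 : z ^ 3 < z := by nlinarith [mul_pos hz0 hz0]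
      have h3 : z ^ 4 < z ^ 2 := by nlinarith [mul_pos hz0 hz0, mul_pos (mul_pos hz0 hz0) hz0]
      have h4 : z ^ 5 < z ^ 3 := by nlinarith [mul_pos hz0 hz0, mul_pos (mul_pos hz0 hz0) hz0]
      nlinarith
    · have : 1 - 1 * (1 + z) / (1 + z + z ^ 2) = z ^ 2 / (1 + z + z ^ 2) := by field_simp; ring
      rw [this, div_le_div_iff₀ (by positivity) (by positivity)]
      have h2 : z ^ 3 < 1 := by nlinarith [mul_pos hz0 hz0]
      have : 0 < 1 + z + z ^ 2 := by positivity
      nlinarith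
  · have : Int.fract (t / (-3 * Real.log z)) = t / (-3 * Real.log z) :=
      Int.fract_eq_self.2 ⟨div_nonneg h0 (by linarith), (div_lt_one (by linarith)).2 h1⟩
    rw [wave, this]
    have : 3 * Real.log z * (t / (-3 * Real.log z)) = -t := by field_simp
    rw [this]

/-- In the definition of `wave`, the rising branch is the smaller one as long as `e ≥ z`. -/
theorem wave_min {e : ℝ} (hz0 : 0 < z) :
    1 - e * (1 + z) / (1 + z + z ^ 2) ≤ e / (z * (1 + z + z ^ 2)) ↔ z ≤ e := by
  have h : 0 < 1 + z + z ^ 2 := by positivity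
  have e1 : e / (z * (1 + z + z ^ 2)) - (1 - e * (1 + z) / (1 + z + z ^ 2)) = (e - z) / z := by
    field_simp; ring
  rw [← sub_nonneg, e1, ← sub_nonneg (b := z), le_div_iff₀ hz0, zero_mul]

theorem wave_rise (hz0 : 0 < z) (hz1 : z < 1) {t : ℝ} (h0 : 0 ≤ t) (h1 : t ≤ -Real.log z) :
    wave z t = 1 - Real.exp (-t) * (1 + z) / (1 + z + z ^ 2) := by
  rw [wave_eq hz0 hz1 h0 (by linarith [Real.log_neg hz0 hz1]), min_eq_left]
  rw [wave_min hz0, ← Real.log_le_iff_le_exp hz0]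
  linarith

theorem wave_fall (hz0 : 0 < z) (hz1 : z < 1) {t : ℝ} (h0 : -Real.log z ≤ t)
    (h1 : t ≤ -3 * Real.log z) :
    wave z t = Real.exp (-t) / (z * (1 + z + z ^ 2)) := by
  rw [wave_eq hz0 hz1 (by linarith [Real.log_neg hz0 hz1]) h1]
  rcases h0.eq_or_lt with rfl | h0
  · refine min_eq_right ?_
    rw [neg_neg, Real.exp_log hz0]
    have : 1 - z * (1 + z) / (1 + z + z ^ 2) = z / (z * (1 + z + z ^ 2)) := by field_simp; ring
    exact this.ge
  · rw [min_eq_right]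
    by_contra! hc
    have := (wave_min hz0).1 hc.le
    rw [← Real.log_le_iff_le_exp hz0] at this
    linarith

/-- Joint continuity in the ratio and the time; the jumps of the fractional part do no harm because
both ends of a period have the same value. -/
theorem continuousOn_wave : ContinuousOn (fun q : ℝ × ℝ => wave q.1 q.2) (Ioo 0 1 ×ˢ univ) := by
  rw [continuousOn_iff_continuous_domRestrict]
  have hlog : ∀ q : (Ioo (0 : ℝ) 1 ×ˢ (univ : Set ℝ) : Set (ℝ × ℝ)), Real.log q.1.1 < 0 := fun q =>
    Real.log_neg q.2.1.1 q.2.1.2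
  have hpos : ∀ q : (Ioo (0 : ℝ) 1 ×ˢ (univ : Set ℝ) : Set (ℝ × ℝ)), 0 < q.1.1 := fun q => q.2.1.1
  have hlt : ∀ q : (Ioo (0 : ℝ) 1 ×ˢ (univ : Set ℝ) : Set (ℝ × ℝ)), q.1.1 < 1 := fun q => q.2.1.2
  have hcl : Continuous fun q : (Ioo (0 : ℝ) 1 ×ˢ (univ : Set ℝ) : Set (ℝ × ℝ)) =>
      Real.log q.1.1 := by
    refine Continuous.log (by fun_prop) fun q => (hpos q).ne'
  have key := ContinuousOn.comp_fract
    (β := (Ioo (0 : ℝ) 1 ×ˢ (univ : Set ℝ) : Set (ℝ × ℝ))) (α := ℝ)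
    (s := fun q => q.1.2 / (-3 * Real.log q.1.1))
    (f := fun q r => min (1 - Real.exp (3 * Real.log q.1.1 * r) *
      (1 + q.1.1) / (1 + q.1.1 + q.1.1 ^ 2))
      (Real.exp (3 * Real.log q.1.1 * r) / (q.1.1 * (1 + q.1.1 + q.1.1 ^ 2)))) ?_ ?_ ?_
  · exact key
  · refine Continuous.continuousOn ?_
    have h1 : Continuous fun w : (Ioo (0 : ℝ) 1 ×ˢ (univ : Set ℝ) : Set (ℝ × ℝ)) × ℝ =>
      Real.log w.1.1.1 := hcl.comp continuous_fst
    refine Continuous.min ?_ ?_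
    · refine Continuous.sub continuous_const (Continuous.div (by fun_prop) (by fun_prop)
        fun w => ?_)
      have := hpos w.1
      positivity
    · refine Continuous.div (by fun_prop) (by fun_prop) fun w => ?_
      have := hpos w.1
      positivity
  · refine Continuous.div (by fun_prop) (by fun_prop) fun q => ?_
    have := hlog q
    nlinarith
  · intro q
    have h0 := wave_eq (hpos q) (hlt q) le_rfl (by linarith [hlog q])
    have h1 := wave_periodic (hpos q) (hlt q) 0
    rw [wave_eq (hpos q) (hlt q) (by linarith [hlog q]) (by linarith), h0] at h1
    simpa using h1.symm

variable (o β z) in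
/-- The periodic orbit with ratio `z`, started at the base point. All six weights are translates of
one function: the strategies of a player follow each other with a delay of a third of the period
`-3 * log z`, and A switches `log gain` after B. -/
noncomputable def orbit (t : ℝ) : State :=
  (fun i => wave z (t - Real.log (gain o β z) - Real.log z +
      ((o.step * i : Fin 3).val : ℝ) * Real.log z),
    fun j => wave z (t + ((o.step * (j - 1) : Fin 3).val : ℝ) * Real.log z))

theorem wA_orbit (m : Fin 3) (t : ℝ) : wA o m (orbit o β z t) =
    wave z (t - Real.log (gain o β z) - Real.log z + (m.val : ℝ) * Real.log z) := by
  simp only [wA, orbit, ← mul_assoc]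
  rw [show o.step * o.step = 1 by cases o <;> rfl, one_mul]

theorem wB_orbit (m : Fin 3) (t : ℝ) : wB o m (orbit o β z t) =
    wave z (t + (m.val : ℝ) * Real.log z) := by
  simp only [wB, orbit, add_sub_cancel_left, ← mul_assoc]
  rw [show o.step * o.step = 1 by cases o <;> rfl, one_mul]

namespace IsRatio

theorem wave_add_three (h : IsRatio o β z) (t : ℝ) :
    wave z (t + 3 * Real.log z) = wave z t := by
  rw [← wave_periodic h.pos h.lt_one (t + 3 * Real.log z), add_sub_cancel_right]

/-- A relabelling of the strategies is a shift of the orbit by a third of its period. -/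
theorem turn_orbit (h : IsRatio o β z) (t : ℝ) :
    turn o (orbit o β z (t - Real.log z)) = orbit o β z t := by
  refine state_ext (o := o) (fun m => ?_) (fun m => ?_)
  · rw [wA_turn, wA_orbit, wA_orbit]
    fin_cases m
    · simp; congr 1; ring
    · simp; congr 1; ring
    · simp
      rw [← h.wave_add_three]; congr 1; ring
  · rw [wB_turn, wB_orbit, wB_orbit]
    fin_cases m
    · simp
    · simp; congr 1; ring
    · simp
      rw [← h.wave_add_three]; congr 1; ring

theorem orbit_periodic (h : IsRatio o β z) (t : ℝ) :
    orbit o β z (t + -3 * Real.log z) = orbit o β z t := by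
  rw [← turn_turn_turn (o := o) (orbit o β z (t + -3 * Real.log z)),
    show t + -3 * Real.log z = t - Real.log z - Real.log z - Real.log z by ring, h.turn_orbit,
    h.turn_orbit, h.turn_orbit]

theorem log_gain_pos (h : IsRatio o β z) : 0 < Real.log (gain o β z) := Real.log_pos h.one_lt_gain

theorem log_gain_lt (h : IsRatio o β z) : Real.log (gain o β z) < -Real.log z := by
  rw [← Real.log_inv, ← one_div]
  exact Real.log_lt_log h.gain_pos h.gain_lt

theorem log_neg (h : IsRatio o β z) : Real.log z < 0 := Real.log_neg h.pos h.lt_one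

theorem orbit_eq_first (h : IsRatio o β z) {t : ℝ} (h0 : 0 ≤ t)
    (h1 : t ≤ Real.log (gain o β z)) :
    orbit o β z t = go o 0 0 (base o β z) (Real.exp t - 1) := by
  have hl := h.log_neg
  have hg := h.log_gain_lt
  have hq := h.quad_pos.ne'
  have hz := h.pos.ne'
  have hy := h.frac_pos.ne'
  have he : Real.exp (Real.log (gain o β z)) = gain o β z := Real.exp_log h.gain_pos
  have hez : Real.exp (Real.log z) = z := Real.exp_log h.pos
  have het := (Real.exp_pos t).ne'
  refine state_ext (o := o) (fun m => ?_) (fun m => ?_)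
  · rw [wA_orbit, wA_go, base, wA_pt]
    fin_cases m
    · simp
      rw [wave_rise h.pos h.lt_one (by linarith) (by linarith),
        show -(t - Real.log (gain o β z) - Real.log z) =
          -t + Real.log (gain o β z) + Real.log z by ring,
        Real.exp_add, Real.exp_add, he, hez, Real.exp_neg, gain]
      field_simp
      ring
    · simp
      rw [← wave_periodic h.pos h.lt_one,
        wave_fall h.pos h.lt_one (by linarith) (by linarith),
        show -(t - Real.log (gain o β z) - 3 * Real.log z) = -t + Real.log (gain o β z) +
          Real.log z + Real.log z + Real.log z by ring,
        Real.exp_add, Real.exp_add, Real.exp_add, Real.exp_add, he, hez, Real.exp_neg, gain]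
      field_simp
    · simp
      rw [← wave_periodic h.pos h.lt_one,
        wave_fall h.pos h.lt_one (by linarith) (by linarith),
        show -(t - Real.log (gain o β z) - Real.log z + 2 * Real.log z - 3 * Real.log z) =
          -t + Real.log (gain o β z) + Real.log z + Real.log z by ring,
        Real.exp_add, Real.exp_add, Real.exp_add, he, hez, Real.exp_neg, gain]
      field_simp
  · rw [wB_orbit, wB_go, base, wB_pt]
    fin_cases m
    · simp
      rw [wave_rise h.pos h.lt_one (by linarith) (by linarith), Real.exp_neg]
      field_simp
      ring
    · simp
      rw [← wave_periodic h.pos h.lt_one,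
        wave_fall h.pos h.lt_one (by linarith) (by linarith),
        show -(t + Real.log z - 3 * Real.log z) = -t + Real.log z + Real.log z by ring,
        Real.exp_add, Real.exp_add, hez, Real.exp_neg]
      field_simp
    · simp
      rw [← wave_periodic h.pos h.lt_one,
        wave_fall h.pos h.lt_one (by linarith) (by linarith),
        show -(t + 2 * Real.log z - 3 * Real.log z) = -t + Real.log z by ring,
        Real.exp_add, hez, Real.exp_neg]
      field_simp

theorem orbit_eq_second (h : IsRatio o β z) {t : ℝ} (h0 : Real.log (gain o β z) ≤ t)
    (h1 : t ≤ -Real.log z) :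
    orbit o β z t = go o 1 0 (mid o β z) (Real.exp (t - Real.log (gain o β z)) - 1) := by
  have hl := h.log_neg
  have hg := h.log_gain_lt
  have hg0 := h.log_gain_pos
  have hq := h.quad_pos.ne'
  have hz := h.pos.ne'
  have hy := h.frac_pos.ne'
  have hgn := h.gain_pos.ne'
  have he : Real.exp (Real.log (gain o β z)) = gain o β z := Real.exp_log h.gain_pos
  have hez : Real.exp (Real.log z) = z := Real.exp_log h.pos
  have het := (Real.exp_pos t).ne'
  refine state_ext (o := o) (fun m => ?_) (fun m => ?_)
  · rw [wA_orbit, wA_go, mid, wA_go, base, wA_pt]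
    fin_cases m
    · simp
      rw [wave_fall h.pos h.lt_one (by linarith) (by linarith),
        show -(t - Real.log (gain o β z) - Real.log z) =
          -t + Real.log (gain o β z) + Real.log z by ring,
        Real.exp_add, Real.exp_add, he, hez, Real.exp_neg, Real.exp_sub, he, gain]
      field_simp
      ring
    · simp
      rw [wave_rise h.pos h.lt_one (by linarith) (by linarith),
        show -(t - Real.log (gain o β z)) = -t + Real.log (gain o β z) by ring,
        Real.exp_add, he, Real.exp_neg, Real.exp_sub, he, gain]
      field_simp
      ring
    · simp
      rw [← wave_periodic h.pos h.lt_one,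
        wave_fall h.pos h.lt_one (by linarith) (by linarith),
        show -(t - Real.log (gain o β z) - Real.log z + 2 * Real.log z - 3 * Real.log z) =
          -t + Real.log (gain o β z) + Real.log z + Real.log z by ring,
        Real.exp_add, Real.exp_add, Real.exp_add, he, hez, Real.exp_neg, Real.exp_sub, he, gain]
      field_simp
  · rw [wB_orbit, wB_go, mid, wB_go, base, wB_pt]
    fin_cases m
    · simp
      rw [wave_rise h.pos h.lt_one (by linarith) (by linarith), Real.exp_neg, Real.exp_sub, he]
      field_simp
      ring
    · simp
      rw [← wave_periodic h.pos h.lt_one,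
        wave_fall h.pos h.lt_one (by linarith) (by linarith),
        show -(t + Real.log z - 3 * Real.log z) = -t + Real.log z + Real.log z by ring,
        Real.exp_add, Real.exp_add, hez, Real.exp_neg, Real.exp_sub, he]
      field_simp
    · simp
      rw [← wave_periodic h.pos h.lt_one,
        wave_fall h.pos h.lt_one (by linarith) (by linarith),
        show -(t + 2 * Real.log z - 3 * Real.log z) = -t + Real.log z by ring,
        Real.exp_add, hez, Real.exp_neg, Real.exp_sub, he]
      field_simp

theorem zone_first (h : IsRatio o β z) :
    ∀ ε ∈ Ioo 0 (gain o β z - 1), go o 0 0 (base o β z) ε ∈ zone o β 0 0 := by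
  refine go_mem_zone_zero h.α₁_pos h.c₁_lt h.base_mem h.waitA_base.ge h.uA_two_lt h.uA_two_lt'.le
    h.uB_two_eq.le h.uB_one_lt ?_
  nlinarith [h.uB_one_lt, h.c₂_lt, h.one_lt_gain]

theorem wait_second_pos (h : IsRatio o β z) : 0 < 1 / z / gain o β z - 1 := by
  rw [sub_pos, lt_div_iff₀ h.gain_pos, one_mul]
  exact h.gain_lt

theorem zone_second (h : IsRatio o β z) :
    ∀ ε ∈ Ioo 0 (1 / z / gain o β z - 1), go o 1 0 (mid o β z) ε ∈ zone o β 1 0 := by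
  have hp : 0 < 1 + (1 / z / gain o β z - 1) := by linarith [h.wait_second_pos]
  obtain ⟨-, a1, a2⟩ := uA_go_zero (o := o) (β := β) 1 (mid o β z) (1 / z / gain o β z - 1)
  obtain ⟨b0, -, b2⟩ := uB_go_one (o := o) (β := β) 0 (mid o β z) (1 / z / gain o β z - 1)
  have h1 := h.uA_endPt.2
  have h2 := h.uB_endPt.2
  rw [endPt] at h1 h2
  rw [a1, a2, div_lt_div_iff_of_pos_right hp] at h1
  rw [b0, b2, div_lt_div_iff_of_pos_right hp] at h2
  exact go_mem_zone_one h.α₁_pos h.c₁_lt h.mid_mem h.waitB_mid.ge h.uB_mid.2 h2.le h.uA_mid.1.ge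
    (h.uA_mid.1 ▸ h.uA_mid.2) h1.le

theorem orbit_mem_zone_first (h : IsRatio o β z) {t : ℝ} (ht : t ∈ Ioo 0 (Real.log (gain o β z))) :
    orbit o β z t ∈ zone o β 0 0 := by
  rw [h.orbit_eq_first ht.1.le ht.2.le]
  refine h.zone_first _ ⟨by simpa using ht.1, ?_⟩
  have := (Real.lt_log_iff_exp_lt h.gain_pos).1 ht.2
  linarith

theorem orbit_mem_zone_second (h : IsRatio o β z) {t : ℝ}
    (ht : t ∈ Ioo (Real.log (gain o β z)) (-Real.log z)) : orbit o β z t ∈ zone o β 1 0 := by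
  rw [h.orbit_eq_second ht.1.le ht.2.le]
  refine h.zone_second _ ⟨by simpa using ht.1, ?_⟩
  rw [Real.exp_sub, Real.exp_log h.gain_pos, sub_lt_sub_iff_right]
  refine div_lt_div_of_pos_right ?_ h.gain_pos
  rw [← Real.lt_log_iff_exp_lt (by have := h.pos; positivity), one_div, Real.log_inv]
  exact ht.2

theorem orbit_zero (h : IsRatio o β z) : orbit o β z 0 = base o β z := by
  rw [h.orbit_eq_first le_rfl h.log_gain_pos.le]; simp [go_zero]

theorem continuous_orbit (h : IsRatio o β z) : Continuous (orbit o β z) := by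
  have h1 : Continuous (wave z) := by
    have := continuousOn_wave.comp_continuous (f := fun t : ℝ => (z, t)) (by fun_prop)
      fun t => ⟨⟨h.pos, h.lt_one⟩, mem_univ _⟩
    exact this
  unfold orbit
  fun_prop

end IsRatio

end ShapleyGame

namespace ShapleyGame

/-! ### The orbit as a periodic solution -/

variable {o : Orient} {β z : ℝ}

theorem ofNat_succ (n : ℕ) : Fin.ofNat 3 (n + 1) = Fin.ofNat 3 n + 1 := by
  simp [Fin.ext_iff, Fin.val_add]

namespace IsRatio

theorem isSolutionOn_first (h : IsRatio o β z) :
    IsSolutionOn β (Icc 0 (Real.log (gain o β z))) (orbit o β z) := by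
  have h1 := isSolutionOn_toward (by linarith [h.one_lt_gain]) h.base_mem h.zone_first
  rw [add_sub_cancel] at h1
  exact h1.congr_Icc fun t ht => h.orbit_eq_first ht.1 ht.2

theorem log_second (h : IsRatio o β z) :
    Real.log (1 / z / gain o β z) = -Real.log z - Real.log (gain o β z) := by
  have := h.pos
  rw [Real.log_div (by positivity) h.gain_pos.ne', one_div, Real.log_inv]

theorem isSolutionOn_second (h : IsRatio o β z) :
    IsSolutionOn β (Icc (Real.log (gain o β z)) (-Real.log z)) (orbit o β z) := by
  have h1 := isSolutionOn_toward h.wait_second_pos.le h.mid_mem h.zone_second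
  rw [add_sub_cancel, h.log_second] at h1
  have h2 := h1.comp_add (J := Icc (Real.log (gain o β z)) (-Real.log z))
    (-Real.log (gain o β z)) measurableSet_Icc measurableSet_Icc
    fun t ht => ⟨by linarith [ht.1], by linarith [ht.2]⟩
  exact h2.congr_Icc fun t ht => h.orbit_eq_second ht.1 ht.2

theorem isSolutionOn_third (h : IsRatio o β z) :
    IsSolutionOn β (Icc 0 (-Real.log z)) (orbit o β z) :=
  h.isSolutionOn_first.union_Icc h.isSolutionOn_second

theorem lipschitz_third (h : IsRatio o β z) :
    LipschitzOnWith 1 (orbit o β z) (Icc 0 (-Real.log z)) := by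
  refine LipschitzOnWith.union_Icc (b := Real.log (gain o β z)) ?_ ?_
  · refine LipschitzOnWith.of_dist_le_mul fun x hx y hy => ?_
    rw [h.orbit_eq_first hx.1 hx.2, h.orbit_eq_first hy.1 hy.2]
    exact (lipschitzOnWith_toward _ _ h.base_mem).dist_le_mul x hx.1 y hy.1
  · refine LipschitzOnWith.of_dist_le_mul fun x hx y hy => ?_
    rw [h.orbit_eq_second hx.1 hx.2, h.orbit_eq_second hy.1 hy.2]
    have := (lipschitzOnWith_toward (o.step * 1) (1 + o.step * 0) h.mid_mem).dist_le_mul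
      (x - Real.log (gain o β z)) (sub_nonneg.2 hx.1) (y - Real.log (gain o β z))
      (sub_nonneg.2 hy.1)
    rwa [dist_sub_right] at this

theorem orbit_add_log (h : IsRatio o β z) (t : ℝ) :
    turn o (orbit o β z t) = orbit o β z (t + Real.log z) := by
  rw [← h.turn_orbit (t + Real.log z), add_sub_cancel_right]

/-- A property of intervals that is inherited along thirds of a period. -/
theorem int_induction {P : ℝ → ℝ → Prop} (h0 : P 0 (-Real.log z))
    (h1 : ∀ a b, P a b → P (a - Real.log z) (b - Real.log z))
    (h2 : ∀ a b, P a b → P (a + Real.log z) (b + Real.log z)) (n : ℤ) :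
    P (n * -Real.log z) ((n + 1) * -Real.log z) := by
  induction n using Int.induction_on with
  | zero => simpa using h0
  | succ n ih =>
    convert h1 _ _ ih using 1 <;> push_cast <;> ring
  | pred n ih =>
    convert h2 _ _ ih using 1 <;> push_cast <;> ring

theorem isSolutionOn_int (h : IsRatio o β z) (n : ℤ) :
    IsSolutionOn β (Icc (n * -Real.log z) ((n + 1) * -Real.log z)) (orbit o β z) := by
  refine int_induction (P := fun a b => IsSolutionOn β (Icc a b) (orbit o β z))
    h.isSolutionOn_third (fun a b hab => ?_) (fun a b hab => ?_) n
  · have h3 := hab.comp_add (J := Icc (a - Real.log z) (b - Real.log z)) (Real.log z)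
      measurableSet_Icc measurableSet_Icc fun t ht => ⟨by linarith [ht.1], by linarith [ht.2]⟩
    have h4 := (h3.turn (o := o)).turn (o := o)
    refine h4.congr_Icc fun t _ => ?_
    simp only [← h.orbit_add_log, turn_turn_turn]
  · have h3 := hab.comp_add (J := Icc (a + Real.log z) (b + Real.log z)) (-Real.log z)
      measurableSet_Icc measurableSet_Icc fun t ht => ⟨by linarith [ht.1], by linarith [ht.2]⟩
    refine (h3.turn (o := o)).congr_Icc fun t _ => ?_
    exact (h.turn_orbit t).symm

theorem lipschitz_int (h : IsRatio o β z) (n : ℤ) :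
    LipschitzOnWith 1 (orbit o β z) (Icc (n * -Real.log z) ((n + 1) * -Real.log z)) := by
  refine int_induction (P := fun a b => LipschitzOnWith 1 (orbit o β z) (Icc a b))
    h.lipschitz_third (fun a b hab => ?_) (fun a b hab => ?_) n
  · refine LipschitzOnWith.of_dist_le_mul fun x hx y hy => ?_
    have := hab.dist_le_mul (x + Real.log z) ⟨by linarith [hx.1], by linarith [hx.2]⟩
      (y + Real.log z) ⟨by linarith [hy.1], by linarith [hy.2]⟩
    rwa [← h.orbit_add_log, ← h.orbit_add_log, dist_turn, dist_add_right] at this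
  · refine LipschitzOnWith.of_dist_le_mul fun x hx y hy => ?_
    have := hab.dist_le_mul (x - Real.log z) ⟨by linarith [hx.1], by linarith [hx.2]⟩
      (y - Real.log z) ⟨by linarith [hy.1], by linarith [hy.2]⟩
    rwa [← dist_turn (o := o), h.turn_orbit, h.turn_orbit, dist_sub_right] at this

theorem lipschitz (h : IsRatio o β z) : LipschitzWith 1 (orbit o β z) := by
  have hτ : 0 < -Real.log z := by linarith [h.log_neg]
  have key (a : ℤ) (n : ℕ) :
      LipschitzOnWith 1 (orbit o β z) (Icc (a * -Real.log z) ((a + (n + 1)) * -Real.log z)) := by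
    induction n with
    | zero => simpa using h.lipschitz_int a
    | succ n ih =>
      have := h.lipschitz_int (a + (n + 1))
      push_cast at this ⊢
      rw [← add_assoc] at this
      have h2 := ih.union_Icc (c := (a + n + 1 + 1) * -Real.log z) (by
        rwa [← add_assoc])
      rwa [← add_assoc, ← add_assoc]
  refine LipschitzWith.of_dist_le_mul fun x y => ?_
  wlog hxy : x ≤ y generalizing x y
  · rw [dist_comm, dist_comm x]
    exact this y x (le_of_not_ge hxy)
  have hx := Int.floor_le (x / -Real.log z)
  have hy := Nat.lt_floor_add_one (y / -Real.log z - ⌊x / -Real.log z⌋)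
  have hx' : ⌊x / -Real.log z⌋ * -Real.log z ≤ x := (le_div_iff₀ hτ).1 hx
  have hy' : y ≤ (⌊x / -Real.log z⌋ + (⌊y / -Real.log z - ⌊x / -Real.log z⌋⌋₊ + 1)) *
      -Real.log z := by
    rw [← div_le_iff₀ hτ]; linarith
  exact (key _ _).dist_le_mul x ⟨hx', hxy.trans hy'⟩ y ⟨hx'.trans hxy, hy'⟩

theorem isPeriodicSolution (h : IsRatio o β z) :
    IsPeriodicSolution β (orbit o β z) (-3 * Real.log z) := by
  have hτ : 0 < -Real.log z := by linarith [h.log_neg]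
  have hex (t : ℝ) : ∃ n : ℤ, t ∈ Icc (n * -Real.log z) ((n + 1) * -Real.log z) :=
    ⟨⌊t / -Real.log z⌋, (le_div_iff₀ hτ).1 (Int.floor_le _),
      ((div_lt_iff₀ hτ).1 (Int.lt_floor_add_one _)).le⟩
  refine ⟨by linarith, ⟨fun t _ => ?_, ⟨1, h.lipschitz.lipschitzOnWith⟩, ?_⟩, h.orbit_periodic⟩
  · obtain ⟨n, hn⟩ := hex t
    exact (h.isSolutionOn_int n).1 t hn
  · rw [Measure.restrict_univ]
    have h1 := ae_all_iff.2 fun n : ℤ =>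
      (ae_restrict_iff' measurableSet_Icc).1 (h.isSolutionOn_int n).2.2
    filter_upwards [h1] with t ht
    obtain ⟨n, hn⟩ := hex t
    exact ht n hn

theorem orbit_mem_zone_add (h : IsRatio o β z) {t : ℝ} {m k : Fin 3}
    (ht : orbit o β z t ∈ zone o β m k) :
    orbit o β z (t - Real.log z) ∈ zone o β (m + 1) (k + 1) := by
  rw [← turn_mem_zone, h.turn_orbit]
  exact ht

theorem orbit_mem_zone_even (h : IsRatio o β z) (n : ℕ) {t : ℝ}
    (ht : t ∈ Ioo (n * -Real.log z) (n * -Real.log z + Real.log (gain o β z))) :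
    orbit o β z t ∈ zone o β (Fin.ofNat 3 n) (Fin.ofNat 3 n) := by
  induction n generalizing t with
  | zero => exact h.orbit_mem_zone_first (by simpa using ht)
  | succ n ih =>
    have := h.orbit_mem_zone_add (ih (t := t + Real.log z) (by
      push_cast at ht; exact ⟨by linarith [ht.1], by linarith [ht.2]⟩))
    rw [add_sub_cancel_right, ← ofNat_succ] at this
    exact this

theorem orbit_mem_zone_odd (h : IsRatio o β z) (n : ℕ) {t : ℝ}
    (ht : t ∈ Ioo (n * -Real.log z + Real.log (gain o β z)) ((n + 1) * -Real.log z)) :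
    orbit o β z t ∈ zone o β (Fin.ofNat 3 n + 1) (Fin.ofNat 3 n) := by
  induction n generalizing t with
  | zero => exact h.orbit_mem_zone_second (by simpa using ht)
  | succ n ih =>
    have := h.orbit_mem_zone_add (ih (t := t + Real.log z) (by
      push_cast at ht; exact ⟨by linarith [ht.1], by linarith [ht.2]⟩))
    rw [add_sub_cancel_right, ← ofNat_succ] at this
    exact this

theorem turn_image_range (h : IsRatio o β z) :
    turn o '' range (orbit o β z) = range (orbit o β z) := by
  ext x
  constructor
  · rintro ⟨_, ⟨t, rfl⟩, rfl⟩
    exact ⟨t + Real.log z, (h.orbit_add_log t).symm⟩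
  · rintro ⟨t, rfl⟩
    exact ⟨_, ⟨t - Real.log z, rfl⟩, h.turn_orbit t⟩

theorem isSymmetric (h : IsRatio o β z) : IsSymmetric (range (orbit o β z)) := by
  have h1 := h.turn_image_range
  rw [IsSymmetric]
  cases o
  · exact h1
  · have h2 : rot = turn .acw ∘ turn .acw := by
      funext x
      refine Prod.ext (funext fun i => ?_) (funext fun i => ?_) <;>
        simp [rot, turn, Orient.step, add_assoc]
    rw [h2, image_comp, h1, h1]

theorem segment_first_subset (h : IsRatio o β z) :
    segment ℝ (base o β z) (mid o β z) ⊆ range (orbit o β z) := by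
  have hg := h.one_lt_gain
  rw [mid, go, ← image_toward_Icc _ _ _ (by linarith)]
  rintro _ ⟨ε, hε, rfl⟩
  have h0 : 0 < 1 + ε := by linarith [hε.1]
  refine ⟨Real.log (1 + ε), ?_⟩
  rw [h.orbit_eq_first (Real.log_nonneg (by linarith [hε.1]))
    (Real.log_le_log h0 (by linarith [hε.2])), Real.exp_log h0, add_sub_cancel_left]
  rfl

theorem segment_second_subset (h : IsRatio o β z) :
    segment ℝ (mid o β z) (endPt o β z) ⊆ range (orbit o β z) := by
  have hg := h.wait_second_pos
  rw [endPt, go, ← image_toward_Icc _ _ _ hg.le]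
  rintro _ ⟨ε, hε, rfl⟩
  have h0 : 0 < 1 + ε := by linarith [hε.1]
  refine ⟨Real.log (1 + ε) + Real.log (gain o β z), ?_⟩
  have h2 := Real.log_le_log h0 (by linarith [hε.2] : 1 + ε ≤ 1 / z / gain o β z)
  rw [h.log_second] at h2
  rw [h.orbit_eq_second (by linarith [Real.log_nonneg (by linarith [hε.1] : 1 ≤ 1 + ε)])
    (by linarith), add_sub_cancel_right, Real.exp_log h0, add_sub_cancel_left]
  rfl

/-- Up to relabelling, every point of the orbit lies on its first or its second leg. -/
theorem exists_turn_mem (h : IsRatio o β z) {y : State} (hy : y ∈ range (orbit o β z)) :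
    ∃ n : ℕ, (turn o)^[n] y ∈ segment ℝ (base o β z) (mid o β z) ∪
      segment ℝ (mid o β z) (endPt o β z) := by
  have hτ : 0 < -Real.log z := by linarith [h.log_neg]
  obtain ⟨t', rfl⟩ := hy
  obtain ⟨t, ht, e⟩ := Function.Periodic.exists_mem_Ico₀ h.orbit_periodic (by linarith) t'
  rw [e]
  have hit (n : ℕ) : (turn o)^[n] (orbit o β z t) = orbit o β z (t + n * Real.log z) := by
    induction n with
    | zero => simp
    | succ n ih =>
      rw [Function.iterate_succ_apply', ih, h.orbit_add_log]
      congr 1; push_cast; ring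
  refine ⟨⌊t / -Real.log z⌋₊, ?_⟩
  rw [hit]
  have h1 := Nat.floor_le (div_nonneg ht.1 hτ.le)
  have h2 := Nat.lt_floor_add_one (t / -Real.log z)
  rw [le_div_iff₀ hτ] at h1
  rw [div_lt_iff₀ hτ] at h2
  generalize (⌊t / -Real.log z⌋₊ : ℝ) = n at h1 h2
  have hlg := h.log_gain_pos
  rcases le_total (t + n * Real.log z) (Real.log (gain o β z)) with hc | hc
  · left
    rw [h.orbit_eq_first (by linarith) hc, mid, go, go,
      ← image_toward_Icc _ _ _ (by linarith [h.one_lt_gain])]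
    refine ⟨_, ⟨?_, ?_⟩, rfl⟩
    · rw [sub_nonneg, Real.one_le_exp_iff]; linarith
    · have := (Real.le_log_iff_exp_le h.gain_pos).1 hc
      linarith
  · right
    rw [h.orbit_eq_second hc (by linarith), endPt, go, go,
      ← image_toward_Icc _ _ _ h.wait_second_pos.le]
    refine ⟨_, ⟨?_, ?_⟩, rfl⟩
    · rw [sub_nonneg, Real.one_le_exp_iff]; linarith
    · have hz := h.pos
      rw [sub_le_sub_iff_right, ← Real.le_log_iff_exp_le (div_pos (by positivity) h.gain_pos),
        h.log_second]
      linarith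

end IsRatio

theorem IsRatio.isShapley {β z : ℝ} (h : IsRatio .cw β z) :
    IsShapley β (orbit .cw β z) (-3 * Real.log z) := by
  have h1 := h.log_gain_pos
  have h2 := h.log_gain_lt
  refine ⟨h.isPeriodicSolution, ![0, Real.log (gain .cw β z), -Real.log z,
    -Real.log z + Real.log (gain .cw β z), -2 * Real.log z, -2 * Real.log z +
      Real.log (gain .cw β z), -3 * Real.log z], ?_, by simp [Fin.last], ?_⟩
  · rw [Fin.strictMono_iff_lt_succ]
    intro k
    fin_cases k <;> simp <;> linarith
  · intro k s hs
    fin_cases k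
    · exact h.orbit_mem_zone_even 0 (by simpa using hs)
    · exact h.orbit_mem_zone_odd 0 (by simpa using hs)
    · exact h.orbit_mem_zone_even 1 (by simpa using hs)
    · refine h.orbit_mem_zone_odd 1 ?_
      simp at hs ⊢
      exact ⟨by linarith [hs.1], by linarith [hs.2]⟩
    · refine h.orbit_mem_zone_even 2 ?_
      simp at hs ⊢
      exact ⟨by linarith [hs.1], by linarith [hs.2]⟩
    · refine h.orbit_mem_zone_odd 2 ?_
      simp at hs ⊢
      exact ⟨by linarith [hs.1], by linarith [hs.2]⟩

theorem IsRatio.isAntiShapley {β z : ℝ} (h : IsRatio .acw β z) :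
    IsAntiShapley β (orbit .acw β z) (-3 * Real.log z) := by
  have h1 := h.log_gain_pos
  have h2 := h.log_gain_lt
  refine ⟨h.isPeriodicSolution, ![-2 * Real.log z + Real.log (gain .acw β z), -3 * Real.log z,
    -3 * Real.log z + Real.log (gain .acw β z), -4 * Real.log z,
    -4 * Real.log z + Real.log (gain .acw β z), -5 * Real.log z, -5 * Real.log z +
      Real.log (gain .acw β z)], ?_, by simp [Fin.last]; ring, ?_⟩
  · rw [Fin.strictMono_iff_lt_succ]
    intro k
    fin_cases k <;> simp <;> linarith
  · intro k s hs
    fin_cases k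
    · refine h.orbit_mem_zone_odd 2 ?_
      simp at hs ⊢
      exact ⟨by linarith [hs.1], by linarith [hs.2]⟩
    · refine h.orbit_mem_zone_even 3 ?_
      simp at hs ⊢
      exact ⟨by linarith [hs.1], by linarith [hs.2]⟩
    · refine h.orbit_mem_zone_odd 3 ?_
      simp at hs ⊢
      exact ⟨by linarith [hs.1], by linarith [hs.2]⟩
    · refine h.orbit_mem_zone_even 4 ?_
      simp at hs ⊢
      exact ⟨by linarith [hs.1], by linarith [hs.2]⟩
    · refine h.orbit_mem_zone_odd 4 ?_
      simp at hs ⊢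
      exact ⟨by linarith [hs.1], by linarith [hs.2]⟩
    · refine h.orbit_mem_zone_even 5 ?_
      simp at hs ⊢
      exact ⟨by linarith [hs.1], by linarith [hs.2]⟩

end ShapleyGame

namespace ShapleyGame

/-! ### Stable linear recurrences -/

/-- A stable linear recurrence of first order maps summable right-hand sides to summable solutions.
-/
theorem sum_norm_le_of_recurrence {a b : ℕ → ℂ} {r : ℂ} {B : ℝ} (hr : ‖r‖ < 1)
    (h : ∀ n, a (n + 1) = r * a n + b n) (hb : ∀ N, ∑ n ∈ Finset.range N, ‖b n‖ ≤ B) (N : ℕ) :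
    ∑ n ∈ Finset.range N, ‖a n‖ ≤ (‖a 0‖ + B) / (1 - ‖r‖) := by
  have h1 : 0 < 1 - ‖r‖ := by linarith
  have h2 : ∑ n ∈ Finset.range (N + 1), ‖a n‖ ≤
      ‖r‖ * ∑ n ∈ Finset.range N, ‖a n‖ + B + ‖a 0‖ := by
    rw [Finset.sum_range_succ', Finset.mul_sum]
    have h3 : ∑ n ∈ Finset.range N, ‖a (n + 1)‖ ≤
        ∑ n ∈ Finset.range N, (‖r‖ * ‖a n‖ + ‖b n‖) := Finset.sum_le_sum fun n _ => by
      rw [h, ← norm_mul]; exact norm_add_le _ _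
    rw [Finset.sum_add_distrib] at h3
    linarith [hb N]
  have h4 : ∑ n ∈ Finset.range N, ‖a n‖ ≤ ∑ n ∈ Finset.range (N + 1), ‖a n‖ := by
    rw [Finset.sum_range_succ]; linarith [norm_nonneg (a N)]
  rw [le_div_iff₀ h1]
  linarith

/-- Jury's criterion for a real quadratic polynomial. -/
theorem exists_roots_in_disc {S P : ℝ} (hP : P < 1) (hS : |S| < 1 + P) :
    ∃ r₁ r₂ : ℂ, r₁ + r₂ = S ∧ r₁ * r₂ = P ∧ ‖r₁‖ < 1 ∧ ‖r₂‖ < 1 := by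
  have hS2 := abs_lt.1 hS
  rcases le_total 0 (S ^ 2 - 4 * P) with hD | hD
  · set d := Real.sqrt (S ^ 2 - 4 * P) with hd
    have hd2 : d ^ 2 = S ^ 2 - 4 * P := Real.sq_sqrt hD
    have hdlt : d < 2 - |S| := by
      rw [hd, Real.sqrt_lt' (by linarith)]
      nlinarith [sq_abs S]
    have hd0 : 0 ≤ d := Real.sqrt_nonneg _
    have hS3 := neg_abs_le S
    have hS4 := le_abs_self S
    refine ⟨((S + d) / 2 : ℝ), ((S - d) / 2 : ℝ), ?_, ?_, ?_, ?_⟩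
    · rw [← Complex.ofReal_add]; congr 1; ring
    · rw [← Complex.ofReal_mul]; congr 1; linear_combination -hd2 / 4
    · rw [Complex.norm_real, Real.norm_eq_abs, abs_lt]; constructor <;> linarith
    · rw [Complex.norm_real, Real.norm_eq_abs, abs_lt]; constructor <;> linarith
  · set d := Real.sqrt (4 * P - S ^ 2) with hd
    have hd2 : d ^ 2 = 4 * P - S ^ 2 := Real.sq_sqrt (by linarith)
    have hn : ∀ e : ℝ, e ^ 2 = 4 * P - S ^ 2 → ‖(⟨S / 2, e / 2⟩ : ℂ)‖ < 1 := fun e he => by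
      rw [← sq_lt_one_iff₀ (norm_nonneg _), Complex.sq_norm, Complex.normSq_mk]
      nlinarith
    refine ⟨⟨S / 2, d / 2⟩, ⟨S / 2, -d / 2⟩, ?_, ?_, hn _ hd2, hn _ (by linarith [neg_sq d])⟩
    · apply Complex.ext <;> simp; ring
    · apply Complex.ext <;> simp
      · linear_combination hd2 / 4
      · ring

/-- If the characteristic roots of a linear recurrence are `1`, `z` and the roots of
`X ^ 2 - S * X + P`, and all of these but `1` are in the open unit disc, then the solutions
converge, and their total variation is controlled by their initial variation. -/
theorem exists_variation_bound {z S P : ℝ} (hz : |z| < 1) (hP : P < 1) (hS : |S| < 1 + P) :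
    ∃ C : ℝ, 0 ≤ C ∧ ∀ a : ℕ → ℝ,
      (∀ n, (a (n + 4) - a (n + 3)) - z * (a (n + 3) - a (n + 2)) =
        S * ((a (n + 3) - a (n + 2)) - z * (a (n + 2) - a (n + 1))) -
        P * ((a (n + 2) - a (n + 1)) - z * (a (n + 1) - a n))) →
      (∀ n, |a n - a 0| ≤ C * (|a 1 - a 0| + |a 2 - a 1| + |a 3 - a 2|)) ∧
        ∃ l, Tendsto a atTop (𝓝 l) := by
  obtain ⟨r₁, r₂, hsum, hprod, h1, h2⟩ := exists_roots_in_disc hP hS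
  have hz0 := abs_nonneg z
  have e1 : 0 < 1 - ‖r₁‖ := by linarith
  have e2 : 0 < 1 - ‖r₂‖ := by linarith
  have e3 : 0 < 1 - |z| := by linarith
  set c₁ := 4 / (1 - ‖r₂‖) with hc₁
  set c₂ := (2 + c₁) / (1 - ‖r₁‖) with hc₂
  set c₃ := (1 + c₂) / (1 - |z|) with hc₃
  have p1 : 0 < c₁ := by positivity
  have p2 : 0 < c₂ := by positivity
  have p3 : 0 < c₃ := by positivity
  refine ⟨c₃, p3.le, fun a ha => ?_⟩
  set V := |a 1 - a 0| + |a 2 - a 1| + |a 3 - a 2| with hV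
  have hV0 : 0 ≤ V := by positivity
  set w : ℕ → ℝ := fun n => a (n + 1) - a n with hw
  set v : ℕ → ℝ := fun n => w (n + 1) - z * w n with hv
  set f : ℕ → ℂ := fun n => v (n + 1) - r₁ * v n with hf
  have hv0 : |v 0| ≤ 2 * V := by
    have := abs_sub (w 1) (z * w 0)
    rw [abs_mul] at this
    have h3 : |z| * |w 0| ≤ 1 * |w 0| := mul_le_mul_of_nonneg_right hz.le (abs_nonneg _)
    simp only [hw] at this h3 ⊢
    simp only [hv, hw, hV]
    norm_num at this h3 ⊢
    linarith [abs_nonneg (a 3 - a 2), abs_nonneg (a 2 - a 1), abs_nonneg (a 1 - a 0)]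
  have hv1 : |v 1| ≤ 2 * V := by
    have := abs_sub (w 2) (z * w 1)
    rw [abs_mul] at this
    have h3 : |z| * |w 1| ≤ 1 * |w 1| := mul_le_mul_of_nonneg_right hz.le (abs_nonneg _)
    simp only [hw] at this h3 ⊢
    simp only [hv, hw, hV]
    norm_num at this h3 ⊢
    linarith [abs_nonneg (a 3 - a 2), abs_nonneg (a 2 - a 1), abs_nonneg (a 1 - a 0)]
  have hf0 : ‖f 0‖ ≤ 4 * V := by
    have := norm_sub_le (v 1 : ℂ) (r₁ * v 0)
    rw [norm_mul, Complex.norm_real, Complex.norm_real, Real.norm_eq_abs, Real.norm_eq_abs] at this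
    have h3 : ‖r₁‖ * |v 0| ≤ 1 * |v 0| := mul_le_mul_of_nonneg_right h1.le (abs_nonneg _)
    simp only [hf]
    linarith
  have hfr : ∀ n, f (n + 1) = r₂ * f n + 0 := fun n => by
    have h3 : (v (n + 2) : ℂ) = (r₁ + r₂) * v (n + 1) - r₁ * r₂ * v n := by
      rw [hsum, hprod]
      exact_mod_cast ha n
    simp only [hf]
    rw [h3]; ring
  have b1 : ∀ N, ∑ n ∈ Finset.range N, ‖f n‖ ≤ c₁ * V := fun N => by
    refine (sum_norm_le_of_recurrence (B := 0) h2 hfr (by simp) N).trans ?_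
    rw [hc₁, div_mul_eq_mul_div]
    gcongr; linarith
  have b2 : ∀ N, ∑ n ∈ Finset.range N, ‖(v n : ℂ)‖ ≤ c₂ * V := fun N => by
    refine (sum_norm_le_of_recurrence h1 (fun n => ?_) b1 N).trans ?_
    · simp only [hf]; ring
    · rw [hc₂, div_mul_eq_mul_div (2 + c₁), Complex.norm_real, Real.norm_eq_abs]
      exact div_le_div_of_nonneg_right (by linarith) e1.le
  have b3 : ∀ N, ∑ n ∈ Finset.range N, ‖(w n : ℂ)‖ ≤ c₃ * V := fun N => by
    refine (sum_norm_le_of_recurrence (r := z) (by simpa using hz) (fun n => ?_) b2 N).trans ?_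
    · simp only [hv]; push_cast; ring
    · rw [hc₃, div_mul_eq_mul_div (1 + c₂), Complex.norm_real, Complex.norm_real, Real.norm_eq_abs,
        Real.norm_eq_abs]
      refine div_le_div_of_nonneg_right ?_ e3.le
      have : |w 0| ≤ V := by
        simp only [hw, hV]; norm_num
        linarith [abs_nonneg (a 3 - a 2), abs_nonneg (a 2 - a 1)]
      linarith
  have hsumw : ∀ n, ∑ i ∈ Finset.range n, w i = a n - a 0 := fun n => Finset.sum_range_sub a n
  constructor
  · intro n
    rw [← hsumw]
    refine (Finset.abs_sum_le_sum_abs _ _).trans ?_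
    simpa using b3 n
  · have hs : Summable fun n => ‖w n‖ :=
      summable_of_sum_range_le (c := c₃ * V) (fun n => norm_nonneg _) (by simpa using b3)
    have h3 := hs.of_norm.hasSum.tendsto_sum_nat
    simp only [hsumw] at h3
    exact ⟨_, by simpa using h3.add_const (a 0)⟩

end ShapleyGame

namespace ShapleyGame

/-! ### The transition map in homogeneous coordinates -/

variable {o : Orient} {β z : ℝ}

variable (o β) in
/-- The transition over one third of a revolution, followed by a relabelling, as a linear map of the
homogeneous coordinates `(u₁, u₂, y₁, y₂)` of states at which B switches from `2` to `0`. -/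
noncomputable def nextV (v : ℝ × ℝ × ℝ × ℝ) : ℝ × ℝ × ℝ × ℝ :=
  (nextU o β v.1 v.2.1 v.2.2.1 v.2.2.2, v.1, nextY o β v.1 v.2.1 v.2.2.1 v.2.2.2, v.2.2.1)

variable (o β) in
/-- A linear form on homogeneous coordinates which equals the homogenising coordinate if the state
belongs to the section, i.e. if B is indifferent between `2` and `0`. -/
noncomputable def height (v : ℝ × ℝ × ℝ × ℝ) : ℝ :=
  ((2 - o.c₁ β - o.c₂ β) * v.2.2.1 + (1 - 2 * o.c₁ β + o.c₂ β) * v.2.2.2) / (1 - o.c₁ β)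

variable (o β) in
/-- The state with given homogeneous coordinates. -/
noncomputable def point (v : ℝ × ℝ × ℝ × ℝ) : State :=
  pt o (v.1 / height o β v) (v.2.1 / height o β v) (v.2.2.1 / height o β v)
    (v.2.2.2 / height o β v)

variable (o β z) in
/-- The coordinates of the base point, an eigenvector of `nextV` with eigenvalue `1 / z`. -/
noncomputable def baseV : ℝ × ℝ × ℝ × ℝ :=
  (1 / (1 + z + z ^ 2), z / (1 + z + z ^ 2), frac o β z, z * frac o β z)

theorem continuous_nextV : Continuous (nextV o β) := by
  unfold nextV nextU nextH nextY nextG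
  fun_prop

theorem continuous_height : Continuous (height o β) := by
  unfold height
  fun_prop

theorem continuous_pt : Continuous fun v : ℝ × ℝ × ℝ × ℝ => pt o v.1 v.2.1 v.2.2.1 v.2.2.2 := by
  unfold pt
  refine Continuous.prodMk (continuous_pi fun i => ?_) (continuous_pi fun i => ?_)
  · generalize o.step * i = k
    fin_cases k <;> simp <;> fun_prop
  · generalize o.step * (i - 1) = k
    fin_cases k <;> simp <;> fun_prop

theorem height_smul (c : ℝ) (v : ℝ × ℝ × ℝ × ℝ) : height o β (c • v) = c * height o β v := by
  simp only [height, Prod.smul_fst, Prod.smul_snd, smul_eq_mul]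
  ring

theorem point_smul {c : ℝ} (hc : c ≠ 0) (v : ℝ × ℝ × ℝ × ℝ) : point o β (c • v) = point o β v := by
  simp only [point, height_smul, Prod.smul_fst, Prod.smul_snd, smul_eq_mul,
    mul_div_mul_left _ _ hc]

theorem nextV_smul (c : ℝ) (v : ℝ × ℝ × ℝ × ℝ) : nextV o β (c • v) = c • nextV o β v := by
  simp only [nextV, nextU, nextH, nextY, nextG, Prod.smul_fst, Prod.smul_snd, smul_eq_mul,
    Prod.smul_mk]
  ext <;> simp <;> ring

theorem height_nextV (v : ℝ × ℝ × ℝ × ℝ) :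
    height o β (nextV o β v) = nextH o β v.1 v.2.1 v.2.2.1 v.2.2.2 := rfl

namespace IsRatio

theorem nextV_baseV (h : IsRatio o β z) : nextV o β (baseV o β z) = z⁻¹ • baseV o β z := by
  have hz := h.pos.ne'
  simp only [nextV, baseV, h.nextU_eq, h.nextY_eq, Prod.smul_mk, smul_eq_mul]
  ext <;> simp <;> field_simp

theorem height_baseV (h : IsRatio o β z) : height o β (baseV o β z) = 1 := by
  have hc : 1 - o.c₁ β ≠ 0 := by linarith [h.c₁_lt]
  have h4 := h.frac_mul
  rw [denA] at h4
  rw [height, div_eq_one_iff_eq hc, baseV]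
  linear_combination h4

theorem point_baseV (h : IsRatio o β z) : point o β (baseV o β z) = base o β z := by
  simp only [point, h.height_baseV, div_one]
  rfl

theorem continuousAt_point {v : ℝ × ℝ × ℝ × ℝ} (hv : height o β v ≠ 0) :
    ContinuousAt (point o β) v := by
  have h1 : ContinuousAt (fun v : ℝ × ℝ × ℝ × ℝ => (v.1 / height o β v, v.2.1 / height o β v,
      v.2.2.1 / height o β v, v.2.2.2 / height o β v)) v := by
    have := continuous_height.continuousAt (x := v) (f := height o β)
    refine ContinuousAt.prodMk (ContinuousAt.div (by fun_prop) this hv) (ContinuousAt.prodMk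
      (ContinuousAt.div (by fun_prop) this hv) (ContinuousAt.prodMk
      (ContinuousAt.div (by fun_prop) this hv) (ContinuousAt.div (by fun_prop) this hv)))
  exact continuous_pt.continuousAt.comp h1

end IsRatio

variable (o β z) in
/-- The iterates of `nextV`, normalised by powers of `z` so that the base point is fixed. -/
noncomputable def scaled (v : ℝ × ℝ × ℝ × ℝ) (n : ℕ) : ℝ × ℝ × ℝ × ℝ :=
  (fun v => z • nextV o β v)^[n] v

theorem scaled_succ (v : ℝ × ℝ × ℝ × ℝ) (n : ℕ) :
    scaled o β z v (n + 1) = z • nextV o β (scaled o β z v n) :=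
  Function.iterate_succ_apply' _ _ _

theorem continuous_scaled (n : ℕ) : Continuous fun v => scaled o β z v n := by
  unfold scaled
  refine Continuous.iterate ?_ n
  exact continuous_nextV.const_smul z

variable (o β z) in
/-- The sum of the two eigenvalues of `z • nextV` other than `1` and `z`; their product is `z ^ 3`.
-/
noncomputable def slope : ℝ := -z ^ 2 * (3 - (1 - 2 * o.c₁ β + o.c₂ β) * (o.α₁ β + o.α₂ β) /
    ((1 - o.c₁ β) * o.α₁ β) + z)

namespace IsRatio

theorem scaled_baseV (h : IsRatio o β z) (n : ℕ) : scaled o β z (baseV o β z) n = baseV o β z := by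
  induction n with
  | zero => rfl
  | succ n ih => rw [scaled_succ, ih, h.nextV_baseV, smul_inv_smul₀ h.pos.ne']

/-- The equation `root` of `IsRatio` has the factor `z - 1`; this is the other factor. -/
theorem cubic_eq (h : IsRatio o β z) :
    (1 - o.c₁ β) * o.α₁ β * (z ^ 3 - 1 + 3 * z ^ 2 - 3 * z) -
      (1 - 2 * o.c₁ β + o.c₂ β) * (o.α₁ β + o.α₂ β) * z ^ 2 +
      (2 - o.c₁ β - o.c₂ β) * (2 * o.α₁ β - o.α₂ β) * z = 0 := by
  have h1 := h.root
  have h2 : z - 1 ≠ 0 := by linarith [h.lt_one]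
  rw [denA] at h1
  refine (mul_eq_zero.1 ?_).resolve_left h2
  linear_combination h1

/-- The normalised iterates satisfy two coupled recurrences of second order. -/
theorem scaled_recurrence (h : IsRatio o β z) (v : ℝ × ℝ × ℝ × ℝ) (n : ℕ) :
    o.α₁ β * ((scaled o β z v (n + 2)).2.2.2 + z * (scaled o β z v (n + 1)).2.2.2 +
        z ^ 2 * (scaled o β z v n).2.2.2) =
      z * ((2 * o.α₁ β - o.α₂ β) * (scaled o β z v (n + 1)).2.1 +
        (o.α₁ β + o.α₂ β) * z * (scaled o β z v n).2.1) ∧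
    (1 - o.c₁ β) * ((scaled o β z v (n + 2)).2.1 + z * (scaled o β z v (n + 1)).2.1 +
        z ^ 2 * (scaled o β z v n).2.1) =
      (2 - o.c₁ β - o.c₂ β) * (scaled o β z v (n + 2)).2.2.2 +
        (1 - 2 * o.c₁ β + o.c₂ β) * z * (scaled o β z v (n + 1)).2.2.2 := by
  have hB : 1 - o.c₁ β ≠ 0 := by linarith [h.c₁_lt]
  have hα := h.α₁_pos.ne'
  simp only [scaled_succ _ (n + 1), scaled_succ _ n, nextV, nextU, nextH, nextY, nextG,
    Prod.smul_fst, Prod.smul_snd, smul_eq_mul]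
  constructor
  · field_simp; ring
  · field_simp; ring

theorem slope_mul (h : IsRatio o β z) : (1 - o.c₁ β) * o.α₁ β * slope o β z =
    -z ^ 2 * (3 * ((1 - o.c₁ β) * o.α₁ β) - (1 - 2 * o.c₁ β + o.c₂ β) * (o.α₁ β + o.α₂ β) +
      (1 - o.c₁ β) * o.α₁ β * z) := by
  have hB : 1 - o.c₁ β ≠ 0 := by linarith [h.c₁_lt]
  have hα := h.α₁_pos.ne'
  rw [slope]
  field_simp

/-- Elimination of the weights of A: the normalised weights of B satisfy a recurrence of fourth
order, with characteristic roots `1`, `z` and the roots of `X ^ 2 - slope * X + z ^ 3`. -/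
theorem scaled_recurrence₁ (h : IsRatio o β z) (v : ℝ × ℝ × ℝ × ℝ) {b : ℕ → ℝ}
    (hb : ∀ n, b n = (scaled o β z v n).2.1) (n : ℕ) :
    (b (n + 4) - b (n + 3)) - z * (b (n + 3) - b (n + 2)) =
      slope o β z * ((b (n + 3) - b (n + 2)) - z * (b (n + 2) - b (n + 1))) -
      z ^ 3 * ((b (n + 2) - b (n + 1)) - z * (b (n + 1) - b n)) := by
  have hB : (1 - o.c₁ β) * o.α₁ β ≠ 0 :=
    mul_ne_zero (by linarith [h.c₁_lt]) h.α₁_pos.ne'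
  obtain ⟨-, p0⟩ := h.scaled_recurrence v n
  obtain ⟨q1, p1⟩ := h.scaled_recurrence v (n + 1)
  obtain ⟨q2, p2⟩ := h.scaled_recurrence v (n + 2)
  simp only [← hb, add_assoc] at p0 p1 p2 q1 q2
  norm_num at p0 p1 p2 q1 q2
  refine mul_left_cancel₀ hB ?_
  linear_combination o.α₁ β * (p2 + z * p1 + z ^ 2 * p0) + (2 - o.c₁ β - o.c₂ β) * q2 +
    (1 - 2 * o.c₁ β + o.c₂ β) * z * q1 + (-b (n + 3) + (1 + z) * b (n + 2) - z * b (n + 1)) *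
    h.slope_mul + (b (n + 3) - z * b (n + 2)) * h.cubic_eq

/-- The normalised weights of A satisfy the same recurrence. -/
theorem scaled_recurrence₂ (h : IsRatio o β z) (v : ℝ × ℝ × ℝ × ℝ) {b : ℕ → ℝ}
    (hb : ∀ n, b n = (scaled o β z v n).2.2.2) (n : ℕ) :
    (b (n + 4) - b (n + 3)) - z * (b (n + 3) - b (n + 2)) =
      slope o β z * ((b (n + 3) - b (n + 2)) - z * (b (n + 2) - b (n + 1))) -
      z ^ 3 * ((b (n + 2) - b (n + 1)) - z * (b (n + 1) - b n)) := by
  have hB : (1 - o.c₁ β) * o.α₁ β ≠ 0 :=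
    mul_ne_zero (by linarith [h.c₁_lt]) h.α₁_pos.ne'
  obtain ⟨q0, p0⟩ := h.scaled_recurrence v n
  obtain ⟨q1, p1⟩ := h.scaled_recurrence v (n + 1)
  obtain ⟨q2, p2⟩ := h.scaled_recurrence v (n + 2)
  simp only [← hb, add_assoc] at p0 p1 p2 q0 q1 q2
  norm_num at p0 p1 p2 q0 q1 q2
  refine mul_left_cancel₀ hB ?_
  linear_combination (1 - o.c₁ β) * (q2 + z * q1 + z ^ 2 * q0) +
    z * (2 * o.α₁ β - o.α₂ β) * p1 + z ^ 2 * (o.α₁ β + o.α₂ β) * p0 +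
    (-b (n + 3) + (1 + z) * b (n + 2) - z * b (n + 1)) *
    h.slope_mul + (b (n + 3) - z * b (n + 2)) * h.cubic_eq

theorem scaled_eq (h : IsRatio o β z) (v : ℝ × ℝ × ℝ × ℝ) (n : ℕ) : scaled o β z v n =
    ((scaled o β z v (n + 1)).2.1 / z, (scaled o β z v n).2.1,
      (scaled o β z v (n + 1)).2.2.2 / z, (scaled o β z v n).2.2.2) := by
  have hz := h.pos.ne'
  rw [scaled_succ]
  ext <;> simp [nextV, hz]

/-- If `slope` satisfies the Jury criterion, then the transition map is asymptotically stable at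
the base point: the normalised iterates converge to a multiple of `baseV`, which represents the
base point. -/
theorem eventually_scaled (h : IsRatio o β z) (hs : |slope o β z| < 1 + z ^ 3) {S : Set State}
    (hS : S ∈ 𝓝 (base o β z)) :
    ∀ᶠ v in 𝓝 (baseV o β z), (∀ n, 0 < height o β (scaled o β z v n) ∧
        point o β (scaled o β z v n) ∈ S) ∧
      Tendsto (fun n => point o β (scaled o β z v n)) atTop (𝓝 (base o β z)) := by
  have hz := h.pos
  have hz1 := h.lt_one
  obtain ⟨C, hC0, hC⟩ := exists_variation_bound (z := z) (S := slope o β z) (P := z ^ 3)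
    (by rwa [abs_of_pos hz]) (by nlinarith [mul_pos hz hz]) hs
  set b₀ := (baseV o β z).2.1 with hb₀
  set d₀ := (baseV o β z).2.2.2 with hd₀
  have hb₀pos : 0 < b₀ := div_pos hz h.quad_pos
  have hbase : baseV o β z = (b₀ / z, b₀, d₀ / z, d₀) := by
    have := h.scaled_eq (baseV o β z) 0
    simpa only [h.scaled_baseV] using this
  -- the set of admissible values of two consecutive terms of both sequences
  have hnb : {w : ℝ × ℝ × ℝ × ℝ | 0 < height o β (w.1 / z, w.2.1, w.2.2.1 / z, w.2.2.2) ∧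
      point o β (w.1 / z, w.2.1, w.2.2.1 / z, w.2.2.2) ∈ S} ∈ 𝓝 (b₀, b₀, d₀, d₀) := by
    have hc : ContinuousAt (fun w : ℝ × ℝ × ℝ × ℝ => (w.1 / z, w.2.1, w.2.2.1 / z, w.2.2.2))
      (b₀, b₀, d₀, d₀) := by fun_prop
    have h1 : ∀ᶠ v in 𝓝 (baseV o β z), 0 < height o β v ∧ point o β v ∈ S := by
      refine ((continuous_height.continuousAt).eventually (lt_mem_nhds ?_)).and
        ((continuousAt_point (by rw [h.height_baseV]; exact one_ne_zero)).eventually ?_)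
      · rw [h.height_baseV]; exact one_pos
      · rw [h.point_baseV]; exact hS
    rw [hbase] at h1
    exact hc.eventually h1
  obtain ⟨ρ, hρ, hball⟩ := Metric.mem_nhds_iff.1 hnb
  set ρ' := min ρ b₀ with hρ'
  have hρ'pos : 0 < ρ' := lt_min hρ hb₀pos
  have hvar : ∀ f : ℝ × ℝ × ℝ × ℝ → ℝ, Continuous f → ∀ᶠ v in 𝓝 (baseV o β z),
      |f (scaled o β z v 0) - f (baseV o β z)| +
        C * (|f (scaled o β z v 1) - f (scaled o β z v 0)| +
        |f (scaled o β z v 2) - f (scaled o β z v 1)| +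
        |f (scaled o β z v 3) - f (scaled o β z v 2)|) < ρ' := by
    intro f hf
    have hcs : ∀ n, Continuous fun v => f (scaled o β z v n) := fun n =>
      hf.comp (continuous_scaled n)
    have hcc : Continuous fun v => |f (scaled o β z v 0) - f (baseV o β z)| +
        C * (|f (scaled o β z v 1) - f (scaled o β z v 0)| +
        |f (scaled o β z v 2) - f (scaled o β z v 1)| +
        |f (scaled o β z v 3) - f (scaled o β z v 2)|) :=
      ((hcs 0).sub continuous_const).abs.add (continuous_const.mul
        ((((hcs 1).sub (hcs 0)).abs.add ((hcs 2).sub (hcs 1)).abs).add ((hcs 3).sub (hcs 2)).abs))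
    refine hcc.continuousAt.eventually (gt_mem_nhds ?_)
    simpa only [h.scaled_baseV, sub_self, abs_zero, add_zero, mul_zero] using hρ'pos
  filter_upwards [hvar (fun w => w.2.1) (by fun_prop), hvar (fun w => w.2.2.2) (by fun_prop)]
    with v hv1 hv2
  obtain ⟨B1, l, hl⟩ := hC (fun n => (scaled o β z v n).2.1)
    (h.scaled_recurrence₁ v fun _ => rfl)
  obtain ⟨B2, l', hl'⟩ := hC (fun n => (scaled o β z v n).2.2.2)
    (h.scaled_recurrence₂ v fun _ => rfl)
  have near1 : ∀ n, |(scaled o β z v n).2.1 - b₀| ≤ |(scaled o β z v 0).2.1 - b₀| +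
      C * (|(scaled o β z v 1).2.1 - (scaled o β z v 0).2.1| +
        |(scaled o β z v 2).2.1 - (scaled o β z v 1).2.1| +
        |(scaled o β z v 3).2.1 - (scaled o β z v 2).2.1|) := fun n => by
    have := abs_sub_le (scaled o β z v n).2.1 (scaled o β z v 0).2.1 b₀
    linarith [B1 n]
  have near2 : ∀ n, |(scaled o β z v n).2.2.2 - d₀| < ρ' := fun n => by
    have := abs_sub_le (scaled o β z v n).2.2.2 (scaled o β z v 0).2.2.2 d₀
    linarith [B2 n]
  have near1' : ∀ n, |(scaled o β z v n).2.1 - b₀| < ρ' := fun n => (near1 n).trans_lt hv1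
  constructor
  · intro n
    have hmem : ((scaled o β z v (n + 1)).2.1, (scaled o β z v n).2.1,
        (scaled o β z v (n + 1)).2.2.2, (scaled o β z v n).2.2.2) ∈
        Metric.ball (b₀, b₀, d₀, d₀) ρ := by
      have hle : ρ' ≤ ρ := min_le_left _ _
      simp only [Metric.mem_ball, Prod.dist_eq, Real.dist_eq, max_lt_iff]
      exact ⟨(near1' _).trans_le hle, (near1' _).trans_le hle, (near2 _).trans_le hle,
        (near2 _).trans_le hle⟩
    have := hball hmem
    rw [h.scaled_eq v n]
    exact this
  · have hlpos : 0 < l := by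
      have h1 : |l - b₀| ≤ _ := le_of_tendsto ((hl.sub_const b₀).abs) (Eventually.of_forall near1)
      have h2 := (abs_lt.1 (h1.trans_lt hv1)).1
      linarith [min_le_right ρ b₀]
    have hlim : Tendsto (fun n => scaled o β z v n) atTop (𝓝 (l / z, l, l' / z, l')) := by
      have e : (fun n => scaled o β z v n) = fun n => ((scaled o β z v (n + 1)).2.1 / z,
        (scaled o β z v n).2.1, (scaled o β z v (n + 1)).2.2.2 / z, (scaled o β z v n).2.2.2) :=
        funext (h.scaled_eq v)
      rw [e]
      exact (((tendsto_add_atTop_iff_nat 1).2 hl).div_const z).prodMk_nhds (hl.prodMk_nhds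
        ((((tendsto_add_atTop_iff_nat 1).2 hl').div_const z).prodMk_nhds hl'))
    -- the limit is a multiple of the coordinates of the base point, by the limit of the recurrence
    have rel : o.α₁ β * (l' + z * l' + z ^ 2 * l') =
        z * ((2 * o.α₁ β - o.α₂ β) * l + (o.α₁ β + o.α₂ β) * z * l) := by
      have s1 := (((((tendsto_add_atTop_iff_nat 2).2 hl').add
        (((tendsto_add_atTop_iff_nat 1).2 hl').const_mul z)).add (hl'.const_mul (z ^ 2))).const_mul
        (o.α₁ β))
      have s2 := ((((tendsto_add_atTop_iff_nat 1).2 hl).const_mul (2 * o.α₁ β - o.α₂ β)).add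
        (hl.const_mul ((o.α₁ β + o.α₂ β) * z))).const_mul z
      refine tendsto_nhds_unique s1 (s2.congr fun n => ?_)
      exact ((h.scaled_recurrence v n).1).symm
    have rel0 := (h.scaled_recurrence (baseV o β z) 0).1
    simp only [h.scaled_baseV] at rel0
    have hl'eq : l' = l / b₀ * d₀ := by
      have hne : o.α₁ β * (1 + z + z ^ 2) ≠ 0 := mul_ne_zero h.α₁_pos.ne' h.quad_pos.ne'
      rw [← hb₀, ← hd₀] at rel0
      have h3 : l' * b₀ = l * d₀ :=
        mul_left_cancel₀ hne (by linear_combination b₀ * rel - l * rel0)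
      field_simp
      linear_combination h3
    have heq : ((l / z, l, l' / z, l') : ℝ × ℝ × ℝ × ℝ) = (l / b₀) • baseV o β z := by
      rw [hbase, hl'eq]
      ext <;> simp <;> field_simp
    have hc : l / b₀ ≠ 0 := (div_pos hlpos hb₀pos).ne'
    rw [heq] at hlim
    have hca := continuousAt_point (o := o) (β := β) (v := (l / b₀) • baseV o β z) (by
      rw [height_smul, h.height_baseV, mul_one]; exact hc)
    have := hca.tendsto.comp hlim
    rw [point_smul hc, h.point_baseV] at this
    exact this

end IsRatio

end ShapleyGame

namespace ShapleyGame

/-! ### Following solutions along legs -/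

variable {o : Orient} {β z : ℝ}

theorem infDist_lt_of_mem_segment {V : Type*} [NormedAddCommGroup V] [NormedSpace ℝ V]
    {Γ : Set V} {x e y e' q : V} {ε : ℝ} (hΓ : segment ℝ y e' ⊆ Γ)
    (hx : dist x y < ε) (he : dist e e' < ε) (hq : q ∈ segment ℝ x e) :
    Metric.infDist q Γ < ε := by
  obtain ⟨a, b, ha, hb, hab, rfl⟩ := hq
  refine (Metric.infDist_le_dist_of_mem (hΓ ⟨a, b, ha, hb, hab, rfl⟩)).trans_lt ?_
  rw [dist_eq_norm] at hx he ⊢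
  calc ‖a • x + b • e - (a • y + b • e')‖ = ‖a • (x - y) + b • (e - e')‖ := by
        congr 1; module
    _ ≤ a * ‖x - y‖ + b * ‖e - e'‖ := by
        refine (norm_add_le _ _).trans_eq ?_
        rw [norm_smul, norm_smul, Real.norm_of_nonneg ha, Real.norm_of_nonneg hb]
    _ < ε := by
        rcases ha.eq_or_lt with rfl | ha
        · rw [zero_add] at hab; subst hab; simpa using he
        · have := mul_lt_mul_of_pos_left hx ha
          have := mul_le_mul_of_nonneg_left he.le hb
          have : a * ε + b * ε = ε := by rw [← add_mul, hab, one_mul]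
          linarith

variable (o β) in
/-- Every solution from `x` arrives after time `s`, up to `n` relabellings, at `y`, and up to this
time its distance from `Γ` is less than `ε`. -/
def Leads (Γ : Set State) (ε : ℝ) (n : ℕ) (s : ℝ) (x y : State) : Prop :=
  0 ≤ s ∧ ∀ p, IsSolutionOn β (Ici 0) p → p 0 = x →
    (turn o)^[n] (p s) = y ∧ ∀ t ∈ Icc 0 s, Metric.infDist (p t) Γ < ε

theorem IsSolutionOn.turn_iterate {I : Set ℝ} {p : ℝ → State} (h : IsSolutionOn β I p) (n : ℕ) :
    IsSolutionOn β I (fun t => (ShapleyGame.turn o)^[n] (p t)) := by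
  induction n with
  | zero => exact h
  | succ n ih =>
    simp only [Function.iterate_succ_apply']
    exact ih.turn

theorem infDist_turn_iterate {Γ : Set State} (hΓ : turn o '' Γ = Γ) (n : ℕ) (x : State) :
    Metric.infDist ((turn o)^[n] x) Γ = Metric.infDist x Γ := by
  induction n with
  | zero => rfl
  | succ n ih =>
    rw [Function.iterate_succ_apply']
    nth_rewrite 1 [← hΓ]
    rw [Metric.infDist_image (Isometry.of_dist_eq dist_turn), ih]

theorem IsSolutionOn.shift {p : ℝ → State} (h : IsSolutionOn β (Ici 0) p) {s : ℝ} (hs : 0 ≤ s) :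
    IsSolutionOn β (Ici 0) (fun t => p (t + s)) :=
  h.comp_add s measurableSet_Ici measurableSet_Ici fun _ ht => add_nonneg ht hs

theorem Leads.trans {Γ : Set State} (hΓ : turn o '' Γ = Γ) {ε s s' : ℝ} {n m : ℕ} {x y w : State}
    (h : Leads o β Γ ε n s x y) (h' : Leads o β Γ ε m s' y w) :
    Leads o β Γ ε (m + n) (s' + s) x w := by
  refine ⟨add_nonneg h'.1 h.1, fun p hp h0 => ?_⟩
  obtain ⟨h1, h2⟩ := h.2 p hp h0
  obtain ⟨h3, h4⟩ := h'.2 _ ((hp.shift h.1).turn_iterate (o := o) n) (by simpa using h1)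
  refine ⟨by rwa [Function.iterate_add_apply], fun t ht => ?_⟩
  rcases le_total t s with hts | hts
  · exact h2 t ⟨ht.1, hts⟩
  · have := h4 (t - s) ⟨by linarith, by linarith [ht.2]⟩
    rwa [infDist_turn_iterate hΓ, sub_add_cancel] at this

theorem leads_turn {Γ : Set State} {ε : ℝ} {x : State} (hx : Metric.infDist x Γ < ε) (n : ℕ) :
    Leads o β Γ ε n 0 x ((turn o)^[n] x) := by
  refine ⟨le_rfl, fun p _ h0 => ⟨by rw [h0], fun t ht => ?_⟩⟩
  rw [le_antisymm ht.2 ht.1, h0]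
  exact hx

/-- Motion along one leg, from a point near a segment of `Γ`. -/
theorem leads_go {Γ : Set State} {ε δ : ℝ} {x y e' : State} {m k : Fin 3} (hδ : 0 ≤ δ)
    (hx : StrictA β (o.step * m) x ∨ StrictB β (1 + o.step * k) x)
    (hreg : ∀ ε ∈ Ioo 0 δ, go o m k x ε ∈ zone o β m k)
    (hΓ : segment ℝ y e' ⊆ Γ) (hxy : dist x y < ε) (he : dist (go o m k x δ) e' < ε) :
    Leads o β Γ ε 0 (Real.log (1 + δ)) x (go o m k x δ) := by
  have hl : 0 ≤ Real.log (1 + δ) := Real.log_nonneg (by linarith)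
  refine ⟨hl, fun p hp h0 => ?_⟩
  have h1 := IsSolutionOn.eq_toward hδ hx hreg (hp.mono Icc_subset_Ici_self) h0
  constructor
  · rw [Function.iterate_zero, id, h1 _ ⟨hl, le_rfl⟩, Real.exp_log (by linarith),
      add_sub_cancel_left]
    rfl
  · intro t ht
    refine infDist_lt_of_mem_segment hΓ hxy he ?_
    rw [h1 t ht, go, ← image_toward_Icc _ _ _ hδ]
    refine ⟨_, ⟨by simpa using ht.1, ?_⟩, rfl⟩
    have := (Real.le_log_iff_exp_le (by linarith)).1 ht.2
    linarith

/-- A property of the distance from `Γ` that holds for all solutions from `y` holds, from time `s`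
on, for those from `x`. -/
theorem Leads.tail {Γ : Set State} (hΓ : turn o '' Γ = Γ) {ε s : ℝ} {n : ℕ} {x y : State}
    (h : Leads o β Γ ε n s x y) {p : ℝ → State} (hp : IsSolutionOn β (Ici 0) p) (h0 : p 0 = x)
    {P : ℝ → Prop} (hP : ∀ q, IsSolutionOn β (Ici 0) q → q 0 = y →
      ∀ t, 0 ≤ t → P (Metric.infDist (q t) Γ)) : ∀ t, s ≤ t → P (Metric.infDist (p t) Γ) := by
  intro t ht
  have := hP _ ((hp.shift h.1).turn_iterate (o := o) n) (by simpa using (h.2 p hp h0).1) (t - s)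
    (sub_nonneg.2 ht)
  rwa [infDist_turn_iterate hΓ, sub_add_cancel] at this

theorem leads_seq {Γ : Set State} (hΓ : turn o '' Γ = Γ) {ε τ₀ : ℝ} {x : ℕ → State} {N : ℕ}
    (hx : ∀ n < N, ∃ s, τ₀ ≤ s ∧ Leads o β Γ ε 1 s (x n) (x (n + 1)))
    (h0 : Metric.infDist (x 0) Γ < ε) :
    ∃ s, N * τ₀ ≤ s ∧ Leads o β Γ ε N s (x 0) (x N) := by
  induction N with
  | zero => exact ⟨0, by simp, leads_turn h0 0⟩
  | succ N ih =>
    obtain ⟨s, hs, hl⟩ := ih fun n hn => hx n (hn.trans N.lt_succ_self)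
    obtain ⟨s', hs', hl'⟩ := hx N N.lt_succ_self
    refine ⟨s' + s, by push_cast; linarith, ?_⟩
    have := hl.trans hΓ hl'
    rwa [add_comm 1 N] at this

/-- A solution that passes through a sequence of states, with times between them bounded from
below, remains close to `Γ` for all times. -/
theorem infDist_lt_of_leads {Γ : Set State} (hΓ : turn o '' Γ = Γ) {ε τ₀ : ℝ} (hτ : 0 < τ₀)
    {x : ℕ → State}
    (hx : ∀ n, ∃ s, τ₀ ≤ s ∧ Leads o β Γ ε 1 s (x n) (x (n + 1)))
    {p : ℝ → State} (hp : IsSolutionOn β (Ici 0) p) (h0 : p 0 = x 0) {t : ℝ} (ht : 0 ≤ t) :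
    Metric.infDist (p t) Γ < ε := by
  obtain ⟨N, hN⟩ := exists_nat_ge (t / τ₀)
  have h1 : Metric.infDist (x 0) Γ < ε := by
    obtain ⟨s, -, hl⟩ := hx 0
    rw [← h0]
    exact (hl.2 p hp h0).2 0 ⟨le_rfl, hl.1⟩
  obtain ⟨s, hs, hl⟩ := leads_seq hΓ (N := N) (fun n _ => hx n) h1
  exact (hl.2 p hp h0).2 t ⟨ht, ((div_le_iff₀ hτ).1 hN).trans hs⟩

theorem continuous_uA (m : Fin 3) : Continuous (uA o β m) := continuous_vA β _

theorem continuous_uB (m : Fin 3) : Continuous (uB o β m) := continuous_vB β _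

theorem continuous_waitA : Continuous (waitA o β) :=
  ((continuous_uA 0).sub (continuous_uA 1)).div_const _

theorem continuous_waitB : Continuous (waitB o β) :=
  ((continuous_uB 0).sub (continuous_uB 1)).div_const _

theorem continuousAt_go (m k : Fin 3) {x : State} {f : State → ℝ} (hf : ContinuousAt f x)
    (h : 1 + f x ≠ 0) : ContinuousAt (fun x => go o m k x (f x)) x := by
  unfold go toward
  exact ((continuousAt_const.add hf).inv₀ h).smul
    (continuousAt_id.add (hf.smul continuousAt_const))

theorem go_go (m k : Fin 3) (x : State) {a b : ℝ} (ha : 0 ≤ a) (hb : 0 ≤ b) :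
    go o m k (go o m k x a) ((b - a) / (1 + a)) = go o m k x b := by
  have h1 : 1 + a ≠ 0 := by positivity
  have h2 : 1 + b ≠ 0 := by positivity
  have h3 : 1 + (b - a) / (1 + a) = (1 + b) / (1 + a) := by field_simp; ring
  refine state_ext (o := o) (fun i => ?_) (fun i => ?_)
  · rw [wA_go, wA_go, wA_go, h3]; split_ifs <;> field_simp <;> ring
  · rw [wB_go, wB_go, wB_go, h3]; split_ifs <;> field_simp <;> ring

end ShapleyGame

namespace ShapleyGame

/-! ### Solutions near the orbit -/

variable {o : Orient} {β z : ℝ}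

theorem lt_of_affine_Icc {a b c d w δ : ℝ} (h0 : a < b) (h1 : a + c * w < b + d * w)
    (hδ : δ ∈ Icc 0 w) : a + c * δ < b + d * δ := by
  rcases le_total c d with hcd | hcd
  · nlinarith [mul_le_mul_of_nonneg_right hcd hδ.1]
  · nlinarith [mul_le_mul_of_nonneg_left hδ.2 (sub_nonneg.2 hcd)]

namespace IsRatio

theorem exists_eq_go_first (h : IsRatio o β z) {y : State}
    (hy : y ∈ segment ℝ (base o β z) (mid o β z)) :
    ∃ δ ∈ Icc 0 (gain o β z - 1), go o 0 0 (base o β z) δ = y := by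
  rwa [mid, go, ← image_toward_Icc _ _ _ (by linarith [h.one_lt_gain])] at hy

theorem exists_eq_go_second (h : IsRatio o β z) {y : State}
    (hy : y ∈ segment ℝ (mid o β z) (endPt o β z)) :
    ∃ δ ∈ Icc 0 (1 / z / gain o β z - 1), go o 1 0 (mid o β z) δ = y := by
  rwa [endPt, go, ← image_toward_Icc _ _ _ h.wait_second_pos.le] at hy

theorem waitA_first (h : IsRatio o β z) {δ : ℝ} (hδ : 0 ≤ δ) :
    waitA o β (go o 0 0 (base o β z) δ) = (gain o β z - 1 - δ) / (1 + δ) := by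
  obtain ⟨e0, e1, e2⟩ := uA_go_zero (o := o) (β := β) 0 (base o β z) δ
  have h1 := h.waitA_base
  have h2 := h.α₁_pos.ne'
  have h3 : 1 + δ ≠ 0 := by positivity
  rw [waitA] at h1
  rw [waitA, e0, e1, ← h1]
  field_simp
  ring

theorem waitB_second (h : IsRatio o β z) {δ : ℝ} (hδ : 0 ≤ δ) :
    waitB o β (go o 1 0 (mid o β z) δ) = (1 / z / gain o β z - 1 - δ) / (1 + δ) := by
  obtain ⟨e0, e1, e2⟩ := uB_go_one (o := o) (β := β) 0 (mid o β z) δ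
  have h1 := h.waitB_mid
  have h2 : 1 - o.c₁ β ≠ 0 := by linarith [h.c₁_lt]
  have h3 : 1 + δ ≠ 0 := by positivity
  rw [waitB] at h1
  rw [waitB, e0, e1, ← h1]
  field_simp
  ring

theorem tendsto_go_first (h : IsRatio o β z) {y : State}
    (hy : y ∈ segment ℝ (base o β z) (mid o β z)) :
    Tendsto (fun x => go o 0 0 x (waitA o β x)) (𝓝 y) (𝓝 (mid o β z)) := by
  obtain ⟨δ, hδ, rfl⟩ := h.exists_eq_go_first hy
  have h1 : 0 < 1 + δ := by linarith [hδ.1]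
  have h2 := h.waitA_first hδ.1
  have h3 : 0 ≤ (gain o β z - 1 - δ) / (1 + δ) := div_nonneg (by linarith [hδ.2]) h1.le
  have h4 := continuousAt_go (o := o) 0 0 (continuous_waitA (o := o) (β := β)).continuousAt
    (x := go o 0 0 (base o β z) δ) (by rw [h2]; positivity)
  have h5 := h4.tendsto
  rwa [h2, go_go _ _ _ hδ.1 (hδ.1.trans hδ.2)] at h5

theorem tendsto_go_second (h : IsRatio o β z) {y : State}
    (hy : y ∈ segment ℝ (mid o β z) (endPt o β z)) :
    Tendsto (fun x => go o 1 0 x (waitB o β x)) (𝓝 y) (𝓝 (endPt o β z)) := by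
  obtain ⟨δ, hδ, rfl⟩ := h.exists_eq_go_second hy
  have h1 : 0 < 1 + δ := by linarith [hδ.1]
  have h2 := h.waitB_second hδ.1
  have h3 : 0 ≤ (1 / z / gain o β z - 1 - δ) / (1 + δ) := div_nonneg (by linarith [hδ.2]) h1.le
  have h4 := continuousAt_go (o := o) 1 0 (continuous_waitB (o := o) (β := β)).continuousAt
    (x := go o 1 0 (mid o β z) δ) (by rw [h2]; positivity)
  have h5 := h4.tendsto
  rwa [h2, go_go _ _ _ hδ.1 (hδ.1.trans hδ.2)] at h5

/-- Points near the first leg of the orbit move along this leg, if B does not prefer `2` and A does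
not prefer `1`. -/
theorem eventually_first (h : IsRatio o β z) {y : State}
    (hy : y ∈ segment ℝ (base o β z) (mid o β z)) {ε : ℝ} (hε : 0 < ε) :
    ∀ᶠ x in 𝓝 y, x ∈ phaseSpace → uB o β 2 x ≤ uB o β 0 x → uA o β 1 x ≤ uA o β 0 x →
      0 ≤ waitA o β x ∧ Leads o β (range (orbit o β z)) ε 0 (Real.log (1 + waitA o β x)) x
        (go o 0 0 x (waitA o β x)) ∧ (StrictA β (o.step * 0) x ∨ StrictB β (1 + o.step * 0) x) ∧
      ∀ ε ∈ Ioo 0 (waitA o β x), go o 0 0 x ε ∈ zone o β 0 0 := by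
  have hsub : segment ℝ y (mid o β z) ⊆ range (orbit o β z) :=
    ((convex_segment _ _).segment_subset hy (right_mem_segment ℝ _ _)).trans
      h.segment_first_subset
  have hgo := (h.tendsto_go_first hy).eventually (Metric.ball_mem_nhds _ hε)
  obtain ⟨δ, hδ, rfl⟩ := h.exists_eq_go_first hy
  have hp : 0 < 1 + δ := by linarith [hδ.1]
  have hw := h.waitA_first hδ.1
  have hw0 : 0 ≤ (gain o β z - 1 - δ) / (1 + δ) := div_nonneg (by linarith [hδ.2]) hp.le
  obtain ⟨a0, a1, a2⟩ := uA_go_zero (o := o) (β := β) 0 (base o β z) δ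
  obtain ⟨b0, b1, b2⟩ := uB_go_zero (o := o) (β := β) 0 (base o β z) δ
  -- the strict inequalities along the orbit
  have s1 : uA o β 2 (go o 0 0 (base o β z) δ) + o.α₂ β * waitA o β (go o 0 0 (base o β z) δ) <
      uA o β 0 (go o 0 0 (base o β z) δ) := by
    rw [hw, a2, a0, mul_div_assoc', ← add_div]
    exact div_lt_div_of_pos_right (by linarith [h.uA_two_lt']) hp
  have s2 : uA o β 2 (go o 0 0 (base o β z) δ) < uA o β 0 (go o 0 0 (base o β z) δ) := by
    rw [hw] at s1
    linarith [mul_nonneg h.α₂_nonneg hw0]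
  have s3 : uB o β 1 (go o 0 0 (base o β z) δ) < uB o β 0 (go o 0 0 (base o β z) δ) := by
    rw [b0, b1]
    exact div_lt_div_of_pos_right (by nlinarith [h.uB_one_lt, h.c₂_lt, hδ.1]) hp
  have s4 : StrictA β (o.step * 0) (go o 0 0 (base o β z) δ) ∨
      StrictB β (1 + o.step * 0) (go o 0 0 (base o β z) δ) := by
    rcases hδ.1.eq_or_lt with rfl | h0
    · left
      rw [go_zero, strictA_iff]
      exact ⟨h.uA_one_lt, h.uA_two_lt⟩
    · right
      rw [strictB_iff]
      refine ⟨s3, ?_⟩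
      simp only [zero_add]
      rw [b0, b2]
      exact div_lt_div_of_pos_right (by nlinarith [h.uB_two_eq, h.c₁_lt]) hp
  have e1 : ∀ᶠ x in 𝓝 (go o 0 0 (base o β z) δ), uA o β 2 x + o.α₂ β * waitA o β x < uA o β 0 x :=
    ((continuous_uA 2).add (continuous_waitA.const_mul _)).continuousAt.eventually_lt
      (continuous_uA 0).continuousAt s1
  have e2 := (continuous_uA 2).continuousAt.eventually_lt (continuous_uA 0).continuousAt s2
  have e3 := (continuous_uB 1).continuousAt.eventually_lt (continuous_uB 0).continuousAt s3
  have e4 : ∀ᶠ x in 𝓝 (go o 0 0 (base o β z) δ), StrictA β (o.step * 0) x ∨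
      StrictB β (1 + o.step * 0) x :=
    ((isOpen_strictA β _).union (isOpen_strictB β _)).mem_nhds s4
  filter_upwards [e1, e2, e3, e4, hgo, Metric.ball_mem_nhds _ hε] with x e1 e2 e3 e4 e5 e6 hx hB hA
  have hw1 : 0 ≤ waitA o β x := div_nonneg (sub_nonneg.2 hA) h.α₁_pos.le
  have hz := go_mem_zone_zero h.α₁_pos h.c₁_lt hx le_rfl e2 e1.le hB e3 (by nlinarith [h.c₂_lt])
  exact ⟨hw1, leads_go hw1 e4 hz hsub e6 e5, e4, hz⟩

/-- Points near the second leg move along this leg, if A does not prefer `0` and B does not prefer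
`1`. -/
theorem eventually_second (h : IsRatio o β z) {y : State}
    (hy : y ∈ segment ℝ (mid o β z) (endPt o β z)) {ε : ℝ} (hε : 0 < ε) :
    ∀ᶠ x in 𝓝 y, x ∈ phaseSpace → uA o β 0 x ≤ uA o β 1 x → uB o β 1 x ≤ uB o β 0 x →
      0 ≤ waitB o β x ∧ Leads o β (range (orbit o β z)) ε 0 (Real.log (1 + waitB o β x)) x
        (go o 1 0 x (waitB o β x)) ∧ (StrictA β (o.step * 1) x ∨ StrictB β (1 + o.step * 0) x) ∧
      ∀ ε ∈ Ioo 0 (waitB o β x), go o 1 0 x ε ∈ zone o β 1 0 := by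
  have hsub : segment ℝ y (endPt o β z) ⊆ range (orbit o β z) :=
    ((convex_segment _ _).segment_subset hy (right_mem_segment ℝ _ _)).trans
      h.segment_second_subset
  have hgo := (h.tendsto_go_second hy).eventually (Metric.ball_mem_nhds _ hε)
  obtain ⟨δ, hδ, rfl⟩ := h.exists_eq_go_second hy
  have hp : 0 < 1 + δ := by linarith [hδ.1]
  set w := 1 / z / gain o β z - 1 with hwdef
  have hw := h.waitB_second hδ.1
  rw [← hwdef] at hw
  have hq : 0 < 1 + w := by linarith [h.wait_second_pos]
  obtain ⟨a0, a1, a2⟩ := uA_go_zero (o := o) (β := β) 1 (mid o β z) δ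
  obtain ⟨b0, b1, b2⟩ := uB_go_one (o := o) (β := β) 0 (mid o β z) δ
  -- the inequalities at the end of the leg
  have t1 : uB o β 2 (mid o β z) + o.c₂ β * w < uB o β 0 (mid o β z) + o.c₁ β * w := by
    obtain ⟨d0, -, d2⟩ := uB_go_one (o := o) (β := β) 0 (mid o β z) w
    have := h.uB_endPt.2
    rw [endPt, d0, d2] at this
    exact (div_lt_div_iff_of_pos_right hq).1 this
  have t2 : uA o β 2 (mid o β z) + o.α₂ β * w < uA o β 1 (mid o β z) + o.α₁ β * w := by
    obtain ⟨-, d1, d2⟩ := uA_go_zero (o := o) (β := β) 1 (mid o β z) w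
    have := h.uA_endPt.2
    rw [endPt, d1, d2] at this
    exact (div_lt_div_iff_of_pos_right hq).1 this
  set y := go o 1 0 (mid o β z) δ with hy'
  have s1 : uB o β 2 y + o.c₂ β * waitB o β y < uB o β 0 y + o.c₁ β * waitB o β y := by
    rw [hw, b2, b0, mul_div_assoc', mul_div_assoc', ← add_div, ← add_div]
    exact div_lt_div_of_pos_right (by linarith) hp
  have s2 : uA o β 2 y + o.α₂ β * waitB o β y < uA o β 1 y + o.α₁ β * waitB o β y := by
    rw [hw, a2, a1, mul_div_assoc', mul_div_assoc', ← add_div, ← add_div]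
    exact div_lt_div_of_pos_right (by linarith) hp
  have s3 : uB o β 2 y < uB o β 0 y := by
    rw [b2, b0]
    exact div_lt_div_of_pos_right (lt_of_affine_Icc h.uB_mid.2 t1 hδ) hp
  have s4 : uA o β 2 y < uA o β 1 y := by
    rw [a2, a1]
    exact div_lt_div_of_pos_right
      (lt_of_affine_Icc (h.uA_mid.2.trans_eq h.uA_mid.1.symm) t2 hδ) hp
  have s5 : StrictA β (o.step * 1) y ∨ StrictB β (1 + o.step * 0) y := by
    rcases hδ.1.eq_or_lt with h0 | h0
    · right
      rw [hy', ← h0, go_zero, strictB_iff]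
      exact h.uB_mid
    · left
      rw [strictA_iff]
      refine ⟨s4, ?_⟩
      change uA o β 0 y < _
      rw [a0, a1]
      exact div_lt_div_of_pos_right (by nlinarith [h.uA_mid.1, mul_pos h.α₁_pos h0]) hp
  have e1 := ((continuous_uB 2).add (continuous_waitB.const_mul _)).continuousAt.eventually_lt
      ((continuous_uB 0).add (continuous_waitB.const_mul _)).continuousAt s1
  have e2 := ((continuous_uA 2).add (continuous_waitB.const_mul _)).continuousAt.eventually_lt
      ((continuous_uA 1).add (continuous_waitB.const_mul _)).continuousAt s2
  have e3 := (continuous_uB 2).continuousAt.eventually_lt (continuous_uB 0).continuousAt s3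
  have e4 := (continuous_uA 2).continuousAt.eventually_lt (continuous_uA 1).continuousAt s4
  have e5 : ∀ᶠ x in 𝓝 y, StrictA β (o.step * 1) x ∨ StrictB β (1 + o.step * 0) x :=
    ((isOpen_strictA β _).union (isOpen_strictB β _)).mem_nhds s5
  filter_upwards [e1, e2, e3, e4, e5, hgo, Metric.ball_mem_nhds _ hε]
    with x e1 e2 e3 e4 e5 e6 e7 hx hA hB
  have hw1 : 0 ≤ waitB o β x := div_nonneg (sub_nonneg.2 hB) (by linarith [h.c₁_lt])
  have hz := go_mem_zone_one h.α₁_pos h.c₁_lt hx le_rfl e3 e1.le hA e4 e2.le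
  exact ⟨hw1, leads_go hw1 e5 hz hsub e7 e6, e5, hz⟩

end IsRatio

variable (o β) in
/-- The transition map of the section on which B is indifferent between `2` and `0`, to itself up
to relabelling. -/
noncomputable def sectionMap (x : State) : State :=
  turn o (go o 1 0 (go o 0 0 x (waitA o β x)) (waitB o β (go o 0 0 x (waitA o β x))))

/-- At the end of the wait for A, this player is indifferent. -/
theorem uA_go_waitA (hα : 0 < o.α₁ β) (m : Fin 3) (x : State) :
    uA o β 0 (go o m 0 x (waitA o β x)) = uA o β 1 (go o m 0 x (waitA o β x)) := by
  obtain ⟨a0, a1, -⟩ := uA_go_zero (o := o) (β := β) m x (waitA o β x)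
  rw [a0, a1, waitA, mul_div_cancel₀ _ hα.ne', add_sub_cancel]

theorem uB_go_waitB (hc : o.c₁ β < 1) (k : Fin 3) (x : State) :
    uB o β 0 (go o 1 k x (waitB o β x)) = uB o β 1 (go o 1 k x (waitB o β x)) := by
  obtain ⟨b0, b1, -⟩ := uB_go_one (o := o) (β := β) k x (waitB o β x)
  have : 1 - o.c₁ β ≠ 0 := by linarith
  rw [b0, b1, waitB]
  congr 1
  field_simp
  ring

namespace IsRatio

theorem uB_sectionMap (h : IsRatio o β z) (x : State) :
    uB o β 2 (sectionMap o β x) = uB o β 0 (sectionMap o β x) := by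
  rw [sectionMap, uB_turn, uB_turn]
  exact uB_go_waitB h.c₁_lt 0 _

variable (o β z) in
/-- The solutions from `x` arrive, up to relabelling, in a given part of the section. -/
def Arrives (ε : ℝ) (S : Set State) (x : State) : Prop :=
  ∃ n s x', Leads o β (range (orbit o β z)) ε n s x x' ∧ x' ∈ phaseSpace ∧
    uB o β 2 x' = uB o β 0 x' ∧ x' ∈ S

theorem Arrives.of_leads (h : IsRatio o β z) {ε s : ℝ} {S : Set State} {n : ℕ} {x y : State}
    (hl : Leads o β (range (orbit o β z)) ε n s x y) (hy : Arrives o β z ε S y) :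
    Arrives o β z ε S x := by
  obtain ⟨m, s', x', h1, h2⟩ := hy
  exact ⟨_, _, x', hl.trans h.turn_image_range h1, h2⟩

theorem eventually_infDist {y : State} (hy : y ∈ range (orbit o β z)) {ε : ℝ}
    (hε : 0 < ε) : ∀ᶠ x in 𝓝 y, Metric.infDist x (range (orbit o β z)) < ε := by
  refine (Metric.continuous_infDist_pt _).continuousAt.eventually (gt_mem_nhds ?_)
  simpa only [Metric.infDist_zero_of_mem hy] using hε

theorem eventually_arrives_second (h : IsRatio o β z) {y : State}
    (hy : y ∈ segment ℝ (mid o β z) (endPt o β z)) {ε : ℝ} (hε : 0 < ε) {S : Set State}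
    (hS : S ∈ 𝓝 (base o β z)) :
    ∀ᶠ x in 𝓝 y, x ∈ phaseSpace → uA o β 0 x ≤ uA o β 1 x → uB o β 1 x ≤ uB o β 0 x →
      Arrives o β z ε S x := by
  have h1 : ∀ᶠ x in 𝓝 (endPt o β z), turn o x ∈ S := by
    refine (continuous_turn.continuousAt).eventually ?_
    rwa [h.turn_end]
  have h2 : ∀ᶠ x in 𝓝 (endPt o β z), Metric.infDist x (range (orbit o β z)) < ε :=
    eventually_infDist (h.segment_second_subset (right_mem_segment ℝ _ _)) hε
  filter_upwards [h.eventually_second hy hε, (h.tendsto_go_second hy).eventually (h1.and h2)]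
    with x hx ⟨hx1, hx2⟩ hp hA hB
  obtain ⟨hw, hl, -⟩ := hx hp hA hB
  refine Arrives.of_leads h hl (Arrives.of_leads h (leads_turn hx2 1) ?_)
  refine ⟨0, 0, _, leads_turn (by rwa [infDist_turn_iterate h.turn_image_range 1]) 0,
    ?_, ?_, ?_⟩
  · exact turn_mem_iff.2 (go_mem hp hw)
  · simp only [Function.iterate_one, Function.iterate_zero, id]
    rw [uB_turn, uB_turn]
    exact uB_go_waitB h.c₁_lt 0 _
  · exact hx1

theorem eventually_arrives_first (h : IsRatio o β z) {y : State}
    (hy : y ∈ segment ℝ (base o β z) (mid o β z)) {ε : ℝ} (hε : 0 < ε) {S : Set State}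
    (hS : S ∈ 𝓝 (base o β z)) :
    ∀ᶠ x in 𝓝 y, x ∈ phaseSpace → uB o β 2 x ≤ uB o β 0 x → uA o β 1 x ≤ uA o β 0 x →
      Arrives o β z ε S x := by
  have e := (continuous_uB 1).continuousAt.eventually_lt (continuous_uB 0).continuousAt h.uB_mid.1
  filter_upwards [h.eventually_first hy hε, (h.tendsto_go_first hy).eventually
    (e.and (h.eventually_arrives_second (left_mem_segment ℝ _ _) hε hS))] with x hx hm hp hB hA
  obtain ⟨hw, hl, -⟩ := hx hp hB hA
  exact Arrives.of_leads h hl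
    (hm.2 (go_mem hp hw) (uA_go_waitA h.α₁_pos 0 x).le hm.1.le)

theorem base_mem_range (h : IsRatio o β z) : base o β z ∈ range (orbit o β z) :=
  h.segment_first_subset (left_mem_segment ℝ _ _)

theorem turn_turn_base (h : IsRatio o β z) : turn o (turn o (base o β z)) = endPt o β z := by
  rw [← h.turn_end, turn_turn_turn]

/-- Near the first leg, three cases: the solution still follows this leg, or A already prefers `1`
(only near its end), so that it follows the second leg, or B still prefers `2` (only near its
beginning), so that it is, up to relabelling, at the end of a second leg. -/
theorem eventually_arrives_of_mem_first (h : IsRatio o β z) {y : State}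
    (hy : y ∈ segment ℝ (base o β z) (mid o β z)) {ε : ℝ} (hε : 0 < ε) {S : Set State}
    (hS : S ∈ 𝓝 (base o β z)) : ∀ᶠ x in 𝓝 y, x ∈ phaseSpace → Arrives o β z ε S x := by
  have e1 : ∀ᶠ x in 𝓝 y, x ∈ phaseSpace → uA o β 0 x < uA o β 1 x → Arrives o β z ε S x := by
    by_cases hym : y = mid o β z
    · subst hym
      have e := (continuous_uB 1).continuousAt.eventually_lt (continuous_uB 0).continuousAt
        h.uB_mid.1
      filter_upwards [e, h.eventually_arrives_second (left_mem_segment ℝ _ _) hε hS]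
        with x hx hx' hp hA using hx' hp hA.le hx.le
    · have : uA o β 1 y < uA o β 0 y := by
        obtain ⟨δ, hδ, rfl⟩ := h.exists_eq_go_first hy
        have h1 : δ < gain o β z - 1 := lt_of_le_of_ne hδ.2 fun h1 => hym (by rw [h1]; rfl)
        have h2 := h.waitA_first hδ.1
        have h3 : 0 < (gain o β z - 1 - δ) / (1 + δ) :=
          div_pos (by linarith) (by linarith [hδ.1])
        rw [← h2, waitA, lt_div_iff₀ h.α₁_pos] at h3
        linarith
      filter_upwards [(continuous_uA 1).continuousAt.eventually_lt
        (continuous_uA 0).continuousAt this] with x hx _ hA using absurd hA hx.not_gt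
  have e2 : ∀ᶠ x in 𝓝 y, x ∈ phaseSpace → uB o β 0 x < uB o β 2 x → Arrives o β z ε S x := by
    by_cases hyb : y = base o β z
    · subst hyb
      have hc : Continuous fun x => turn o (turn o x) := continuous_turn.comp continuous_turn
      have e3 := (continuous_uA 0).continuousAt.eventually_lt (continuous_uA 1).continuousAt
        h.uA_endPt.1
      have e4 := e3.and (h.eventually_arrives_second (right_mem_segment ℝ _ _) hε hS)
      rw [← h.turn_turn_base] at e4
      filter_upwards [hc.continuousAt.eventually e4, eventually_infDist h.base_mem_range hε]
        with x hx hx' hp hB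
      refine Arrives.of_leads h (leads_turn hx' 2) ?_
      refine hx.2 (turn_mem_iff.2 (turn_mem_iff.2 hp)) hx.1.le ?_
      simp only [uB_turn]
      exact hB.le
    · have : uB o β 2 y < uB o β 0 y := by
        obtain ⟨δ, hδ, rfl⟩ := h.exists_eq_go_first hy
        have h1 : 0 < δ := lt_of_le_of_ne hδ.1 fun h1 => hyb (by rw [← h1, go_zero])
        obtain ⟨b0, b1, b2⟩ := uB_go_zero (o := o) (β := β) 0 (base o β z) δ
        rw [b0, b2]
        exact div_lt_div_of_pos_right (by nlinarith [h.uB_two_eq, h.c₁_lt]) (by linarith)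
      filter_upwards [(continuous_uB 2).continuousAt.eventually_lt
        (continuous_uB 0).continuousAt this] with x hx _ hA using absurd hA hx.not_gt
  filter_upwards [e1, e2, h.eventually_arrives_first hy hε hS] with x h1 h2 h3 hp
  rcases lt_or_ge (uA o β 0 x) (uA o β 1 x) with hA | hA
  · exact h1 hp hA
  rcases lt_or_ge (uB o β 0 x) (uB o β 2 x) with hB | hB
  · exact h2 hp hB
  · exact h3 hp hB hA

/-- The same three cases near the second leg; near its end, a relabelling leads to the first leg.
-/
theorem eventually_arrives_of_mem_second (h : IsRatio o β z) {y : State}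
    (hy : y ∈ segment ℝ (mid o β z) (endPt o β z)) {ε : ℝ} (hε : 0 < ε) {S : Set State}
    (hS : S ∈ 𝓝 (base o β z)) : ∀ᶠ x in 𝓝 y, x ∈ phaseSpace → Arrives o β z ε S x := by
  have e1 : ∀ᶠ x in 𝓝 y, x ∈ phaseSpace → uA o β 1 x < uA o β 0 x → Arrives o β z ε S x := by
    by_cases hym : y = mid o β z
    · subst hym
      filter_upwards [h.eventually_arrives_of_mem_first (right_mem_segment ℝ _ _) hε hS]
        with x hx hp _ using hx hp
    · have : uA o β 0 y < uA o β 1 y := by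
        obtain ⟨δ, hδ, rfl⟩ := h.exists_eq_go_second hy
        have h1 : 0 < δ := lt_of_le_of_ne hδ.1 fun h1 => hym (by rw [← h1, go_zero])
        obtain ⟨a0, a1, -⟩ := uA_go_zero (o := o) (β := β) 1 (mid o β z) δ
        rw [a0, a1]
        exact div_lt_div_of_pos_right (by nlinarith [h.uA_mid.1, mul_pos h.α₁_pos h1])
          (by linarith)
      filter_upwards [(continuous_uA 0).continuousAt.eventually_lt
        (continuous_uA 1).continuousAt this] with x hx _ hA using absurd hA hx.not_gt
  have e2 : ∀ᶠ x in 𝓝 y, x ∈ phaseSpace → uB o β 0 x < uB o β 1 x → Arrives o β z ε S x := by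
    by_cases hyb : y = endPt o β z
    · subst hyb
      have e4 := h.eventually_arrives_of_mem_first (left_mem_segment ℝ _ _) hε hS
      rw [← h.turn_end] at e4
      filter_upwards [continuous_turn.continuousAt.eventually e4,
        eventually_infDist (h.segment_second_subset (right_mem_segment ℝ _ _)) hε]
        with x hx hx' hp _
      exact Arrives.of_leads h (leads_turn hx' 1) (hx (turn_mem_iff.2 hp))
    · have : uB o β 1 y < uB o β 0 y := by
        obtain ⟨δ, hδ, rfl⟩ := h.exists_eq_go_second hy
        have h1 : δ < 1 / z / gain o β z - 1 :=
          lt_of_le_of_ne hδ.2 fun h1 => hyb (by rw [h1]; rfl)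
        have h2 := h.waitB_second hδ.1
        have h3 : 0 < (1 / z / gain o β z - 1 - δ) / (1 + δ) :=
          div_pos (by linarith) (by linarith [hδ.1])
        rw [← h2, waitB, lt_div_iff₀ (by linarith [h.c₁_lt])] at h3
        linarith
      filter_upwards [(continuous_uB 1).continuousAt.eventually_lt
        (continuous_uB 0).continuousAt this] with x hx _ hA using absurd hA hx.not_gt
  filter_upwards [e1, e2, h.eventually_arrives_second hy hε hS] with x h1 h2 h3 hp
  rcases lt_or_ge (uA o β 1 x) (uA o β 0 x) with hA | hA
  · exact h1 hp hA
  rcases lt_or_ge (uB o β 0 x) (uB o β 1 x) with hB | hB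
  · exact h2 hp hB
  · exact h3 hp hA hB

/-- All solutions from points near the orbit arrive near the base point. -/
theorem eventually_arrives (h : IsRatio o β z) {y : State} (hy : y ∈ range (orbit o β z)) {ε : ℝ}
    (hε : 0 < ε) {S : Set State} (hS : S ∈ 𝓝 (base o β z)) :
    ∀ᶠ x in 𝓝 y, x ∈ phaseSpace → Arrives o β z ε S x := by
  obtain ⟨n, hn⟩ := h.exists_turn_mem hy
  have hc : Continuous (turn o)^[n] := continuous_turn.iterate n
  have e : ∀ᶠ x in 𝓝 ((turn o)^[n] y), x ∈ phaseSpace → Arrives o β z ε S x :=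
    hn.elim (fun hn => h.eventually_arrives_of_mem_first hn hε hS)
      fun hn => h.eventually_arrives_of_mem_second hn hε hS
  have hm (n : ℕ) (x : State) (hx : x ∈ phaseSpace) : (turn o)^[n] x ∈ phaseSpace := by
    induction n with
    | zero => exact hx
    | succ n ih => rw [Function.iterate_succ_apply']; exact turn_mem_iff.2 ih
  filter_upwards [hc.continuousAt.eventually e, eventually_infDist hy hε] with x h1 h2 hp
  exact Arrives.of_leads h (leads_turn h2 n) (h1 (hm n x hp))

/-- Near the base point, `sectionMap` is the transition along the solutions; it takes at least a
fixed positive time. -/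
theorem eventually_sectionMap (h : IsRatio o β z) {ε : ℝ} (hε : 0 < ε) :
    ∀ᶠ x in 𝓝 (base o β z), x ∈ phaseSpace → uB o β 2 x = uB o β 0 x →
      (∃ s, Real.log (1 + (gain o β z - 1) / 2) ≤ s ∧
        Leads o β (range (orbit o β z)) ε 1 s x (sectionMap o β x)) ∧
      0 ≤ waitA o β x ∧ 0 ≤ waitB o β (go o 0 0 x (waitA o β x)) := by
  have hl := left_mem_segment ℝ (base o β z) (mid o β z)
  have hm := left_mem_segment ℝ (mid o β z) (endPt o β z)
  have hg := h.one_lt_gain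
  have e0 := (continuous_uA 1).continuousAt.eventually_lt (continuous_uA 0).continuousAt h.uA_one_lt
  have e1 := (continuous_uB 1).continuousAt.eventually_lt (continuous_uB 0).continuousAt h.uB_mid.1
  have e2 : ∀ᶠ x in 𝓝 (endPt o β z), Metric.infDist x (range (orbit o β z)) < ε :=
    eventually_infDist (h.segment_second_subset (right_mem_segment ℝ _ _)) hε
  have e3 : ∀ᶠ x in 𝓝 (base o β z), (gain o β z - 1) / 2 < waitA o β x := by
    refine continuous_waitA.continuousAt.eventually (lt_mem_nhds ?_)
    rw [h.waitA_base]; linarith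
  filter_upwards [e0, e3, h.eventually_first hl hε, (h.tendsto_go_first hl).eventually
    ((e1.and (h.eventually_second hm hε)).and ((h.tendsto_go_second hm).eventually e2))]
    with x h0 h3 h1 h2 hp hB
  obtain ⟨w1, l1, -⟩ := h1 hp hB.le h0.le
  obtain ⟨w2, l2, -⟩ := h2.1.2 (go_mem hp w1) (uA_go_waitA h.α₁_pos 0 x).le h2.1.1.le
  refine ⟨⟨_, ?_, (l1.trans h.turn_image_range l2).trans h.turn_image_range (leads_turn h2.2 1)⟩,
    w1, w2⟩
  have := Real.log_le_log (by linarith) (by linarith :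
    1 + (gain o β z - 1) / 2 ≤ 1 + waitA o β x)
  have := l2.1
  linarith

end IsRatio

end ShapleyGame

namespace ShapleyGame

/-! ### Asymptotic stability -/

variable {o : Orient} {β z : ℝ}

variable (o) in
/-- The coordinates of a state that determine it on the section. -/
def coords (x : State) : ℝ × ℝ × ℝ × ℝ := (wB o 2 x, wB o 1 x, wA o 2 x, wA o 1 x)

theorem continuous_coords : Continuous (coords o) := by
  unfold coords wB wA
  fun_prop

theorem height_coords (hc : o.c₁ β < 1) {x : State} (hx : x ∈ phaseSpace)
    (ht : uB o β 2 x = uB o β 0 x) : height o β (coords o x) = 1 := by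
  obtain ⟨-, -, h1, -⟩ := (mem_phaseSpace_iff (o := o)).1 hx
  have hc' : 1 - o.c₁ β ≠ 0 := by linarith
  have h0 : wA o 0 x = 1 - wA o 1 x - wA o 2 x := by linarith
  simp only [uB_eq, show (2 : Fin 3) + 1 = 0 from rfl, show (2 : Fin 3) + 2 = 1 from rfl,
    zero_add, h0] at ht
  rw [height, coords, div_eq_one_iff_eq hc']
  linear_combination ht

/-- A state on the section is determined by its coordinates. -/
theorem point_coords (hc : o.c₁ β < 1) {x : State} (hx : x ∈ phaseSpace)
    (ht : uB o β 2 x = uB o β 0 x) : point o β (coords o x) = x := by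
  rw [point, height_coords hc hx ht]
  simp only [div_one]
  exact (eq_pt hx).symm

theorem uB_point (hc : o.c₁ β < 1) {v : ℝ × ℝ × ℝ × ℝ} (hv : height o β v ≠ 0) :
    uB o β 2 (point o β v) = uB o β 0 (point o β v) := by
  have hc' : 1 - o.c₁ β ≠ 0 := by linarith
  have h1 : (2 - o.c₁ β - o.c₂ β) * v.2.2.1 + (1 - 2 * o.c₁ β + o.c₂ β) * v.2.2.2 =
      height o β v * (1 - o.c₁ β) := by
    rw [height]; field_simp
  simp only [uB_eq, point, wA_pt]
  simp
  generalize height o β v = k at hv h1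
  field_simp
  linear_combination h1

/-- In homogeneous coordinates, the transition map is the linear map `nextV`. -/
theorem sectionMap_point (hα : 0 < o.α₁ β) (hc : o.c₁ β < 1) {v : ℝ × ℝ × ℝ × ℝ}
    (hv : 0 < height o β v) (hA : 0 ≤ waitA o β (point o β v))
    (hB : 0 ≤ waitB o β (go o 0 0 (point o β v) (waitA o β (point o β v)))) :
    sectionMap o β (point o β v) = point o β (nextV o β v) := by
  set w : ℝ × ℝ × ℝ × ℝ := (height o β v)⁻¹ • v with hw
  have hpw : point o β v = pt o w.1 w.2.1 w.2.2.1 w.2.2.2 := by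
    simp only [point, hw, Prod.smul_fst, Prod.smul_snd, smul_eq_mul, div_eq_inv_mul]
  rw [hpw] at hA hB
  have h1 := waitA_pt hα w.1 w.2.1 w.2.2.1 w.2.2.2
  have hg : 0 < nextG o β w.1 w.2.1 := by linarith
  have h1' : waitA o β (pt o w.1 w.2.1 w.2.2.1 w.2.2.2) = nextG o β w.1 w.2.1 - 1 := by linarith
  rw [h1'] at hB
  have h2 := waitB_go_pt hc (y₁ := w.2.2.1) (y₂ := w.2.2.2) rfl hg
  have hh : 0 < nextH o β w.1 w.2.1 w.2.2.1 w.2.2.2 := by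
    have : 0 < nextH o β w.1 w.2.1 w.2.2.1 w.2.2.2 / nextG o β w.1 w.2.1 := by linarith
    exact (div_pos_iff_of_pos_right hg).1 this
  have h3 := turn_go_go_pt (y₁ := w.2.2.1) (y₂ := w.2.2.2) rfl hg rfl hh
  rw [sectionMap, hpw, h1', show ∀ a b : ℝ, 1 + a = b ↔ a = b - 1 from
    fun a b => by constructor <;> intro h <;> linarith] at *
  rw [h2, h3, ← point_smul (inv_pos.2 hv).ne' (nextV o β v), ← nextV_smul, ← hw, point,
    height_nextV]
  rfl

namespace IsRatio

theorem coords_base : coords o (base o β z) = baseV o β z := by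
  simp [coords, base, wA_pt, wB_pt, baseV]

/-- Solutions that start on the section near the base point remain close to the orbit, and tend to
it. -/
theorem eventually_section (h : IsRatio o β z) (hs : |slope o β z| < 1 + z ^ 3) {ε : ℝ}
    (hε : 0 < ε) :
    ∀ᶠ x in 𝓝 (base o β z), x ∈ phaseSpace → uB o β 2 x = uB o β 0 x →
      ∀ p, IsSolutionOn β (Ici 0) p → p 0 = x →
        (∀ t, 0 ≤ t → Metric.infDist (p t) (range (orbit o β z)) < ε) ∧
        Tendsto (fun t => Metric.infDist (p t) (range (orbit o β z))) atTop (𝓝 0) := by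
  set Γ := range (orbit o β z) with hΓdef
  have hΓ : turn o '' Γ = Γ := h.turn_image_range
  set τ₀ := Real.log (1 + (gain o β z - 1) / 2) with hτ₀
  have hτ : 0 < τ₀ := Real.log_pos (by linarith [h.one_lt_gain])
  have e1 := h.eventually_scaled hs (h.eventually_sectionMap hε)
  rw [← coords_base] at e1
  filter_upwards [continuous_coords.continuousAt.eventually e1] with x hx hp ht
  obtain ⟨h1, h2⟩ := hx
  set X : ℕ → State := fun n => point o β (scaled o β z (coords o x) n) with hX
  have hX0 : X 0 = x := point_coords h.c₁_lt hp ht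
  have tie (n) : uB o β 2 (X n) = uB o β 0 (X n) := uB_point h.c₁_lt (h1 n).1.ne'
  have succ (n) (hn : 0 ≤ waitA o β (X n) ∧ 0 ≤ waitB o β (go o 0 0 (X n) (waitA o β (X n)))) :
      sectionMap o β (X n) = X (n + 1) := by
    rw [hX]
    simp only
    rw [sectionMap_point h.α₁_pos h.c₁_lt (h1 n).1 hn.1 hn.2, scaled_succ, point_smul h.pos.ne']
  have mem (n) : X n ∈ phaseSpace := by
    induction n with
    | zero => rwa [hX0]
    | succ n ih =>
      obtain ⟨-, hw⟩ := (h1 n).2 ih (tie n)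
      rw [← succ n hw]
      exact turn_mem_iff.2 (go_mem (go_mem ih hw.1) hw.2)
  have lead {ε' : ℝ} {n} (hn : X n ∈ phaseSpace → uB o β 2 (X n) = uB o β 0 (X n) →
      (∃ s, τ₀ ≤ s ∧ Leads o β Γ ε' 1 s (X n) (sectionMap o β (X n))) ∧
      0 ≤ waitA o β (X n) ∧ 0 ≤ waitB o β (go o 0 0 (X n) (waitA o β (X n)))) :
      ∃ s, τ₀ ≤ s ∧ Leads o β Γ ε' 1 s (X n) (X (n + 1)) := by
    obtain ⟨hl, hw⟩ := hn (mem n) (tie n)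
    rwa [succ n hw] at hl
  have lead1 (n) := lead (h1 n).2
  intro p hp h0
  rw [← hX0] at h0
  refine ⟨fun t ht => infDist_lt_of_leads hΓ hτ lead1 hp h0 ht, ?_⟩
  -- convergence: from some iterate on, the states are so close to the base point that the whole
  -- third of a revolution remains within the smaller distance
  rw [Metric.tendsto_atTop]
  intro ε' hε'
  obtain ⟨N, hN⟩ := eventually_atTop.1 (h2.eventually (h.eventually_sectionMap hε'))
  have hi : Metric.infDist (X 0) Γ < ε := by
    rw [← h0]
    exact infDist_lt_of_leads hΓ hτ lead1 hp h0 le_rfl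
  obtain ⟨s, -, hl⟩ := leads_seq hΓ (N := N) (fun n _ => lead1 n) hi
  refine ⟨s, fun t ht => ?_⟩
  rw [Real.dist_0_eq_abs, abs_of_nonneg Metric.infDist_nonneg]
  exact hl.tail hΓ hp h0 (P := fun r => r < ε') (fun q hq hq0 t ht =>
    infDist_lt_of_leads (x := fun n => X (N + n)) hΓ hτ
      (fun n => lead (hN (N + n) (Nat.le_add_right N n))) hq hq0 ht) t ht

theorem isCompact_range (h : IsRatio o β z) : IsCompact (range (orbit o β z)) :=
  Function.Periodic.compact_of_continuous h.orbit_periodic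
    (by linarith [h.log_neg]) h.continuous_orbit

theorem eventually_near (h : IsRatio o β z) (hs : |slope o β z| < 1 + z ^ 3) {ε : ℝ}
    (hε : 0 < ε) {y : State} (hy : y ∈ range (orbit o β z)) :
    ∀ᶠ x in 𝓝 y, ∀ p, IsSolutionOn β (Ici 0) p → p 0 = x →
        (∀ t, 0 ≤ t → Metric.infDist (p t) (range (orbit o β z)) < ε) ∧
        Tendsto (fun t => Metric.infDist (p t) (range (orbit o β z))) atTop (𝓝 0) := by
  filter_upwards [h.eventually_arrives hy hε (h.eventually_section hs hε)] with x hx p hp h0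
  obtain ⟨n, s, x', hl, hx', ht, hS⟩ := hx (h0 ▸ hp.1 0 self_mem_Ici)
  have hq := hl.2 p hp h0
  have hS' := hS hx' ht
  constructor
  · intro t ht0
    rcases le_total t s with hts | hts
    · exact hq.2 t ⟨ht0, hts⟩
    · exact hl.tail h.turn_image_range hp h0 (P := fun r => r < ε)
        (fun q hq hq0 => (hS' q hq hq0).1) t hts
  · have := (hS' _ ((hp.shift hl.1).turn_iterate (o := o) n) (by simpa using hq.1)).2
    simp only [infDist_turn_iterate h.turn_image_range] at this
    rw [← map_add_atTop_eq s, tendsto_map'_iff]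
    exact this

/-- The orbit is asymptotically stable if the quadratic factor of the characteristic polynomial of
the transition map satisfies the Jury criterion. -/
theorem isAttracting (h : IsRatio o β z) (hs : |slope o β z| < 1 + z ^ 3) :
    IsAttracting β (range (orbit o β z)) := by
  constructor
  · intro U hU
    obtain ⟨O, hO, hΓO, hOU⟩ := mem_nhdsSet_iff_exists.1 hU
    obtain ⟨ε, hε, hεU⟩ := h.isCompact_range.exists_thickening_subset_open hO hΓO
    refine ⟨{x | ∀ p, IsSolutionOn β (Ici 0) p → p 0 = x → ∀ t, 0 ≤ t → p t ∈ U},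
      mem_nhdsSet_iff_forall.2 fun y hy => ?_, fun p hp h0 t ht => h0 p hp rfl t ht⟩
    filter_upwards [h.eventually_near hs hε hy] with x hx p hp h0 t ht
    refine hOU (hεU ?_)
    rw [Metric.mem_thickening_iff_infDist_lt ⟨_, hy⟩]
    exact (hx p hp h0).1 t ht
  · refine ⟨{x | ∀ p, IsSolutionOn β (Ici 0) p → p 0 = x →
      Tendsto (fun t => Metric.infDist (p t) (range (orbit o β z))) atTop (𝓝 0)},
      mem_nhdsSet_iff_forall.2 fun y hy => ?_, fun p hp h0 => h0 p hp rfl⟩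
    filter_upwards [h.eventually_near hs one_pos hy] with x hx p hp h0
    exact (hx p hp h0).2

end IsRatio

end ShapleyGame

namespace ShapleyGame

/-! ### Ratios, the critical parameter, and the eigenvalue -/

variable {o : Orient} {β z : ℝ}

/-- A family of functions on `[0, 1]` with one change of sign each: the zero depends continuously
on the parameter, and tends to `1` where the sign at `1` changes. -/
theorem exists_continuousOn_root {I J : Set ℝ} (hIJ : I ⊆ J)
    {g : ℝ → ℝ → ℝ} (hβ : ∀ z, Continuous fun β => g β z)
    (hz : ∀ β, Continuous (g β)) (h0 : ∀ β ∈ I, g β 0 < 0) (h1 : ∀ β ∈ I, 0 < g β 1)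
    (hg : ∀ β ∈ J, ∀ z w, 0 < z → z < w → w ≤ 1 → 0 ≤ g β z → 0 < g β w) :
    ∃ ζ : ℝ → ℝ, (∀ β ∈ I, ζ β ∈ Ioo 0 1 ∧ g β (ζ β) = 0) ∧ ContinuousOn ζ I ∧
      ∀ β ∈ J, g β 1 ≤ 0 → Tendsto ζ (𝓝[I] β) (𝓝 1) := by
  have ex : ∀ β, ∃ z, β ∈ I → z ∈ Ioo (0 : ℝ) 1 ∧ g β z = 0 := by
    intro β
    by_cases hI : β ∈ I
    · obtain ⟨z, hz1, hz2⟩ := intermediate_value_Ioo zero_le_one (hz β).continuousOn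
        ⟨h0 β hI, h1 β hI⟩
      exact ⟨z, fun _ => ⟨hz1, hz2⟩⟩
    · exact ⟨0, fun h => absurd h hI⟩
  choose ζ hζ using ex
  have lower : ∀ β a, 0 < a → a ≤ 1 → g β a < 0 → ∀ᶠ b in 𝓝[I] β, a < ζ b := by
    intro β a ha0 ha1 ha
    filter_upwards [((hβ a).continuousAt.eventually (gt_mem_nhds ha)).filter_mono
      nhdsWithin_le_nhds, self_mem_nhdsWithin] with b hb hbI
    obtain ⟨m, e⟩ := hζ b hbI
    by_contra! hle
    rcases hle.eq_or_lt with rfl | hlt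
    · exact hb.ne e
    · exact absurd (hg b (hIJ hbI) _ _ m.1 hlt ha1 e.ge) hb.not_gt
  refine ⟨ζ, hζ, fun β hβI => ?_, fun β hβI hβ1 => ?_⟩
  · obtain ⟨m, e⟩ := hζ β hβI
    refine tendsto_order.2 ⟨fun a ha => ?_, fun b hb => ?_⟩
    · obtain ⟨c, hc1, hc2⟩ := exists_between (max_lt ha m.1)
      refine (lower β c ((le_max_right _ _).trans_lt hc1) (hc2.trans m.2).le ?_).mono
        fun b hb => ((le_max_left _ _).trans_lt hc1).trans hb
      by_contra! h
      exact (hg β (hIJ hβI) _ _ ((le_max_right _ _).trans_lt hc1) hc2 m.2.le h).ne' e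
    · obtain ⟨c, hc1, hc2⟩ := exists_between (lt_min hb m.2)
      have hc3 := hg β (hIJ hβI) _ _ m.1 hc1 (hc2.trans_le (min_le_right _ _)).le e.ge
      filter_upwards [((hβ c).continuousAt.eventually (lt_mem_nhds hc3)).filter_mono
        nhdsWithin_le_nhds, self_mem_nhdsWithin] with b' hb' hbI
      obtain ⟨m', e'⟩ := hζ b' hbI
      refine lt_of_lt_of_le ?_ (hc2.trans_le (min_le_left _ _)).le
      by_contra! hle
      rcases hle.eq_or_lt with h | hlt
      · rw [h] at hb'; exact hb'.ne' e'
      · exact (hg b' (hIJ hbI) _ _ (m.1.trans hc1) hlt m'.2.le hb'.le).ne' e'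
  · refine tendsto_order.2 ⟨fun a ha => ?_, fun b hb => ?_⟩
    · obtain ⟨c, hc1, hc2⟩ := exists_between (max_lt ha zero_lt_one)
      refine (lower β c ((le_max_right _ _).trans_lt hc1) hc2.le ?_).mono
        fun b hb => ((le_max_left _ _).trans_lt hc1).trans hb
      by_contra! h
      exact (hg β hβI _ _ ((le_max_right _ _).trans_lt hc1) hc2 le_rfl h).not_ge hβ1
    · filter_upwards [self_mem_nhdsWithin] with b' hb'
      exact (hζ b' hb').1.2.trans hb

/-- The cubic polynomial whose root in `(0, 1)` is the ratio of the clockwise orbit. -/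
def cwCubic (β z : ℝ) : ℝ :=
  (1 + β) * z ^ 3 + 2 * (1 - β ^ 2) * z ^ 2 + (1 - 3 * β - β ^ 2) * z - (1 + β)

/-- The cubic polynomial whose root in `(0, 1)` is the ratio of the anticlockwise orbit. -/
def acwCubic (β z : ℝ) : ℝ :=
  β * z ^ 3 - (1 - 3 * β - β ^ 2) * z ^ 2 - (2 - 2 * β ^ 2) * z - β

theorem isRatio_cw (h0 : 0 ≤ β) (hz : z ∈ Ioo (0 : ℝ) 1) (hr : cwCubic β z = 0) :
    IsRatio .cw β z := by
  obtain ⟨z0, z1⟩ := hz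
  rw [cwCubic] at hr
  have h1 : 0 ≤ β * z * (1 - z) := mul_nonneg (mul_nonneg h0 z0.le) (by linarith)
  constructor <;> try simp only [Orient.α₁, Orient.α₂, Orient.c₁, Orient.c₂, denA]
  · exact one_pos
  · exact h0
  · linarith
  · exact one_pos
  · exact z0
  · exact z1
  · nlinarith [mul_nonneg h0 z0.le]
  · linear_combination (z - 1) * hr
  · nlinarith
  · nlinarith
  · have : 0 < (1 - z) * (1 + β + β ^ 2) := mul_pos (by linarith) (by positivity)
    nlinarith

theorem isRatio_acw (h0 : 0 < β) (h1 : β < 1) (hz : z ∈ Ioo (0 : ℝ) 1) (hr : acwCubic β z = 0) :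
    IsRatio .acw β z := by
  obtain ⟨z0, z1⟩ := hz
  rw [acwCubic] at hr
  have h2 : 0 < β * (1 - z) := mul_pos h0 (by linarith)
  have h3 : 0 < (1 - z) * (1 - β * z) := mul_pos (by linarith) (by nlinarith)
  constructor <;> try simp only [Orient.α₁, Orient.α₂, Orient.c₁, Orient.c₂, denA]
  · exact h0
  · exact zero_le_one
  · exact one_pos
  · linarith
  · exact z0
  · exact z1
  · nlinarith
  · linear_combination (z - 1) * hr
  · nlinarith
  · nlinarith
  · have : 0 < (1 - z) * (1 + β + β ^ 2) := mul_pos (by linarith) (by positivity)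
    nlinarith

/-- The golden mean is the value of `β` at which both cubic polynomials have the root `1`. -/
theorem σ_sq : σ ^ 2 = 1 - σ := by
  have := Real.sq_sqrt (show (0 : ℝ) ≤ 5 by norm_num)
  rw [σ]; linarith

theorem σ_pos : 0.618 < σ := by
  have : (2.236 : ℝ) < Real.sqrt 5 := Real.lt_sqrt_of_sq_lt (by norm_num)
  rw [σ]; linarith

theorem σ_lt : σ < 0.619 := by
  have : Real.sqrt 5 < (2.238 : ℝ) := (Real.sqrt_lt' (by norm_num)).2 (by norm_num)
  rw [σ]; linarith

/-- The ratios of the clockwise orbits. -/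
theorem exists_ratio_cw : ∃ ζ : ℝ → ℝ,
    (∀ β ∈ Ico 0 σ, ζ β ∈ Ioo 0 1 ∧ cwCubic β (ζ β) = 0) ∧ ContinuousOn ζ (Ico 0 σ) ∧
      Tendsto ζ (𝓝[<] σ) (𝓝 1) := by
  have hσ := σ_pos
  have hσ' := σ_lt
  have hsq := σ_sq
  obtain ⟨ζ, h1, h2, h3⟩ := exists_continuousOn_root Ico_subset_Icc_self
    (I := Ico 0 σ) (J := Icc 0 σ) (g := cwCubic)
    (fun z => by unfold cwCubic; fun_prop) (fun β => by unfold cwCubic; fun_prop)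
    (fun β hβ => by rw [cwCubic]; linarith [hβ.1])
    (fun β hβ => by rw [cwCubic]; nlinarith [hβ.1, hβ.2]) (fun β hβ z w hz hw hw1 hg => by
      rw [cwCubic] at hg
      have b1 : 0 < 1 + β := by linarith [hβ.1]
      have b2 : 0 < 1 - β ^ 2 := by nlinarith [hβ.1, hβ.2]
      have hwz : 0 < w - z := by linarith
      have hw0 : 0 < w := hz.trans hw
      have key : z * cwCubic β w - w * cwCubic β z = (1 + β) * (z * w) * ((w - z) * (w + z)) +
          2 * (1 - β ^ 2) * (z * w) * (w - z) + (1 + β) * (w - z) := by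
        rw [cwCubic, cwCubic]; ring
      have : 0 < z * cwCubic β w - w * cwCubic β z := by rw [key]; positivity
      have h4 : 0 ≤ w * cwCubic β z := mul_nonneg hw0.le hg
      exact (mul_pos_iff_of_pos_left hz).1 (by linarith))
  refine ⟨ζ, h1, h2, ?_⟩
  have := h3 σ ⟨by linarith, le_rfl⟩ (by rw [cwCubic]; linarith)
  rwa [nhdsWithin_Ico_eq_nhdsLT (by linarith)] at this

/-- `acwCubic β z / z ^ 2` increases in `z`, hence there is at most one root. -/
theorem acwCubic_pos {w : ℝ} (h0 : 0 < β) (h1 : β < 1) (hz : 0 < z) (hw : z < w)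
    (hg : 0 ≤ acwCubic β z) : 0 < acwCubic β w := by
  have b2 : 0 < 2 - 2 * β ^ 2 := by nlinarith
  have hwz : 0 < w - z := by linarith
  have hw0 : 0 < w := hz.trans hw
  have key : z ^ 2 * acwCubic β w - w ^ 2 * acwCubic β z = β * (z ^ 2 * w ^ 2) * (w - z) +
      (2 - 2 * β ^ 2) * (z * w) * (w - z) + β * ((w - z) * (w + z)) := by
    rw [acwCubic, acwCubic]; ring
  have : 0 < z ^ 2 * acwCubic β w - w ^ 2 * acwCubic β z := by rw [key]; positivity
  have h4 : 0 ≤ w ^ 2 * acwCubic β z := mul_nonneg (sq_nonneg w) hg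
  exact (mul_pos_iff_of_pos_left (pow_pos hz 2)).1 (by linarith)

/-- The ratios of the anticlockwise orbits. -/
theorem exists_ratio_acw : ∃ ζ : ℝ → ℝ,
    (∀ β ∈ Ioo σ 1, ζ β ∈ Ioo 0 1 ∧ acwCubic β (ζ β) = 0) ∧ Tendsto ζ (𝓝[>] σ) (𝓝 1) := by
  have hσ := σ_pos
  have hσ' := σ_lt
  have hsq := σ_sq
  obtain ⟨ζ, h1, -, h3⟩ := exists_continuousOn_root Ioo_subset_Ico_self
    (I := Ioo σ 1) (J := Ico σ 1) (g := acwCubic)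
    (fun z => by unfold acwCubic; fun_prop) (fun β => by unfold acwCubic; fun_prop)
    (fun β hβ => by rw [acwCubic]; linarith [hβ.1])
    (fun β hβ => by rw [acwCubic]; nlinarith [hβ.1, hβ.2]) (fun β hβ z w hz hw _ hg =>
      acwCubic_pos (by linarith [hβ.1]) hβ.2 hz hw hg)
  refine ⟨ζ, h1, ?_⟩
  have := h3 σ ⟨le_rfl, by linarith⟩ (by rw [acwCubic]; linarith)
  rwa [nhdsWithin_Ioo_eq_nhdsGT (by linarith)] at this

theorem wave_mem_Icc (hz0 : 0 < z) (hz1 : z < 1) (t : ℝ) :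
    wave z t ∈ Icc (z ^ 2 / (1 + z + z ^ 2)) (1 / (1 + z + z ^ 2)) := by
  have hl : Real.log z < 0 := Real.log_neg hz0 hz1
  have hq : 0 < 1 + z + z ^ 2 := by positivity
  have hper : Function.Periodic (wave z) (-3 * Real.log z) := fun t => by
    rw [← wave_periodic hz0 hz1 t]; congr 1; ring
  obtain ⟨s, hs, e⟩ := hper.exists_mem_Ico₀ (by linarith) t
  rw [e]
  have e1 : Real.exp (3 * Real.log z) = z ^ 3 := by
    rw [mul_comm, Real.exp_mul, Real.exp_log hz0]; norm_cast
  rcases le_total s (-Real.log z) with h | h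
  · rw [wave_rise hz0 hz1 hs.1 h]
    have h1 : Real.exp (-s) ≤ 1 := Real.exp_le_one_iff.2 (by linarith [hs.1])
    have h2 : z ≤ Real.exp (-s) := (Real.log_le_iff_le_exp hz0).1 (by linarith)
    constructor
    · rw [div_le_iff₀ hq, sub_mul, div_mul_cancel₀ _ hq.ne']
      nlinarith
    · rw [le_div_iff₀ hq, sub_mul, div_mul_cancel₀ _ hq.ne']
      nlinarith
  · rw [wave_fall hz0 hz1 h hs.2.le]
    have h1 : Real.exp (-s) ≤ z := (Real.le_log_iff_exp_le hz0).1 (by linarith)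
    have h2 : z ^ 3 ≤ Real.exp (-s) := by
      rw [← e1]; exact Real.exp_le_exp.2 (by linarith [hs.2])
    rw [mem_Icc, ← div_div, div_le_div_iff_of_pos_right hq, div_le_div_iff_of_pos_right hq,
      le_div_iff₀ hz0, div_le_one hz0]
    exact ⟨by linarith [h2, show z ^ 2 * z = z ^ 3 by ring], h1⟩

/-- The orbit is small if the ratio is close to `1`. -/
theorem range_orbit_subset (hz0 : 0 < z) (hz1 : z < 1) :
    range (orbit o β z) ⊆ Metric.closedBall E (1 - z) := by
  have hq : 0 < 1 + z + z ^ 2 := by positivity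
  have key (t : ℝ) : dist (wave z t) (1 / 3) ≤ 1 - z := by
    obtain ⟨h1, h2⟩ := wave_mem_Icc hz0 hz1 t
    rw [div_le_iff₀ hq] at h1
    rw [le_div_iff₀ hq] at h2
    rw [Real.dist_eq, abs_le]
    constructor
    · by_contra! h
      nlinarith [mul_lt_mul_of_pos_right h hq, mul_pos hz0 (sub_pos.2 hz1)]
    · by_contra! h
      nlinarith [mul_lt_mul_of_pos_right h hq, mul_pos hz0 (sub_pos.2 hz1)]
  rintro _ ⟨t, rfl⟩
  rw [Metric.mem_closedBall, Prod.dist_eq]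
  have h1z : 0 ≤ 1 - z := by linarith
  exact max_le ((dist_pi_le_iff h1z).2 fun i => key _) ((dist_pi_le_iff h1z).2 fun i => key _)

/-- The orbits shrink to the equilibrium when their ratios tend to `1`. -/
theorem shrinksTo_orbit {β : ℝ → ℝ} {ζ : ℝ → ℝ} {l : Filter ℝ}
    (h : ∀ᶠ b in l, ζ b ∈ Ioo (0 : ℝ) 1) (hl : Tendsto ζ l (𝓝 1)) :
    ShrinksTo (fun b => range (orbit o (β b) (ζ b))) l E := by
  have h0 : Tendsto (fun b => 1 - ζ b) l (𝓝 0) := by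
    simpa using hl.const_sub 1
  constructor
  · intro U hU
    obtain ⟨ε, hε, hU⟩ := Metric.mem_nhds_iff.1 hU
    filter_upwards [h, h0.eventually (gt_mem_nhds hε)] with b hb hb'
    exact (range_orbit_subset hb.1 hb.2).trans
      ((Metric.closedBall_subset_ball hb').trans hU)
  · refine squeeze_zero' (Eventually.of_forall fun b => Metric.diam_nonneg)
      (h.mono fun b hb => ?_) (by simpa using h0.const_mul 2)
    refine (Metric.diam_mono (range_orbit_subset hb.1 hb.2) Metric.isBounded_closedBall).trans
      (Metric.diam_closedBall (by linarith [hb.2]))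

/-- The clockwise orbit satisfies the stability criterion. -/
theorem abs_slope_cw (h0 : 0 ≤ β) (h1 : β < 1) (hz : z ∈ Ioo (0 : ℝ) 1) (hr : cwCubic β z = 0) :
    |slope .cw β z| < 1 + z ^ 3 := by
  obtain ⟨z0, z1⟩ := hz
  have hS : slope .cw β z = -(z ^ 2 * (2 * (1 - β) + z)) := by
    have : 1 + β ≠ 0 := by positivity
    simp only [slope, Orient.α₁, Orient.α₂, Orient.c₁, Orient.c₂]
    rw [show (1 - 2 * -β + 0) * (1 + β) / ((1 - -β) * 1) = 1 + 2 * β by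
      rw [div_eq_iff (by rwa [sub_neg_eq_add, mul_one])]; ring]
    ring
  have hz3 : 0 < z ^ 3 := by positivity
  have key : 2 * (1 - β) * z ^ 2 < 1 := by
    by_contra! hle
    have hb : β < 1 / 2 := by nlinarith
    rw [cwCubic] at hr
    have h5 : (2 * (1 - β) * z ^ 2 - 1) * (1 + β) ≥ 0 := mul_nonneg (by linarith) (by linarith)
    have h2 : z * ((1 + β) * z ^ 2 + 1 - 3 * β - β ^ 2) ≤ 0 := by nlinarith
    have h3 : (1 + β) * z ^ 2 + 1 - 3 * β - β ^ 2 ≤ 0 := by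
      by_contra! h
      exact absurd h2 (mul_pos z0 h).not_ge
    have h4 : 2 * (1 - β) * ((1 + β) * z ^ 2 + 1 - 3 * β - β ^ 2) ≤ 0 := by nlinarith
    nlinarith [mul_nonneg h0 h0, mul_nonneg h0 (mul_nonneg h0 h0), sq_nonneg (β - 1 / 2)]
  rw [hS, abs_neg, abs_of_nonneg]
  · nlinarith
  · have : 0 < 1 - β := by linarith
    positivity

theorem slope_acw (h0 : 0 < β) (hz : z ∈ Ioo (0 : ℝ) 1) (hr : acwCubic β z = 0) :
    slope .acw β z * (z + 2) = -(z * (2 * z ^ 2 + 6 * z + 1)) := by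
  obtain ⟨z0, z1⟩ := hz
  rw [acwCubic] at hr
  simp only [slope, Orient.α₁, Orient.α₂, Orient.c₁, Orient.c₂]
  field_simp
  linear_combination -hr

/-- The equation for the ratio, solved for `1 / β - β`. -/
theorem acwCubic_eq_zero_iff (h0 : 0 < β) (hz : 0 < z) :
    acwCubic β z = 0 ↔ 1 / β - β = (z ^ 3 + 3 * z ^ 2 - 1) / (z ^ 2 + 2 * z) := by
  have h1 : acwCubic β z =
      -β * ((1 / β - β) * (z ^ 2 + 2 * z) - (z ^ 3 + 3 * z ^ 2 - 1)) := by
    rw [acwCubic]; field_simp; ring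
  rw [h1, mul_eq_zero, or_iff_right (neg_ne_zero.2 h0.ne'), sub_eq_zero, eq_div_iff (by positivity)]

/-- The right-hand side of the equation in `acwCubic_eq_zero_iff` increases. -/
theorem ratio_fun_lt {w : ℝ} (hz : 0 < z) (hw : z < w) :
    (z ^ 3 + 3 * z ^ 2 - 1) / (z ^ 2 + 2 * z) < (w ^ 3 + 3 * w ^ 2 - 1) / (w ^ 2 + 2 * w) := by
  have hw0 : 0 < w := hz.trans hw
  rw [div_lt_div_iff₀ (by positivity) (by positivity), ← sub_pos]
  have : (w ^ 3 + 3 * w ^ 2 - 1) * (z ^ 2 + 2 * z) - (z ^ 3 + 3 * z ^ 2 - 1) * (w ^ 2 + 2 * w) =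
    (w - z) * (z ^ 2 * w ^ 2 + 2 * (z * w) * (w + z) + 6 * (w * z) + (w + z + 2)) := by ring
  rw [this]
  have : 0 < w - z := by linarith
  positivity

theorem one_div_sub_lt_iff {β' : ℝ} (h0 : 0 < β) (h0' : 0 < β') :
    1 / β - β < 1 / β' - β' ↔ β' < β := by
  have : 1 / β - β - (1 / β' - β') = (β' - β) * (1 / (β * β') + 1) := by field_simp; ring
  have hp : 0 < 1 / (β * β') + 1 := by positivity
  rw [← sub_neg, this, ← sub_neg (a := β')]
  refine ⟨fun h => ?_, fun h => mul_neg_of_neg_of_pos h hp⟩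
  by_contra! hle
  exact (mul_nonneg hle hp.le).not_gt h

/-- The ratio of the anticlockwise orbit decreases. -/
theorem ratio_lt_iff {w β' : ℝ} (h0 : 0 < β) (h0' : 0 < β') (hz : 0 < z) (hw : 0 < w)
    (h : acwCubic β z = 0) (h' : acwCubic β' w = 0) : z < w ↔ β' < β := by
  rw [acwCubic_eq_zero_iff h0 hz] at h
  rw [acwCubic_eq_zero_iff h0' hw] at h'
  rw [← one_div_sub_lt_iff h0 h0', h, h']
  refine ⟨ratio_fun_lt hz, fun h1 => ?_⟩
  by_contra! hle
  rcases hle.eq_or_lt with rfl | hlt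
  · exact h1.false
  · exact (ratio_fun_lt hw hlt).not_gt h1

/-- The ratio at which the multiplier `-1` occurs: `z² = 3 - √7`. -/
theorem exists_critical : ∃ τ z : ℝ, 0.915 < τ ∧ τ < 0.9155 ∧ z ∈ Ioo (0 : ℝ) 1 ∧
    acwCubic τ z = 0 ∧ ∀ w ∈ Ioo (0 : ℝ) 1, (0 < w ^ 4 - 6 * w ^ 2 + 2 ↔ w < z) ∧
      (w ^ 4 - 6 * w ^ 2 + 2 < 0 ↔ z < w) := by
  have h7 : (2.64575 : ℝ) < Real.sqrt 7 := Real.lt_sqrt_of_sq_lt (by norm_num)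
  have h7' : Real.sqrt 7 < (2.64576 : ℝ) := (Real.sqrt_lt' (by norm_num)).2 (by norm_num)
  have h7s : Real.sqrt 7 ^ 2 = 7 := Real.sq_sqrt (by norm_num)
  set z := Real.sqrt (3 - Real.sqrt 7) with hz
  have hz2 : z ^ 2 = 3 - Real.sqrt 7 := Real.sq_sqrt (by linarith)
  have hz0 : 0.59515 < z := Real.lt_sqrt_of_sq_lt (by norm_num; linarith)
  have hz1 : z < 0.59525 := (Real.sqrt_lt' (by norm_num)).2 (by norm_num; linarith)
  have hzp : 0 < z := by linarith
  obtain ⟨τ, hτ, e⟩ := intermediate_value_Ioo' (f := fun b => 1 / b - b)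
    (show (0.915 : ℝ) ≤ 0.9155 by norm_num) (by
      refine ContinuousOn.sub (ContinuousOn.div continuousOn_const continuousOn_id ?_)
        continuousOn_id
      intro b hb
      exact (show (0 : ℝ) < b by norm_num at hb ⊢; linarith [hb.1]).ne')
    (show (z ^ 3 + 3 * z ^ 2 - 1) / (z ^ 2 + 2 * z) ∈ _ from by
      constructor
      · refine lt_trans ?_ (ratio_fun_lt (by norm_num) hz0)
        norm_num
      · refine (ratio_fun_lt hzp hz1).trans ?_
        norm_num)
  have hτ0 : 0 < τ := by linarith [hτ.1]
  refine ⟨τ, z, hτ.1, hτ.2, ⟨hzp, by linarith⟩, (acwCubic_eq_zero_iff hτ0 hzp).2 e, fun w hw => ?_⟩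
  have h1 : w ^ 4 - 6 * w ^ 2 + 2 = (w ^ 2 - (3 + Real.sqrt 7)) * (w ^ 2 - z ^ 2) := by
    rw [hz2]; linear_combination h7s
  have h2 : w ^ 2 - (3 + Real.sqrt 7) < 0 := by nlinarith [hw.1, hw.2]
  have h3 : 0 < -(w ^ 2 - (3 + Real.sqrt 7)) := neg_pos.2 h2
  rw [h1, ← neg_mul_neg, mul_pos_iff_of_pos_left h3, neg_pos, sub_neg, mul_neg, neg_lt_zero,
    mul_pos_iff_of_pos_left h3, sub_pos, pow_lt_pow_iff_left₀ hw.1.le hzp.le two_ne_zero,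
    pow_lt_pow_iff_left₀ hzp.le hw.1.le two_ne_zero]
  exact ⟨Iff.rfl, Iff.rfl⟩

/-- The value at `-1` of the quadratic factor `X ^ 2 - slope * X + z ^ 3`, in terms of the ratio
alone. -/
theorem slope_add (h0 : 0 < β) (hz : z ∈ Ioo (0 : ℝ) 1) (hr : acwCubic β z = 0) :
    (1 + z ^ 3 + slope .acw β z) * (z + 2) = z ^ 4 - 6 * z ^ 2 + 2 := by
  linear_combination slope_acw h0 hz hr

theorem slope_acw_neg (h0 : 0 < β) (hz : z ∈ Ioo (0 : ℝ) 1) (hr : acwCubic β z = 0) :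
    slope .acw β z < 0 := by
  have h1 := slope_acw h0 hz hr
  obtain ⟨z0, z1⟩ := hz
  have h2 : 0 < z * (2 * z ^ 2 + 6 * z + 1) := by positivity
  by_contra! h
  nlinarith [mul_nonneg h z0.le]

theorem abs_slope_acw (h0 : 0 < β) (hz : z ∈ Ioo (0 : ℝ) 1) (hr : acwCubic β z = 0)
    (h : 0 < z ^ 4 - 6 * z ^ 2 + 2) : |slope .acw β z| < 1 + z ^ 3 := by
  rw [abs_of_neg (slope_acw_neg h0 hz hr)]
  rw [← slope_add h0 hz hr] at h
  linarith [(mul_pos_iff_of_pos_right (by linarith [hz.1])).1 h]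

/-- The quadratic factor `X ^ 2 - slope * X + z ^ 3` has two different real roots. -/
theorem slope_sq (h0 : 0 < β) (hz : z ∈ Ioo (0 : ℝ) 1) (hr : acwCubic β z = 0) :
    4 * z ^ 3 < slope .acw β z ^ 2 := by
  have h1 := slope_acw h0 hz hr
  obtain ⟨z0, z1⟩ := hz
  have h2 : 0 < (z + 2) ^ 2 := by positivity
  refine lt_of_mul_lt_mul_right ?_ h2.le
  rw [← mul_pow, h1, ← sub_pos]
  have : (-(z * (2 * z ^ 2 + 6 * z + 1))) ^ 2 - 4 * z ^ 3 * (z + 2) ^ 2 =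
    z ^ 2 * (4 * z ^ 4 + 20 * z ^ 3 + 20 * z ^ 2 + (2 * z - 1) ^ 2) := by ring
  rw [this]
  positivity

theorem half_lt_ratio (h0 : 0 < β) (h1 : β < 1) (hz : z ∈ Ioo (0 : ℝ) 1)
    (hr : acwCubic β z = 0) : 1 / 2 < z := by
  obtain ⟨z0, z1⟩ := hz
  rw [acwCubic] at hr
  by_contra! h
  have h2 : z ^ 3 + 3 * z ^ 2 < 1 := by nlinarith
  have h3 : 0 < (1 - β ^ 2) * (z ^ 2 + 2 * z) := mul_pos (by nlinarith) (by positivity)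
  nlinarith

/-- The number `μ` of the statement is a rational function of the ratio: it is the common utility of
the two strategies of B between which this player switches at the base point. -/
theorem mu_props (h0 : 1 / 4 < β) (h1 : β < 1) (hz : z ∈ Ioo (0 : ℝ) 1) (hr : acwCubic β z = 0)
    {μ : ℝ} (hμ : μ = (1 - z * β) / (2 + z + β - z * β)) :
    μ ∈ Ioo 0 (1 / 3 : ℝ) ∧ antiCubic β μ = 0 ∧
      antiN₁ β μ = (z + β) / (1 + z + z ^ 2) ∧ antiN₂ β μ = z * antiN₁ β μ := by
  have hz2 := half_lt_ratio (by linarith) h1 hz hr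
  obtain ⟨z0, z1⟩ := hz
  have hD : 0 < 2 + z + β - z * β := by nlinarith
  have hq : 0 < 1 + z + z ^ 2 := by positivity
  have hb : 0 < 1 + β + β ^ 2 := by nlinarith
  rw [acwCubic] at hr
  have hD' := hD.ne'
  have hm : μ * (2 + z + β - z * β) = 1 - z * β := by rw [hμ, div_mul_cancel₀ _ hD']
  have hn : antiN₁ β μ = (z + β) / (1 + z + z ^ 2) := by
    rw [antiN₁, eq_div_iff hq.ne']
    refine mul_right_cancel₀ hD' ?_
    linear_combination hr - β * (1 + z + z ^ 2) * hm
  refine ⟨⟨?_, ?_⟩, ?_, hn, ?_⟩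
  · rw [hμ]; exact div_pos (by nlinarith) hD
  · rw [hμ, div_lt_iff₀ hD]; nlinarith
  · rw [antiCubic]
    refine (mul_eq_zero.1 ?_).resolve_right (pow_ne_zero 3 hD')
    have h2 : μ ^ 2 * (2 + z + β - z * β) ^ 2 = (1 - z * β) ^ 2 := by rw [← hm]; ring
    have h3 : μ ^ 3 * (2 + z + β - z * β) ^ 3 = (1 - z * β) ^ 3 := by rw [← hm]; ring
    linear_combination (3 * β ^ 3 + 3 * β ^ 2 + 3 * β) * h3 +
      (-5 * β ^ 3 - 7 * β ^ 2 - 4 * β - 2) * (2 + z + β - z * β) * h2 +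
      (2 * β ^ 3 + 5 * β ^ 2 + β + 1) * (2 + z + β - z * β) ^ 2 * hm -
      (1 + β + β ^ 2) ^ 2 * hr
  · rw [antiN₂, antiN₁, div_eq_iff hb.ne']
    refine mul_right_cancel₀ (pow_ne_zero 2 hD') ?_
    have h2 : μ ^ 2 * (2 + z + β - z * β) ^ 2 = (1 - z * β) ^ 2 := by rw [← hm]; ring
    linear_combination (3 * β ^ 2 + 3 * β + 3 * β ^ 3) * h2 -
      (3 * β ^ 3 + 5 * β ^ 2 + 2 * β + 2 - z * β * (1 + β + β ^ 2)) *
        (2 + z + β - z * β) * hm + (β ^ 3 - 1) * hr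

/-- The eigenvalue in closed form: the smaller root of `X² - S X + z³`. -/
theorem eigMinus_eq_neg_one_iff (h0 : 0 < β) (hz : z ∈ Ioo (0 : ℝ) 1)
    (hr : acwCubic β z = 0) {n : ℝ} (hn : n = (z + β) / (1 + z + z ^ 2)) :
    eigMinus β n (z * n) = -1 ↔ z ^ 4 - 6 * z ^ 2 + 2 = 0 := by
  have hS := slope_acw h0 hz hr
  have hSq := slope_sq h0 hz hr
  rw [← slope_add h0 hz hr]
  generalize slope .acw β z = S at hS hSq
  obtain ⟨z0, z1⟩ := hz
  have hq : 0 < 1 + z + z ^ 2 := by positivity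
  have hn0 : 0 < n := by rw [hn]; positivity
  have hnq : n * (1 + z + z ^ 2) = z + β := by rw [hn, div_mul_cancel₀ _ hq.ne']
  rw [acwCubic] at hr
  have hL : z * (-n * (2 * β + 1 + 2 * z + z * β) + 2 * β ^ 2) = S * β := by
    refine mul_right_cancel₀ (mul_pos hq (by linarith : 0 < z + 2)).ne' ?_
    linear_combination -z * (z + 2) * (2 * β + 1 + 2 * z + z * β) * hnq -
      β * (1 + z + z ^ 2) * hS + (2 * z ^ 2 + z) * hr
  have hk : n * (2 + z + β - z * β) = β * (1 + β + z) := by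
    refine mul_right_cancel₀ hq.ne' ?_
    linear_combination (2 + z + β - z * β) * hnq - hr
  have hD : eigDisc β n (z * n) = (β / z) ^ 2 * (S ^ 2 - 4 * z ^ 3) := by
    have : (β / z) ^ 2 * (S ^ 2 - 4 * z ^ 3) = ((S * β) / z) ^ 2 - 4 * z * β ^ 2 := by
      field_simp
    rw [this, ← hL, mul_div_cancel_left₀ _ z0.ne', eigDisc]
    linear_combination -4 * β * hk
  have hsqrt : Real.sqrt (eigDisc β n (z * n)) = β / z * Real.sqrt (S ^ 2 - 4 * z ^ 3) := by
    rw [hD, Real.sqrt_mul (sq_nonneg _), Real.sqrt_sq (by positivity)]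
  have he : eigMinus β n (z * n) = (S - Real.sqrt (S ^ 2 - 4 * z ^ 3)) / 2 := by
    have hL' : -2 * n * β - n - 2 * (z * n) - z * n * β + 2 * β ^ 2 = S * β / z := by
      rw [← hL, mul_div_cancel_left₀ _ z0.ne']; ring
    rw [eigMinus, hsqrt, hL']
    field_simp
  rw [he, mul_eq_zero, or_iff_left (by linarith : z + 2 ≠ 0)]
  constructor
  · intro h
    have h1 : Real.sqrt (S ^ 2 - 4 * z ^ 3) = S + 2 := by linarith
    have h2 := Real.sq_sqrt (by linarith : 0 ≤ S ^ 2 - 4 * z ^ 3)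
    rw [h1] at h2
    linarith
  · intro h
    have h1 : S ^ 2 - 4 * z ^ 3 = (S + 2) ^ 2 := by linear_combination -4 * h
    have h2 : 0 ≤ S + 2 := by nlinarith [pow_lt_one₀ z0.le z1 three_ne_zero]
    rw [h1, Real.sqrt_sq h2]
    ring

end ShapleyGame

namespace ShapleyGame

/-! ### The clockwise orbits -/

variable {o : Orient} {β z : ℝ}

theorem continuousOn_log_gain {ζ : ℝ → ℝ} {I : Set ℝ} (h : ∀ β ∈ I, IsRatio .cw β (ζ β))
    (hζ : ContinuousOn ζ I) : ContinuousOn (fun β => Real.log (gain .cw β (ζ β))) I := by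
  refine ContinuousOn.log ?_ fun β hβ => (h β hβ).gain_pos.ne'
  unfold gain frac
  refine ContinuousOn.div (ContinuousOn.mul (ContinuousOn.div ?_ ?_
    fun β hβ => (h β hβ).den_pos.ne') (by fun_prop)) hζ fun β hβ => (h β hβ).pos.ne'
  · simp only [Orient.c₁]; fun_prop
  · simp only [denA, Orient.c₁, Orient.c₂]; fun_prop

theorem continuousOn_orbit {ζ : ℝ → ℝ} {I : Set ℝ} (h : ∀ β ∈ I, IsRatio .cw β (ζ β))
    (hζ : ContinuousOn ζ I) :
    ContinuousOn (fun q : ℝ × ℝ => orbit .cw q.1 (ζ q.1) q.2) (I ×ˢ univ) := by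
  have h1 : ContinuousOn (fun q : ℝ × ℝ => ζ q.1) (I ×ˢ univ) :=
    hζ.comp continuous_fst.continuousOn fun q hq => hq.1
  have h2 : ContinuousOn (fun q : ℝ × ℝ => Real.log (ζ q.1)) (I ×ˢ univ) :=
    h1.log fun q hq => (h q.1 hq.1).pos.ne'
  have h3 : ContinuousOn (fun q : ℝ × ℝ => Real.log (gain .cw q.1 (ζ q.1))) (I ×ˢ univ) :=
    (continuousOn_log_gain h hζ).comp continuous_fst.continuousOn fun q hq => hq.1
  have hw (f : ℝ × ℝ → ℝ) (hf : ContinuousOn f (I ×ˢ univ)) :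
      ContinuousOn (fun q : ℝ × ℝ => wave (ζ q.1) (f q)) (I ×ˢ univ) :=
    continuousOn_wave.comp (f := fun q : ℝ × ℝ => (ζ q.1, f q)) (h1.prodMk hf) fun q hq =>
      ⟨⟨(h q.1 hq.1).pos, (h q.1 hq.1).lt_one⟩, mem_univ _⟩
  unfold orbit
  refine ContinuousOn.prodMk (continuousOn_pi.2 fun i => hw _ ?_)
    (continuousOn_pi.2 fun i => hw _ ?_) <;> fun_prop

/-- The clockwise orbits. -/
theorem exists_clockwise : ∃ (γ : ℝ → ℝ → State) (T : ℝ → ℝ),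
    (∀ β ∈ Ico 0 σ, IsShapley β (γ β) (T β) ∧ IsSymmetric (range (γ β)) ∧
      IsAttracting β (range (γ β))) ∧
    ContinuousOn T (Ico 0 σ) ∧
    ContinuousOn (fun q : ℝ × ℝ => γ q.1 q.2) (Ico 0 σ ×ˢ univ) ∧
    ShrinksTo (fun β => range (γ β)) (𝓝[<] σ) E := by
  obtain ⟨ζ, h1, h2, h3⟩ := exists_ratio_cw
  have h : ∀ β ∈ Ico 0 σ, IsRatio .cw β (ζ β) := fun β hβ =>
    isRatio_cw hβ.1 (h1 β hβ).1 (h1 β hβ).2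
  refine ⟨fun β => orbit .cw β (ζ β), fun β => -3 * Real.log (ζ β), fun β hβ =>
    ⟨(h β hβ).isShapley, (h β hβ).isSymmetric, (h β hβ).isAttracting ?_⟩, ?_, ?_, ?_⟩
  · exact abs_slope_cw hβ.1 (by linarith [hβ.2, σ_lt]) (h1 β hβ).1 (h1 β hβ).2
  · exact continuousOn_const.mul (h2.log fun β hβ => (h β hβ).pos.ne')
  · exact continuousOn_orbit h h2
  · refine shrinksTo_orbit (β := id) ?_ h3
    filter_upwards [Ico_mem_nhdsLT (by linarith [σ_pos] : (0 : ℝ) < σ)] with β hβ using (h1 β hβ).1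

/-- The utilities at the base point of the anticlockwise orbit, where B switches between the
strategies with indices `2` and `1`. -/
theorem utilities_base (h : IsRatio .acw β z) : vA β (base .acw β z) 0 = (z + β) / (1 + z + z ^ 2) ∧
    vA β (base .acw β z) 1 = z * ((z + β) / (1 + z + z ^ 2)) ∧
    vB β (base .acw β z) 1 = (1 - z * β) / (2 + z + β - z * β) ∧
    vB β (base .acw β z) 2 = (1 - z * β) / (2 + z + β - z * β) := by
  have h1 := h.quad_pos.ne'
  have h2 := h.uB_two_eq
  have hd := h.den_pos
  simp only [denA, Orient.c₁, Orient.c₂] at hd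
  have hd' : 0 < 2 + z + β - z * β := by linarith
  have hB : vB β (base .acw β z) 1 = (1 - z * β) / (2 + z + β - z * β) := by
    change uB .acw β 0 (base .acw β z) = _
    simp only [uB_eq, base, wA_pt, frac, denA, Orient.c₁, Orient.c₂]
    simp
    rw [show 2 + β + (1 + -β) * z = 2 + z + β - z * β by ring]
    field_simp
    ring
  refine ⟨?_, ?_, hB, ?_⟩
  · change uA .acw β 0 (base .acw β z) = _
    simp only [uA_eq, base, wB_pt, Orient.α₁, Orient.α₂]
    simp
    field_simp
    ring
  · change uA .acw β 2 (base .acw β z) = _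
    simp only [uA_eq, base, wB_pt, Orient.α₁, Orient.α₂]
    simp
    field_simp
    ring
  · rw [← hB]; exact h2

end ShapleyGame

namespace ShapleyGame

/-! ### Equations for the switching times -/

variable {o : Orient} {β z : ℝ}

theorem Orient.step_mul_inj {i m : Fin 3} : o.step * i = o.step * m ↔ i = m := by
  cases o <;> revert i m <;> decide

/-- In homogeneous coordinates, a leg of a solution is a straight line. -/
theorem IsSolutionOn.exp_mul {γ : ℝ → State} (hγ : IsSolutionOn β univ γ) {a b : ℝ}
    (hab : a ≤ b) {m k : Fin 3} (h : ∀ s ∈ Ioo a b, γ s ∈ zone o β m k) (i : Fin 3) :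
    Real.exp b * wA o i (γ b) = Real.exp a * wA o i (γ a) +
      (if i = m then Real.exp b - Real.exp a else 0) ∧
    Real.exp b * wB o i (γ b) = Real.exp a * wB o i (γ a) +
      (if i = k then Real.exp b - Real.exp a else 0) := by
  have h' := hγ.mono (subset_univ (Icc a b))
  have e : Real.exp b * Real.exp (a - b) = Real.exp a := by rw [← Real.exp_add]; ring_nf
  have hm := Orient.step_mul_inj (o := o) (i := i) (m := m)
  have hk := Orient.step_mul_inj (o := o) (i := i) (m := k)
  constructor
  · have h1 := congrFun (h'.fst_eq hab fun s hs => (h s hs).2.1) (o.step * i)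
    simp only [Pi.add_apply, Pi.smul_apply, Pi.sub_apply, Pi.single_apply, hm, smul_eq_mul] at h1
    rw [wA, wA, h1, mul_add, ← mul_assoc, e]
    split_ifs <;> ring
  · have h1 := congrFun (h'.snd_eq hab fun s hs => (h s hs).2.2) (1 + o.step * i)
    simp only [Pi.add_apply, Pi.smul_apply, Pi.sub_apply, Pi.single_apply, add_right_inj, hk,
      smul_eq_mul] at h1
    rw [wB, wB, h1, mul_add, ← mul_assoc, e]
    split_ifs <;> ring

/-- Preferences persist, as weak inequalities, at the ends of a leg. -/
theorem le_of_mem_zone {γ : ℝ → State} (hγ : Continuous γ) {a b : ℝ} (hab : a < b) {m k : Fin 3}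
    (h : ∀ s ∈ Ioo a b, γ s ∈ zone o β m k) {s : ℝ} (hs : s ∈ Icc a b) (i : Fin 3) :
    uA o β i (γ s) ≤ uA o β m (γ s) ∧ uB o β i (γ s) ≤ uB o β k (γ s) := by
  have hc : IsClosed {s | uA o β i (γ s) ≤ uA o β m (γ s) ∧ uB o β i (γ s) ≤ uB o β k (γ s)} :=
    (isClosed_le ((continuous_uA i).comp hγ) ((continuous_uA m).comp hγ)).inter
      (isClosed_le ((continuous_uB i).comp hγ) ((continuous_uB k).comp hγ))
  have h1 : Ioo a b ⊆ {s | uA o β i (γ s) ≤ uA o β m (γ s) ∧ uB o β i (γ s) ≤ uB o β k (γ s)} := by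
    intro s hs
    obtain ⟨-, hA, hB⟩ := h s hs
    have hi := Orient.step_mul_inj (o := o) (i := i) (m := m)
    have hk := Orient.step_mul_inj (o := o) (i := i) (m := k)
    constructor
    · by_cases hm : i = m
      · rw [hm]
      · exact (hA (o.step * i) (by rwa [Ne, hi])).le
    · by_cases hm : i = k
      · rw [hm]
      · exact (hB (1 + o.step * i) (by rwa [Ne, add_right_inj, hk])).le
  have h2 := hc.closure_subset_iff.2 h1
  rw [closure_Ioo hab.ne] at h2
  exact h2 hs

/-- The equations between the exponentials of the switching times, for periodic solutions with the
anticlockwise pattern. -/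
theorem IsAntiShapley.equations {γ : ℝ → State} {T : ℝ} (h : IsAntiShapley β γ T) :
    0 < β ∧ ∃ s κ g₀ g₁ g₂ h₁ h₂ h₃ : ℝ, 1 < κ ∧ Real.exp s = h₁ ∧ h₁ < h₂ ∧ h₂ < h₃ ∧
      h₃ < κ * h₁ ∧
      (β * (κ - 1) * (g₁ - h₁) = (β - 1) * (κ * h₁ - h₃) + (h₃ - h₂) - β * (h₂ - h₁) ∧
      β * (κ - 1) * (g₂ - h₂) = (β - 1) * (κ * h₂ - κ * h₁) + (κ * h₁ - h₃) - β * (h₃ - h₂) ∧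
      β * (κ - 1) * (κ * g₀ - h₃) = (β - 1) * (κ * h₃ - κ * h₂) + (κ * h₂ - κ * h₁) -
        β * (κ * h₁ - h₃)) ∧
      ((κ - 1) * (h₁ - g₀) = (1 + β) * (κ * g₀ - g₂) - β * (g₂ - g₁) - (g₁ - g₀) ∧
      (κ - 1) * (h₂ - g₁) = (1 + β) * (κ * g₁ - κ * g₀) - β * (κ * g₀ - g₂) - (g₂ - g₁) ∧
      (κ - 1) * (h₃ - g₂) = (1 + β) * (κ * g₂ - κ * g₁) - β * (κ * g₁ - κ * g₀) -
        (κ * g₀ - g₂)) ∧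
      ((κ - 1) * (h₁ * wB .acw 1 (γ s)) = h₃ - h₂ ∧
        (κ - 1) * (h₁ * wB .acw 2 (γ s)) = κ * h₁ - h₃) ∧
      ((κ - 1) * (h₁ * wA .acw 1 (γ s)) = g₂ - g₁ ∧
        (κ - 1) * (h₁ * wA .acw 2 (γ s)) = κ * g₀ - g₂) ∧
      uB .acw β 2 (γ s) = uB .acw β 0 (γ s) := by
  obtain ⟨⟨hT, hs, hp⟩, t, ht, htl, hreg⟩ := h
  have hcont : Continuous γ := continuousOn_univ.1 hs.continuousOn
  have l0 : t 0 < t 1 := ht (by decide)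
  have l1 : t 1 < t 2 := ht (by decide)
  have l2 : t 2 < t 3 := ht (by decide)
  have l3 : t 3 < t 4 := ht (by decide)
  have l4 : t 4 < t 5 := ht (by decide)
  have l5 : t 5 < t 6 := ht (by decide)
  have r0 : ∀ s ∈ Ioo (t 0) (t 1), γ s ∈ zone .acw β 0 2 := hreg 0
  have r1 : ∀ s ∈ Ioo (t 1) (t 2), γ s ∈ zone .acw β 0 0 := hreg 1
  have r2 : ∀ s ∈ Ioo (t 2) (t 3), γ s ∈ zone .acw β 1 0 := hreg 2
  have r3 : ∀ s ∈ Ioo (t 3) (t 4), γ s ∈ zone .acw β 1 1 := hreg 3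
  have r4 : ∀ s ∈ Ioo (t 4) (t 5), γ s ∈ zone .acw β 2 1 := hreg 4
  have r5 : ∀ s ∈ Ioo (t 5) (t 6), γ s ∈ zone .acw β 2 2 := hreg 5
  have h6 : t 6 = t 0 + T := htl
  have hγ6 : γ (t 6) = γ (t 0) := by rw [h6, hp]
  have hκ : Real.exp (t 6) = Real.exp T * Real.exp (t 0) := by rw [h6, ← Real.exp_add, add_comm]
  have hκ1 : 1 < Real.exp T := Real.one_lt_exp_iff.2 hT
  have tA2 : uA .acw β 0 (γ (t 2)) = uA .acw β 1 (γ (t 2)) :=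
    le_antisymm (le_of_mem_zone hcont l2 r2 ⟨le_rfl, l2.le⟩ 0).1
      (le_of_mem_zone hcont l1 r1 ⟨l1.le, le_rfl⟩ 1).1
  have tA4 : uA .acw β 1 (γ (t 4)) = uA .acw β 2 (γ (t 4)) :=
    le_antisymm (le_of_mem_zone hcont l4 r4 ⟨le_rfl, l4.le⟩ 1).1
      (le_of_mem_zone hcont l3 r3 ⟨l3.le, le_rfl⟩ 2).1
  have tA0 : uA .acw β 2 (γ (t 0)) = uA .acw β 0 (γ (t 0)) :=
    le_antisymm (le_of_mem_zone hcont l0 r0 ⟨le_rfl, l0.le⟩ 2).1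
      (hγ6 ▸ (le_of_mem_zone hcont l5 r5 ⟨l5.le, le_rfl⟩ 0).1)
  have tB1 : uB .acw β 2 (γ (t 1)) = uB .acw β 0 (γ (t 1)) :=
    le_antisymm (le_of_mem_zone hcont l1 r1 ⟨le_rfl, l1.le⟩ 2).2
      (le_of_mem_zone hcont l0 r0 ⟨l0.le, le_rfl⟩ 0).2
  have tB3 : uB .acw β 0 (γ (t 3)) = uB .acw β 1 (γ (t 3)) :=
    le_antisymm (le_of_mem_zone hcont l3 r3 ⟨le_rfl, l3.le⟩ 0).2
      (le_of_mem_zone hcont l2 r2 ⟨l2.le, le_rfl⟩ 1).2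
  have tB5 : uB .acw β 1 (γ (t 5)) = uB .acw β 2 (γ (t 5)) :=
    le_antisymm (le_of_mem_zone hcont l5 r5 ⟨le_rfl, l5.le⟩ 1).2
      (le_of_mem_zone hcont l4 r4 ⟨l4.le, le_rfl⟩ 2).2
  -- A becomes indifferent to strategy `1` while B plays `0`, which can only happen if `β > 0`
  have hβ : 0 < β := by
    obtain ⟨s, hs1, hs2⟩ := exists_between l1
    have hz := strictA_iff.1 (r1 s ⟨hs1, hs2⟩).2.1
    have hr : ∀ s' ∈ Ioo s (t 2), γ s' ∈ zone .acw β 0 0 := fun s' h => r1 s' ⟨hs1.trans h.1, h.2⟩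
    have b0 := (hs.exp_mul hs2.le hr 0).2
    have b1 := (hs.exp_mul hs2.le hr 1).2
    have b2 := (hs.exp_mul hs2.le hr 2).2
    have hz1 := hz.1
    simp only [uA_eq, Orient.α₁, Orient.α₂] at hz1 tA2
    simp at b0 b1 b2 hz1 tA2
    have he := Real.exp_lt_exp.2 hs2
    have h1 := mul_lt_mul_of_pos_left hz1 (Real.exp_pos s)
    by_contra! hle
    nlinarith [congrArg (fun x => Real.exp (t 2) * x) tA2]
  have A0 := fun i => (hs.exp_mul l0.le r0 i).1
  have A1 := fun i => (hs.exp_mul l1.le r1 i).1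
  have A2 := fun i => (hs.exp_mul l2.le r2 i).1
  have A3 := fun i => (hs.exp_mul l3.le r3 i).1
  have A4 := fun i => (hs.exp_mul l4.le r4 i).1
  have A5 := fun i => (hs.exp_mul l5.le r5 i).1
  have B0 := fun i => (hs.exp_mul l0.le r0 i).2
  have B1 := fun i => (hs.exp_mul l1.le r1 i).2
  have B2 := fun i => (hs.exp_mul l2.le r2 i).2
  have B3 := fun i => (hs.exp_mul l3.le r3 i).2
  have B4 := fun i => (hs.exp_mul l4.le r4 i).2
  have B5 := fun i => (hs.exp_mul l5.le r5 i).2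
  simp only [hγ6, hκ, Fin.forall_fin_succ] at A0 A1 A2 A3 A4 A5 B0 B1 B2 B3 B4 B5
  simp at A0 A1 A2 A3 A4 A5 B0 B1 B2 B3 B4 B5
  simp only [uA_eq, Orient.α₁, Orient.α₂] at tA2 tA4 tA0
  have tB1' := tB1
  simp only [uB_eq, Orient.c₁, Orient.c₂] at tB1 tB3 tB5
  simp at tA2 tA4 tA0 tB1 tB3 tB5
  obtain ⟨A00, A01, A02⟩ := A0
  obtain ⟨A10, A11, A12⟩ := A1
  obtain ⟨A20, A21, A22⟩ := A2
  obtain ⟨A30, A31, A32⟩ := A3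
  obtain ⟨A40, A41, A42⟩ := A4
  obtain ⟨A50, A51, A52⟩ := A5
  obtain ⟨B00, B01, B02⟩ := B0
  obtain ⟨B10, B11, B12⟩ := B1
  obtain ⟨B20, B21, B22⟩ := B2
  obtain ⟨B30, B31, B32⟩ := B3
  obtain ⟨B40, B41, B42⟩ := B4
  obtain ⟨B50, B51, B52⟩ := B5
  set κ := Real.exp T
  -- the coordinates at the time at which B begins to play `0`
  have X0 : (κ - 1) * (Real.exp (t 1) * wB .acw 0 (γ (t 1))) = Real.exp (t 3) - Real.exp (t 1) := by
    linear_combination κ * B00 + B50 + B40 + B30 + B20 + B10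
  have X1 : (κ - 1) * (Real.exp (t 1) * wB .acw 1 (γ (t 1))) = Real.exp (t 5) - Real.exp (t 3) := by
    linear_combination κ * B01 + B51 + B41 + B31 + B21 + B11
  have X2 : (κ - 1) * (Real.exp (t 1) * wB .acw 2 (γ (t 1))) =
      κ * Real.exp (t 1) - Real.exp (t 5) := by
    linear_combination κ * B02 + B52 + B42 + B32 + B22 + B12
  have Z0 : (κ - 1) * (Real.exp (t 1) * wA .acw 0 (γ (t 1))) =
      κ * (Real.exp (t 1) - Real.exp (t 0)) + (Real.exp (t 2) - Real.exp (t 1)) := by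
    linear_combination κ * A00 + A50 + A40 + A30 + A20 + A10
  have Z1 : (κ - 1) * (Real.exp (t 1) * wA .acw 1 (γ (t 1))) = Real.exp (t 4) - Real.exp (t 2) := by
    linear_combination κ * A01 + A51 + A41 + A31 + A21 + A11
  have Z2 : (κ - 1) * (Real.exp (t 1) * wA .acw 2 (γ (t 1))) =
      κ * Real.exp (t 0) - Real.exp (t 4) := by
    linear_combination κ * A02 + A52 + A42 + A32 + A22 + A12
  refine ⟨hβ, t 1, κ, Real.exp (t 0), Real.exp (t 2), Real.exp (t 4), Real.exp (t 1),
    Real.exp (t 3), Real.exp (t 5), hκ1, rfl, Real.exp_lt_exp.2 (l1.trans l2),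
    Real.exp_lt_exp.2 (l3.trans l4), ?_, ⟨?_, ?_, ?_⟩, ⟨?_, ?_, ?_⟩, ⟨X1, X2⟩, ⟨Z1, Z2⟩, tB1'⟩
  · refine (Real.exp_lt_exp.2 l5).trans ?_
    rw [hκ]
    exact mul_lt_mul_of_pos_left (Real.exp_lt_exp.2 l0) (Real.exp_pos T)
  · linear_combination -(κ - 1) * Real.exp (t 2) * tA2 + (β - 1) * X2 + X1 - β * X0 +
      (κ - 1) * ((β - 1) * B12 + B11 - β * B10)
  · linear_combination -(κ - 1) * Real.exp (t 4) * tA4 + (β - 1) * X0 + X2 - β * X1 +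
      (κ - 1) * ((β - 1) * (B10 + B20 + B30) + (B12 + B22 + B32) - β * (B11 + B21 + B31))
  · linear_combination -(κ - 1) * κ * Real.exp (t 0) * tA0 + κ * ((β - 1) * X1 + X0 - β * X2) -
      κ * (κ - 1) * ((β - 1) * B01 + B00 - β * B02)
  · linear_combination -(κ - 1) * Real.exp (t 1) * tB1 + (1 + β) * Z2 - β * Z1 - Z0
  · linear_combination -(κ - 1) * Real.exp (t 3) * tB3 + (1 + β) * Z0 - β * Z2 - Z1 +
      (κ - 1) * ((1 + β) * (A10 + A20) - β * (A12 + A22) - (A11 + A21))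
  · linear_combination -(κ - 1) * Real.exp (t 5) * tB5 + (1 + β) * Z1 - β * Z0 - Z2 +
      (κ - 1) * ((1 + β) * (A11 + A21 + A31 + A41) - β * (A10 + A20 + A30 + A40) -
        (A12 + A22 + A32 + A42))

end ShapleyGame

namespace ShapleyGame

/-! ### Elimination -/

variable {β z : ℝ}

/-- The equations for the switching times, after elimination of the switching times of A: a cubic
recurrence for the time between two switches of B. -/
theorem switching_recurrence {κ g₀ g₁ g₂ h₁ h₂ h₃ : ℝ} (hκ : 1 < κ)
    (A1 : β * (κ - 1) * (g₁ - h₁) = (β - 1) * (κ * h₁ - h₃) + (h₃ - h₂) - β * (h₂ - h₁))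
    (A2 : β * (κ - 1) * (g₂ - h₂) =
      (β - 1) * (κ * h₂ - κ * h₁) + (κ * h₁ - h₃) - β * (h₃ - h₂))
    (A3 : β * (κ - 1) * (κ * g₀ - h₃) = (β - 1) * (κ * h₃ - κ * h₂) + (κ * h₂ - κ * h₁) -
        β * (κ * h₁ - h₃))
    (B1 : (κ - 1) * (h₁ - g₀) = (1 + β) * (κ * g₀ - g₂) - β * (g₂ - g₁) - (g₁ - g₀))
    (B2 : (κ - 1) * (h₂ - g₁) = (1 + β) * (κ * g₁ - κ * g₀) - β * (κ * g₀ - g₂) - (g₂ - g₁))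
    (B3 : (κ - 1) * (h₃ - g₂) = (1 + β) * (κ * g₂ - κ * g₁) - β * (κ * g₁ - κ * g₀) -
        (κ * g₀ - g₂)) {D₁ D₂ D₃ : ℝ} (hD₁ : D₁ = h₂ - h₁) (hD₂ : D₂ = h₃ - h₂)
    (hD₃ : D₃ = κ * h₁ - h₃) :
    -β * D₁ + (1 - 3 * β - β ^ 2) * D₂ + (2 - 2 * β ^ 2) * D₃ + β * (κ * D₁) = 0 ∧
    -β * D₂ + (1 - 3 * β - β ^ 2) * D₃ + (2 - 2 * β ^ 2) * (κ * D₁) + β * (κ * D₂) = 0 ∧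
    -β * D₃ + (1 - 3 * β - β ^ 2) * (κ * D₁) + (2 - 2 * β ^ 2) * (κ * D₂) + β * (κ * D₃) = 0 := by
  set r₁ := -β * D₁ + (1 - 3 * β - β ^ 2) * D₂ + (2 - 2 * β ^ 2) * D₃ + β * (κ * D₁) with hr₁
  set r₂ := -β * D₂ + (1 - 3 * β - β ^ 2) * D₃ + (2 - 2 * β ^ 2) * (κ * D₁) + β * (κ * D₂) with hr₂
  set r₃ := -β * D₃ + (1 - 3 * β - β ^ 2) * (κ * D₁) + (2 - 2 * β ^ 2) * (κ * D₂) +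
    β * (κ * D₃) with hr₃
  have q1 : κ * (r₃ - 2 * r₂ + r₁) = 0 := by
    rw [hr₁, hr₂, hr₃, hD₁, hD₂, hD₃]
    linear_combination κ * β * (κ - 1) * B1 + (2 + β) * κ * A3 - (1 + 2 * β) * κ * A2 -
      (1 - β) * κ * A1
  have q2 : κ * r₁ - 2 * r₃ + r₂ = 0 := by
    rw [hr₁, hr₂, hr₃, hD₁, hD₂, hD₃]
    linear_combination β * (κ - 1) * B2 + (2 + β) * κ * A1 - (1 - β) * A2 - (1 + 2 * β) * A3
  have q3 : κ * r₂ - 2 * (κ * r₁) + r₃ = 0 := by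
    rw [hr₁, hr₂, hr₃, hD₁, hD₂, hD₃]
    linear_combination β * (κ - 1) * B3 + (2 + β) * κ * A2 - (1 + 2 * β) * κ * A1 - (1 - β) * A3
  have q1' := (mul_eq_zero.1 q1).resolve_left (by linarith)
  have hκ' : (κ - 1) ^ 2 ≠ 0 := pow_ne_zero 2 (by linarith)
  have h1 : r₁ = 0 := by
    refine (mul_eq_zero.1 ?_).resolve_left hκ'
    linear_combination (κ + 2) * q2 + 3 * q3 + (2 * κ + 1) * q1'
  have h2 : r₂ = 0 := by
    rw [h1] at q1' q2
    linarith
  exact ⟨h1, h2, by rw [h1, h2] at q1'; linarith⟩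

/-- Below the golden mean, the recurrence has no positive solution. -/
theorem not_isAntiShapley (h : β ∈ Ioo (-1) σ) {γ : ℝ → State} {T : ℝ} :
    ¬ IsAntiShapley β γ T := by
  intro hγ
  obtain ⟨h0, s, κ, g₀, g₁, g₂, h₁, h₂, h₃, hκ, -, l1, l2, l3, ⟨A1, A2, A3⟩, ⟨B1, B2, B3⟩, -⟩ :=
    hγ.equations
  obtain ⟨r1, r2, r3⟩ := switching_recurrence hκ A1 A2 A3 B1 B2 B3 rfl rfl rfl
  have d1 : 0 < h₂ - h₁ := by linarith
  have d2 : 0 < h₃ - h₂ := by linarith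
  have d3 : 0 < κ * h₁ - h₃ := by linarith
  generalize h₂ - h₁ = D₁ at *
  generalize h₃ - h₂ = D₂ at *
  generalize κ * h₁ - h₃ = D₃ at *
  have hσ := σ_lt
  have hsq := σ_sq
  have hβ1 : β < 1 := by linarith [h.2]
  have hβ2 : β ^ 2 + β < 1 := by nlinarith [h.2]
  have k1 : 0 < β * ((κ - 1) * (D₁ + D₂ + D₃)) :=
    mul_pos h0 (mul_pos (by linarith) (by linarith))
  have k2 : 0 < (κ - 1) * D₂ := mul_pos (by linarith) d2
  have k3 : 0 < κ * D₁ := mul_pos (by linarith) d1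
  have k4 : 0 < (1 - β ^ 2 - β) * (D₂ + D₃ + κ * D₁) := mul_pos (by linarith) (by linarith)
  have k5 : 0 < (2 - 2 * β ^ 2) * ((κ - 1) * D₂) := mul_pos (by nlinarith) k2
  linarith

/-- Above the golden mean, the recurrence has a single eigenvalue that is compatible with
periodicity and positivity. -/
theorem ratio_of_recurrence (h0 : 0 < β) (hz : z ∈ Ioo (0 : ℝ) 1)
    (hr : acwCubic β z = 0) {κ D₁ D₂ D₃ : ℝ} (hκ : 1 < κ) (hD : 0 < D₁)
    (r1 : -β * D₁ + (1 - 3 * β - β ^ 2) * D₂ + (2 - 2 * β ^ 2) * D₃ + β * (κ * D₁) = 0)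
    (r2 : -β * D₂ + (1 - 3 * β - β ^ 2) * D₃ + (2 - 2 * β ^ 2) * (κ * D₁) + β * (κ * D₂) = 0)
    (r3 : -β * D₃ + (1 - 3 * β - β ^ 2) * (κ * D₁) + (2 - 2 * β ^ 2) * (κ * D₂) +
      β * (κ * D₃) = 0) :
    D₁ = z * D₂ ∧ D₂ = z * D₃ ∧ D₃ = z * (κ * D₁) ∧ κ * z ^ 3 = 1 := by
  obtain ⟨z0, z1⟩ := hz
  rw [acwCubic] at hr
  -- the other two roots of the cubic are those of `E² + p E + z`
  obtain ⟨p, hp⟩ : ∃ p, p = (2 * z ^ 2 + 6 * z + 1) / (z + 2) := ⟨_, rfl⟩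
  have hp0 : 0 < p := by rw [hp]; positivity
  have hp' : p * (z + 2) = 2 * z ^ 2 + 6 * z + 1 := by
    rw [hp, div_mul_cancel₀ _ (by positivity)]
  have hp2 : 0 < p ^ 2 - 3 * z := by
    have h2 : 0 < (z + 2) ^ 2 := by positivity
    refine (mul_pos_iff_of_pos_right h2).1 ?_
    have : (p ^ 2 - 3 * z) * (z + 2) ^ 2 =
        4 * z ^ 4 + 21 * z ^ 3 + 28 * z ^ 2 + 1 := by
      linear_combination (p * (z + 2) + (2 * z ^ 2 + 6 * z + 1)) * hp'
    rw [this]; positivity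
  have c2 : 2 - 2 * β ^ 2 = β * (p - 1 / z) := by
    have e : β * (p - 1 / z) * (z * (z + 2)) = β * p * z * (z + 2) - β * (z + 2) := by field_simp
    refine mul_right_cancel₀ (b := z * (z + 2)) (by positivity) ?_
    rw [e]
    linear_combination -2 * hr - β * z * hp'
  have c1 : 1 - 3 * β - β ^ 2 = β * (z - p / z) := by
    have h5 : (2 - 2 * β ^ 2) * z = β * p * z - β := by rw [c2]; field_simp
    have e : β * (z - p / z) * z ^ 2 = β * (z ^ 3 - p * z) := by field_simp
    refine mul_right_cancel₀ (b := z ^ 2) (by positivity) ?_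
    rw [e]
    linear_combination -hr - h5
  have hz' := z0.ne'
  -- the part of the solution that belongs to these roots vanishes
  set w₁ := D₂ - D₁ / z with hw₁
  set w₂ := D₃ - D₂ / z with hw₂
  set w₃ := κ * D₁ - D₃ / z with hw₃
  have s1 : w₃ + p * w₂ + z * w₁ = 0 := by
    refine mul_left_cancel₀ h0.ne' ?_
    rw [c1, c2] at r1
    rw [hw₁, hw₂, hw₃, mul_zero, ← r1]; field_simp; ring
  have s2 : κ * w₁ + p * w₃ + z * w₂ = 0 := by
    refine mul_left_cancel₀ h0.ne' ?_
    rw [c1, c2] at r2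
    rw [hw₁, hw₂, hw₃, mul_zero, ← r2]; field_simp; ring
  have s3 : κ * w₂ + p * (κ * w₁) + z * w₃ = 0 := by
    refine mul_left_cancel₀ h0.ne' ?_
    rw [c1, c2] at r3
    rw [hw₁, hw₂, hw₃, mul_zero, ← r3]; field_simp; ring
  -- the determinant of the three equations, a circulant up to the factors `κ`
  have hdet : 0 < κ ^ 2 + (p ^ 3 - 3 * p * z) * κ + z ^ 3 := by
    have : p ^ 3 - 3 * p * z = p * (p ^ 2 - 3 * z) := by ring
    rw [this]; positivity
  have hw1 : w₁ = 0 := by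
    refine (mul_eq_zero.1 ?_).resolve_left hdet.ne'
    linear_combination (κ - p * z) * (s2 - p * s1) + (p ^ 2 - z) * (s3 - z * s1)
  have hw2 : w₂ = 0 := by
    have h3 : (p ^ 2 - z) * w₂ = 0 := by
      rw [hw1] at s1 s2; linear_combination p * s1 - s2
    exact (mul_eq_zero.1 h3).resolve_left (by linarith)
  have hw3 : w₃ = 0 := by
    rw [hw1, hw2] at s1; linarith
  have e1 : D₁ = z * D₂ := by
    have : z * w₁ = 0 := by rw [hw1, mul_zero]
    rw [hw₁] at this; field_simp at this; linarith
  have e2 : D₂ = z * D₃ := by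
    have : z * w₂ = 0 := by rw [hw2, mul_zero]
    rw [hw₂] at this; field_simp at this; linarith
  have e3 : D₃ = z * (κ * D₁) := by
    have : z * w₃ = 0 := by rw [hw3, mul_zero]
    rw [hw₃] at this; field_simp at this; linarith
  refine ⟨e1, e2, e3, mul_right_cancel₀ hD.ne' ?_⟩
  nth_rewrite 2 [e1]
  rw [e2, e3]; ring

end ShapleyGame

namespace ShapleyGame

/-! ### Uniqueness of solutions and of the anticlockwise orbit -/

variable {o : Orient} {β z : ℝ}

/-- On the interval `[0, T]`, the only solution with initial state `p 0` is `p`. -/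
structure IsUniqueSolution (β T : ℝ) (p : ℝ → State) : Prop where
  nonneg : 0 ≤ T
  isSolutionOn : IsSolutionOn β (Icc 0 T) p
  eqOn : ∀ q, IsSolutionOn β (Icc 0 T) q → q 0 = p 0 → EqOn q p (Icc 0 T)

namespace IsUniqueSolution

theorem congr {T : ℝ} {p q : ℝ → State} (h : IsUniqueSolution β T p) (hq : EqOn q p (Icc 0 T)) :
    IsUniqueSolution β T q :=
  ⟨h.nonneg, h.isSolutionOn.congr_Icc hq, fun r hr h0 =>
    (h.eqOn r hr (h0.trans (hq ⟨le_rfl, h.nonneg⟩))).trans hq.symm⟩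

/-- Uniqueness on consecutive intervals. -/
theorem glue {T S : ℝ} {p : ℝ → State} (hp : IsUniqueSolution β T p)
    (hq : IsUniqueSolution β S (fun t => p (t + T))) : IsUniqueSolution β (T + S) p := by
  have h0 := hp.nonneg
  have h1 := hq.nonneg
  refine ⟨add_nonneg h0 h1, ?_, fun r hr hr0 t ht => ?_⟩
  · refine hp.isSolutionOn.union_Icc ?_
    have := hq.isSolutionOn.comp_add (J := Icc T (T + S)) (-T) measurableSet_Icc measurableSet_Icc
      fun t ht => ⟨by linarith [ht.1], by linarith [ht.2]⟩
    simpa using this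
  · have e1 := hp.eqOn r (hr.mono (Icc_subset_Icc le_rfl (by linarith))) hr0
    rcases le_total t T with htT | htT
    · exact e1 ⟨ht.1, htT⟩
    · have e2 := hq.eqOn (fun t => r (t + T)) (hr.comp_add T measurableSet_Icc measurableSet_Icc
        fun t ht => ⟨by linarith [ht.1], by linarith [ht.2]⟩)
        (by simpa using e1 ⟨h0, le_rfl⟩)
      have := e2 ⟨sub_nonneg.2 htT, by linarith [ht.2]⟩
      simpa using this

/-- Concatenation of unique solutions. -/
theorem append {T S : ℝ} {p q : ℝ → State} (hp : IsUniqueSolution β T p)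
    (hq : IsUniqueSolution β S q) (h : p T = q 0) :
    IsUniqueSolution β (T + S) (fun t => if t ≤ T then p t else q (t - T)) := by
  refine glue (hp.congr fun t ht => if_pos ht.2) (hq.congr fun t ht => ?_)
  rcases ht.1.eq_or_lt with rfl | ht0
  · simpa using h
  · simp [ht0]

theorem turn {T : ℝ} {p : ℝ → State} (h : IsUniqueSolution β T p) :
    IsUniqueSolution β T (fun t => turn o (p t)) := by
  refine ⟨h.nonneg, h.isSolutionOn.turn, fun q hq h0 t ht => ?_⟩
  have := h.eqOn _ (hq.turn (o := o)).turn (by rw [h0, turn_turn_turn]) ht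
  rw [← turn_turn_turn (o := o) (q t), ← this]

end IsUniqueSolution

/-- The motion along one leg. -/
theorem isUniqueSolution_go {δ : ℝ} {x : State} {m k : Fin 3} (hδ : 0 ≤ δ) (hm : x ∈ phaseSpace)
    (hx : StrictA β (o.step * m) x ∨ StrictB β (1 + o.step * k) x)
    (hreg : ∀ ε ∈ Ioo 0 δ, go o m k x ε ∈ zone o β m k) :
    IsUniqueSolution β (Real.log (1 + δ)) (fun t => go o m k x (Real.exp t - 1)) := by
  refine ⟨Real.log_nonneg (by linarith), isSolutionOn_toward hδ hm hreg, fun q hq h0 t ht => ?_⟩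
  simp only [Real.exp_zero, sub_self, go_zero] at h0
  exact IsSolutionOn.eq_toward hδ hx hreg hq h0 t ht

namespace IsRatio

theorem isUniqueSolution_third (h : IsRatio o β z) :
    IsUniqueSolution β (-Real.log z) (orbit o β z) := by
  have hg := h.one_lt_gain
  have e1 : IsUniqueSolution β (Real.log (gain o β z)) (orbit o β z) := by
    have hx : StrictA β (o.step * 0) (base o β z) := by
      rw [strictA_iff]; exact ⟨h.uA_one_lt, h.uA_two_lt⟩
    have h1 := isUniqueSolution_go (m := 0) (k := 0) (δ := gain o β z - 1) (by linarith)
      h.base_mem (Or.inl hx) h.zone_first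
    rw [add_sub_cancel] at h1
    exact h1.congr fun t ht => h.orbit_eq_first ht.1 ht.2
  have e2 : IsUniqueSolution β (-Real.log z - Real.log (gain o β z))
      (fun t => orbit o β z (t + Real.log (gain o β z))) := by
    have hx : StrictB β (1 + o.step * 0) (mid o β z) := by
      rw [strictB_iff]; exact h.uB_mid
    have h1 := isUniqueSolution_go (m := 1) (k := 0) h.wait_second_pos.le
      h.mid_mem (Or.inr hx) h.zone_second
    rw [add_sub_cancel, h.log_second] at h1
    refine h1.congr fun t ht => ?_
    rw [h.orbit_eq_second (by linarith [ht.1]) (by linarith [ht.2]), add_sub_cancel_right]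
  have := e1.glue e2
  rwa [add_sub_cancel] at this

/-- The orbit is the only solution from the base point, on arbitrarily long intervals. -/
theorem isUniqueSolution_nat (h : IsRatio o β z) (n : ℕ) :
    IsUniqueSolution β (n * -Real.log z) (orbit o β z) := by
  have step (n : ℕ) : IsUniqueSolution β (-Real.log z)
      (fun t => orbit o β z (t + n * -Real.log z)) := by
    induction n with
    | zero => simpa using h.isUniqueSolution_third
    | succ n ih =>
      refine (ih.turn (o := o).turn (o := o)).congr fun t _ => ?_
      simp only
      rw [← h.turn_orbit (t + n * -Real.log z), turn_turn_turn]
      congr 1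
      push_cast
      ring
  induction n with
  | zero =>
    have := h.isUniqueSolution_third
    refine ⟨by simp, this.isSolutionOn.mono (Icc_subset_Icc le_rfl (by simpa using this.nonneg)),
      fun q _ h0 t ht => ?_⟩
    have : t = 0 := le_antisymm (by simpa using ht.2) ht.1
    rw [this, h0]
  | succ n ih =>
    have := ih.glue (step n)
    convert this using 1
    push_cast
    ring

/-- The orbit of a periodic solution through the base point. -/
theorem range_eq_of_apply_eq_base (h : IsRatio o β z) {γ : ℝ → State} {T s : ℝ}
    (hγ : IsPeriodicSolution β γ T) (hs : γ s = base o β z) : range γ = range (orbit o β z) := by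
  have hl := h.log_neg
  have key (t : ℝ) (ht : 0 ≤ t) : γ (t + s) = orbit o β z t := by
    obtain ⟨n, hn⟩ := exists_nat_ge (t / -Real.log z)
    refine (h.isUniqueSolution_nat n).eqOn (fun t => γ (t + s)) ?_ ?_
      ⟨ht, (div_le_iff₀ (by linarith)).1 hn⟩
    · exact hγ.2.1.comp_add s MeasurableSet.univ measurableSet_Icc fun _ _ => mem_univ _
    · simp only [zero_add]
      rw [hs, h.orbit_zero]
  apply Subset.antisymm
  · rintro _ ⟨u, rfl⟩
    obtain ⟨n, hn⟩ := exists_nat_ge ((s - u) / T)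
    have hn' := (div_le_iff₀ hγ.1).1 hn
    have hp : γ (u + n * T) = γ u := Function.Periodic.nat_mul hγ.2.2 n u
    refine ⟨u + n * T - s, ?_⟩
    rw [← key _ (by linarith), sub_add_cancel, hp]
  · rintro _ ⟨u, rfl⟩
    obtain ⟨n, hn⟩ := exists_nat_ge (-u / (-3 * Real.log z))
    have hn' := (div_le_iff₀ (by linarith)).1 hn
    have hp : orbit o β z (u + n * (-3 * Real.log z)) = orbit o β z u :=
      Function.Periodic.nat_mul h.orbit_periodic n u
    rw [← hp, ← key _ (by linarith)]
    exact mem_range_self _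

end IsRatio

/-- There is a single orbit with the anticlockwise pattern. -/
theorem IsAntiShapley.range_eq {γ : ℝ → State} {T : ℝ} (hγ : IsAntiShapley β γ T) (h1 : β < 1)
    (hz : z ∈ Ioo (0 : ℝ) 1) (hr : acwCubic β z = 0) : range γ = range (orbit .acw β z) := by
  obtain ⟨h0, s, κ, g₀, g₁, g₂, h₁, h₂, h₃, hκ, hs, l1, l2, l3, ⟨A1, A2, A3⟩, ⟨B1, B2, B3⟩,
    ⟨X1, X2⟩, ⟨Z1, Z2⟩, tie⟩ := hγ.equations
  have h := isRatio_acw h0 h1 hz hr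
  obtain ⟨r1, r2, r3⟩ := switching_recurrence hκ A1 A2 A3 B1 B2 B3 rfl rfl rfl
  obtain ⟨e1, e2, e3, e4⟩ := ratio_of_recurrence h0 hz hr hκ (by linarith) r1 r2 r3
  obtain ⟨z0, z1⟩ := hz
  refine h.range_eq_of_apply_eq_base hγ.1 (s := s) ?_
  have hmem := hγ.1.2.1.1 s (mem_univ _)
  have hq := h.quad_pos
  have hβκ : β * (κ - 1) ≠ 0 := mul_ne_zero h0.ne' (by linarith)
  have hh : h₁ ≠ 0 := by rw [← hs]; exact (Real.exp_pos s).ne'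
  have hκh : (κ - 1) * h₁ ≠ 0 := mul_ne_zero (by linarith) hh
  -- the time between two switches grows by the factor `1 / z`, for both players
  have y1 : g₁ - h₁ = z * (g₂ - h₂) := mul_left_cancel₀ hβκ (by
    linear_combination A1 - z * A2 + (β - 1) * e3 + e2 - β * e1)
  have y2 : g₂ - h₂ = z * (κ * g₀ - h₃) := mul_left_cancel₀ hβκ (by
    linear_combination A2 - z * A3 + (β - 1) * κ * e1 + e3 - β * e2)
  have f1 : g₂ - g₁ = z * (κ * g₀ - g₂) := by linear_combination y2 - y1 + e1
  have hA : wA .acw 1 (γ s) = z * wA .acw 2 (γ s) := mul_left_cancel₀ hκh (by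
    linear_combination Z1 - z * Z2 + f1)
  have hB : wB .acw 1 (γ s) = z * wB .acw 2 (γ s) := mul_left_cancel₀ hκh (by
    linear_combination X1 - z * X2 + e2)
  have hB2 : wB .acw 2 (γ s) = 1 / (1 + z + z ^ 2) := by
    rw [eq_div_iff hq.ne']
    refine mul_left_cancel₀ hκh ?_
    linear_combination (1 + z + z ^ 2) * X2 - e1 - (1 + z) * e2
  have hA2 : wA .acw 2 (γ s) = frac .acw β z := by
    obtain ⟨-, -, hsum, -⟩ := (mem_phaseSpace_iff (o := .acw)).1 hmem
    rw [frac, eq_div_iff h.den_pos.ne']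
    rw [hA] at hsum
    simp only [uB_eq, denA, Orient.c₁, Orient.c₂, show (2 : Fin 3) + 1 = 0 from rfl,
      show (2 : Fin 3) + 2 = 1 from rfl, zero_add] at tie ⊢
    rw [hA] at tie
    linear_combination hsum + tie
  rw [eq_pt (o := .acw) hmem, base, hA, hB, hA2, hB2, mul_one_div]

end ShapleyGame

namespace ShapleyGame

/-! ### The derivative of the return map -/

variable {o : Orient} {β z : ℝ}

/-- A linear endomorphism of a real vector space of dimension at most three that has three
different real eigenvalues has no other complex eigenvalues. -/
theorem aeval_charpoly_eq_zero_iff {V : Type*} [AddCommGroup V] [Module ℝ V] [FiniteDimensional ℝ V]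
    (hV : Module.finrank ℝ V ≤ 3) {f : Module.End ℝ V} {a b c : ℝ} (hab : a ≠ b) (hac : a ≠ c)
    (hbc : b ≠ c) (ha : f.HasEigenvalue a) (hb : f.HasEigenvalue b) (hc : f.HasEigenvalue c)
    (x : ℂ) : Polynomial.aeval x (LinearMap.charpoly f) = 0 ↔ x = a ∨ x = b ∨ x = c := by
  have hr {a : ℝ} (ha : f.HasEigenvalue a) :
      Polynomial.aeval (a : ℂ) (LinearMap.charpoly f) = 0 := by
    have h1 := (Module.End.hasEigenvalue_iff_isRoot_charpoly f a).1 ha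
    have h2 := Polynomial.aeval_algebraMap_apply_eq_algebraMap_eval (A := ℂ) a
      (LinearMap.charpoly f)
    rw [Polynomial.IsRoot.def.1 h1] at h2
    simpa using h2
  constructor
  · intro hx
    by_contra! hne
    have hd : ((LinearMap.charpoly f).map (algebraMap ℝ ℂ)).natDegree ≤ 3 := by
      rw [(LinearMap.charpoly_monic f).natDegree_map, (LinearMap.charpoly_natDegree f)]
      exact hV
    have h0 : (LinearMap.charpoly f).map (algebraMap ℝ ℂ) ≠ 0 :=
      ((LinearMap.charpoly_monic f).map _).ne_zero
    have hmem {y : ℂ} (hy : Polynomial.aeval y (LinearMap.charpoly f) = 0) :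
        y ∈ ((LinearMap.charpoly f).map (algebraMap ℝ ℂ)).roots := by
      rw [Polynomial.mem_roots h0, Polynomial.IsRoot.def, Polynomial.eval_map_algebraMap]
      exact hy
    have hsub : ({x, (a : ℂ), (b : ℂ), (c : ℂ)} : Finset ℂ).val ⊆
        ((LinearMap.charpoly f).map (algebraMap ℝ ℂ)).roots := by
      intro y hy
      simp only [Finset.mem_val, Finset.mem_insert, Finset.mem_singleton] at hy
      rcases hy with rfl | rfl | rfl | rfl
      exacts [hmem hx, hmem (hr ha), hmem (hr hb), hmem (hr hc)]
    have hcard := Polynomial.card_le_degree_of_subset_roots hsub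
    rw [Finset.card_insert_of_notMem, Finset.card_insert_of_notMem, Finset.card_insert_of_notMem,
      Finset.card_singleton] at hcard
    · omega
    all_goals simp [hne.1, hne.2.1, hne.2.2, hab, hac, hbc]
  · rintro (rfl | rfl | rfl)
    exacts [hr ha, hr hb, hr hc]

variable (o) in
/-- The map `coords`, as a continuous linear map. -/
noncomputable def coordsL : State →L[ℝ] ℝ × ℝ × ℝ × ℝ :=
  LinearMap.toContinuousLinearMap
    { toFun := coords o
      map_add' := fun _ _ => rfl
      map_smul' := fun _ _ => rfl }

variable (o β) in
/-- The map `height`, as a continuous linear map. -/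
noncomputable def heightL : (ℝ × ℝ × ℝ × ℝ) →L[ℝ] ℝ :=
  LinearMap.toContinuousLinearMap
    { toFun := height o β
      map_add' := fun v w => by
        simp only [height, Prod.fst_add, Prod.snd_add]
        ring
      map_smul' := height_smul }

theorem heightL_apply (v : ℝ × ℝ × ℝ × ℝ) : heightL o β v = height o β v := rfl

theorem nextV_add (v w : ℝ × ℝ × ℝ × ℝ) :
    nextV o β (v + w) = nextV o β v + nextV o β w := by
  simp only [nextV, nextU, nextH, nextY, nextG, Prod.fst_add, Prod.snd_add, Prod.mk_add_mk]
  ext <;> simp <;> ring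

theorem scaled_add (v w : ℝ × ℝ × ℝ × ℝ) (n : ℕ) :
    scaled o β z (v + w) n = scaled o β z v n + scaled o β z w n := by
  induction n with
  | zero => rfl
  | succ n ih => rw [scaled_succ, scaled_succ, scaled_succ, ih, nextV_add, smul_add]

theorem scaled_smul (c : ℝ) (v : ℝ × ℝ × ℝ × ℝ) (n : ℕ) :
    scaled o β z (c • v) n = c • scaled o β z v n := by
  induction n with
  | zero => rfl
  | succ n ih => rw [scaled_succ, scaled_succ, ih, nextV_smul, smul_comm]

variable (o β z) in
/-- The third iterate of the linear map `z • nextV`. -/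
noncomputable def scaledL : (ℝ × ℝ × ℝ × ℝ) →L[ℝ] ℝ × ℝ × ℝ × ℝ :=
  LinearMap.toContinuousLinearMap
    { toFun := fun v => scaled o β z v 3
      map_add' := fun v w => scaled_add v w 3
      map_smul' := fun c v => scaled_smul c v 3 }

variable (o) in
/-- The linear part of the affine map `pt`. -/
noncomputable def ptL : (ℝ × ℝ × ℝ × ℝ) →L[ℝ] State :=
  LinearMap.toContinuousLinearMap
    { toFun := fun v => pt o v.1 v.2.1 v.2.2.1 v.2.2.2 - pt o 0 0 0 0
      map_add' := fun v w => by
        refine state_ext (o := o) (fun m => ?_) (fun m => ?_)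
        · change wA o m (pt o _ _ _ _) - wA o m (pt o _ _ _ _) =
            (wA o m (pt o _ _ _ _) - wA o m (pt o _ _ _ _)) +
              (wA o m (pt o _ _ _ _) - wA o m (pt o _ _ _ _))
          simp only [wA_pt]
          fin_cases m <;> simp; ring
        · change wB o m (pt o _ _ _ _) - wB o m (pt o _ _ _ _) =
            (wB o m (pt o _ _ _ _) - wB o m (pt o _ _ _ _)) +
              (wB o m (pt o _ _ _ _) - wB o m (pt o _ _ _ _))
          simp only [wB_pt]
          fin_cases m <;> simp; ring
      map_smul' := fun c v => by
        refine state_ext (o := o) (fun m => ?_) (fun m => ?_)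
        · change wA o m (pt o _ _ _ _) - wA o m (pt o _ _ _ _) =
            c * (wA o m (pt o _ _ _ _) - wA o m (pt o _ _ _ _))
          simp only [wA_pt]
          fin_cases m <;> simp; ring
        · change wB o m (pt o _ _ _ _) - wB o m (pt o _ _ _ _) =
            c * (wB o m (pt o _ _ _ _) - wB o m (pt o _ _ _ _))
          simp only [wB_pt]
          fin_cases m <;> simp; ring }

theorem ptL_apply (v : ℝ × ℝ × ℝ × ℝ) :
    ptL o v = pt o v.1 v.2.1 v.2.2.1 v.2.2.2 - pt o 0 0 0 0 := rfl

theorem wA_ptL (m : Fin 3) (v : ℝ × ℝ × ℝ × ℝ) :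
    wA o m (ptL o v) = ![-v.2.2.1 - v.2.2.2, v.2.2.2, v.2.2.1] m := by
  change wA o m (pt o _ _ _ _) - wA o m (pt o _ _ _ _) = _
  rw [wA_pt, wA_pt]
  fin_cases m <;> simp; ring

theorem wB_ptL (m : Fin 3) (v : ℝ × ℝ × ℝ × ℝ) :
    wB o m (ptL o v) = ![-v.1 - v.2.1, v.2.1, v.1] m := by
  change wB o m (pt o _ _ _ _) - wB o m (pt o _ _ _ _) = _
  rw [wB_pt, wB_pt]
  fin_cases m <;> simp; ring

theorem coords_ptL (v : ℝ × ℝ × ℝ × ℝ) : coords o (ptL o v) = v := by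
  simp [coords, wA_ptL, wB_ptL]

variable (o β) in
/-- The linear form whose level sets are used as sections. Along the first leg of the orbit, it is
the reciprocal of the homogenising coordinate. -/
noncomputable def level : State →L[ℝ] ℝ := (heightL o β).comp (coordsL o)

theorem level_apply (x : State) : level o β x = height o β (coords o x) := rfl

theorem sum_eq (x : State) : ∑ i, x.1 i = wA o 0 x + wA o 1 x + wA o 2 x ∧
    ∑ i, x.2 i = wB o 0 x + wB o 1 x + wB o 2 x := by
  constructor <;> cases o <;> simp [wA, wB, Orient.step, Fin.sum_univ_three] <;> ring

theorem mem_sectionDirections_iff {v : State} : v ∈ sectionDirections (level o β) ↔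
    wA o 0 v + wA o 1 v + wA o 2 v = 0 ∧ wB o 0 v + wB o 1 v + wB o 2 v = 0 ∧
      height o β (coords o v) = 0 := by
  have : v ∈ sectionDirections (level o β) ↔
    ∑ i, v.1 i = 0 ∧ ∑ i, v.2 i = 0 ∧ level o β v = 0 := Iff.rfl
  rw [this, (sum_eq (o := o) v).1, (sum_eq (o := o) v).2, level_apply]

theorem ptL_mem {v : ℝ × ℝ × ℝ × ℝ} (hv : height o β v = 0) :
    ptL o v ∈ sectionDirections (level o β) := by
  refine mem_sectionDirections_iff.2 ⟨?_, ?_, by rwa [coords_ptL]⟩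
  · simp [wA_ptL]
  · simp [wB_ptL]

theorem finrank_sectionDirections_le (hc : o.c₁ β < 1) (hc' : o.c₂ β < 1) :
    Module.finrank ℝ (sectionDirections (level o β)) ≤ 3 := by
  let g : State →ₗ[ℝ] ℝ × ℝ × ℝ :=
    { toFun := fun v => (wB o 2 v, wB o 1 v, wA o 1 v)
      map_add' := fun _ _ => rfl
      map_smul' := fun _ _ => rfl }
  have hg : Function.Injective (g.domRestrict (sectionDirections (level o β))) := by
    rw [← LinearMap.ker_eq_bot, LinearMap.ker_eq_bot']
    rintro ⟨v, hv⟩ h0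
    obtain ⟨h1, h2, h3⟩ := mem_sectionDirections_iff.1 hv
    have h4 : (wB o 2 v, wB o 1 v, wA o 1 v) = (0, 0, 0) := h0
    simp only [Prod.mk.injEq] at h4
    obtain ⟨k1, k2, k3⟩ := h4
    have k4 : wA o 2 v = 0 := by
      have hb : 1 - o.c₁ β ≠ 0 := by linarith
      have hn : 2 - o.c₁ β - o.c₂ β ≠ 0 := by linarith
      rw [height, div_eq_zero_iff, or_iff_left hb] at h3
      simp only [coords, k3, mul_zero, add_zero] at h3
      exact (mul_eq_zero.1 h3).resolve_left hn
    refine Subtype.ext (state_ext (o := o) (fun m => ?_) (fun m => ?_))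
    · change wA o m v = 0
      fin_cases m
      · change wA o 0 v = 0; linarith
      · exact k3
      · exact k4
    · change wB o m v = 0
      fin_cases m
      · change wB o 0 v = 0; linarith
      · exact k2
      · exact k1
  have := LinearMap.finrank_le_finrank_of_injective hg
  simpa using this

variable (o β z) in
/-- Eigenvectors of `z • nextV`. -/
noncomputable def eigV (l : ℝ) : ℝ × ℝ × ℝ × ℝ :=
  (l * (o.α₁ β * (l ^ 2 + l * z + z ^ 2)), z * (o.α₁ β * (l ^ 2 + l * z + z ^ 2)),
    l * (z * ((2 * o.α₁ β - o.α₂ β) * l + (o.α₁ β + o.α₂ β) * z)),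
    z * (z * ((2 * o.α₁ β - o.α₂ β) * l + (o.α₁ β + o.α₂ β) * z)))

namespace IsRatio

/-- The characteristic equation of `z • nextV` factors: the eigenvalues are `1`, `z`, and the roots
of `X ^ 2 - slope * X + z ^ 3`. -/
theorem quartic (h : IsRatio o β z) (l : ℝ) :
    (1 - o.c₁ β) * o.α₁ β * (l ^ 2 + l * z + z ^ 2) ^ 2 =
      z * l * ((2 - o.c₁ β - o.c₂ β) * l + (1 - 2 * o.c₁ β + o.c₂ β) * z) *
        ((2 * o.α₁ β - o.α₂ β) * l + (o.α₁ β + o.α₂ β) * z) +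
      (1 - o.c₁ β) * o.α₁ β * ((l - 1) * (l - z) * (l ^ 2 - slope o β z * l + z ^ 3)) := by
  linear_combination l * (l - 1) * (l - z) * h.slope_mul - l ^ 2 * (l - z) * h.cubic_eq

theorem nextV_eigV (h : IsRatio o β z) {l : ℝ}
    (hl : (l - z) * (l ^ 2 - slope o β z * l + z ^ 3) = 0) :
    z • nextV o β (eigV o β z l) = l • eigV o β z l := by
  have hq := h.quartic l
  rw [mul_assoc (l - 1), hl, mul_zero, mul_zero, add_zero] at hq
  have hB : 1 - o.c₁ β ≠ 0 := by linarith [h.c₁_lt]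
  have hα := h.α₁_pos.ne'
  have hz := h.pos.ne'
  simp only [nextV, eigV, nextU, nextH, nextY, nextG, Prod.smul_mk, smul_eq_mul]
  refine Prod.ext ?_ (Prod.ext ?_ (Prod.ext ?_ ?_))
  · simp only
    field_simp
    linear_combination -hq
  · simp only
    ring
  · simp only
    field_simp
    ring
  · simp only
    ring

theorem scaled_eigV (h : IsRatio o β z) {l : ℝ}
    (hl : (l - z) * (l ^ 2 - slope o β z * l + z ^ 3) = 0) (n : ℕ) :
    scaled o β z (eigV o β z l) n = l ^ n • eigV o β z l := by
  induction n with
  | zero => rw [pow_zero, one_smul]; rfl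
  | succ n ih => rw [scaled_succ, ih, nextV_smul, smul_comm, h.nextV_eigV hl, smul_smul, pow_succ]

variable (o β z) in
/-- The derivative of the return map. -/
noncomputable def returnDeriv : State →L[ℝ] State :=
  (ptL o).comp ((ContinuousLinearMap.id ℝ _ - (heightL o β).smulRight (baseV o β z)).comp
    ((scaledL o β z).comp (coordsL o)))

theorem returnDeriv_apply (v : State) : returnDeriv o β z v =
    ptL o (scaled o β z (coords o v) 3 -
      height o β (scaled o β z (coords o v) 3) • baseV o β z) := rfl

theorem returnDeriv_mem (h : IsRatio o β z) (v : State) :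
    returnDeriv o β z v ∈ sectionDirections (level o β) := by
  rw [returnDeriv_apply]
  refine ptL_mem ?_
  rw [← heightL_apply, map_sub, map_smul, heightL_apply (baseV o β z), h.height_baseV,
    smul_eq_mul, mul_one, heightL_apply, sub_self]

/-- The derivative of the return map has the cubes of the eigenvalues of `z • nextV` as
eigenvalues: the eigenvector is the projection of `eigV` along `baseV` to the directions of the
section. -/
theorem hasEigenvalue (h : IsRatio o β z) {l : ℝ} (h1 : l ^ 3 ≠ 1)
    (hl : (l - z) * (l ^ 2 - slope o β z * l + z ^ 3) = 0) :
    Module.End.HasEigenvalue ((returnDeriv o β z).toLinearMap.restrict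
      (p := sectionDirections (level o β)) (q := sectionDirections (level o β))
      fun v _ => h.returnDeriv_mem v) (l ^ 3) := by
  set e := eigV o β z l with he
  set w := e - height o β e • baseV o β z with hw
  have hs : scaled o β z w 3 = l ^ 3 • e - height o β e • baseV o β z := by
    rw [hw, sub_eq_add_neg, ← neg_smul, scaled_add, scaled_smul, h.scaled_baseV, h.scaled_eigV hl,
      neg_smul, ← sub_eq_add_neg]
  have hh : height o β w = 0 := by
    rw [hw, ← heightL_apply, map_sub, map_smul, heightL_apply (baseV o β z), h.height_baseV,
      smul_eq_mul, mul_one, heightL_apply, sub_self]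
  have hw0 : w ≠ 0 := by
    intro h0
    have h2 : (l ^ 3 - 1) • e = 0 := by
      have h3 : scaled o β z w 3 = 0 := by
        rw [h0]
        exact map_zero (scaledL o β z)
      rw [h3, ← sub_eq_zero.1 (hw.symm.trans h0)] at hs
      rw [sub_smul, one_smul, ← hs]
    have h4 : e.2.1 = 0 := by
      rw [(smul_eq_zero.1 h2).resolve_left (sub_ne_zero.2 h1)]; rfl
    have hz := h.pos
    have h5 : 0 < e.2.1 := by
      refine mul_pos hz (mul_pos h.α₁_pos ?_)
      nlinarith [sq_nonneg (l + z / 2), mul_pos hz hz]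
    exact h5.ne' h4
  refine Module.End.hasEigenvalue_of_hasEigenvector (x := ⟨ptL o w, ptL_mem hh⟩)
    (Module.End.hasEigenvector_iff.2 ⟨Module.End.mem_eigenspace_iff.2 (Subtype.ext ?_),
      fun h0 => ?_⟩)
  · change returnDeriv o β z (ptL o w) = l ^ 3 • ptL o w
    rw [returnDeriv_apply, coords_ptL, hs, ← map_smul]
    congr 1
    have : height o β (l ^ 3 • e - height o β e • baseV o β z) =
        l ^ 3 * height o β e - height o β e := by
      rw [← heightL_apply, map_sub, map_smul, map_smul, heightL_apply (baseV o β z),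
        h.height_baseV, smul_eq_mul, smul_eq_mul, mul_one, heightL_apply]
    rw [this, hw]
    module
  · have h2 : ptL o w = 0 := congrArg Subtype.val h0
    have h3 := coords_ptL (o := o) w
    rw [h2] at h3
    exact hw0 h3.symm

/-- If the value of the quadratic factor at `-1` is negative, then one of its roots is smaller than
`-1`, and the cubes of the roots are the eigenvalues of the return map. -/
theorem eigenvalues (h : IsRatio o β z) (hS : 1 + z ^ 3 + slope o β z < 0) :
    let f := (returnDeriv o β z).toLinearMap.restrict
      (p := sectionDirections (level o β)) (q := sectionDirections (level o β))
      fun v _ => h.returnDeriv_mem v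
    (∀ x : ℂ, Polynomial.aeval x (LinearMap.charpoly f) = 0 → ‖x‖ ≠ 1) ∧
      (∃ x : ℂ, Polynomial.aeval x (LinearMap.charpoly f) = 0 ∧ 1 < ‖x‖) ∧
      (∃ x : ℂ, Polynomial.aeval x (LinearMap.charpoly f) = 0 ∧ ‖x‖ < 1) := by
  intro f
  have hz := h.pos
  have hz1 := h.lt_one
  have hz3 : 0 < z ^ 3 := by positivity
  have hz31 : z ^ 3 < 1 := pow_lt_one₀ hz.le hz1 (by norm_num)
  set S := slope o β z with hSdef
  have hD : 0 < S ^ 2 - 4 * z ^ 3 := by nlinarith [sq_nonneg (1 - z ^ 3)]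
  set r := Real.sqrt (S ^ 2 - 4 * z ^ 3) with hr
  have hr0 : 0 < r := Real.sqrt_pos.2 hD
  have hr2 : r ^ 2 = S ^ 2 - 4 * z ^ 3 := Real.sq_sqrt hD.le
  set a := (S - r) / 2 with ha
  set b := (S + r) / 2 with hb
  have hsum : a + b = S := by rw [ha, hb]; ring
  have hprod : a * b = z ^ 3 := by rw [ha, hb]; linear_combination -hr2 / 4
  have hlt : a < b := by rw [ha, hb]; linarith
  have hval : (a + 1) * (b + 1) < 0 := by nlinarith
  have ha1 : a < -1 := by
    by_contra! hc
    exact absurd hval (not_lt.2 (mul_nonneg (by linarith) (by linarith)))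
  have hb1 : -1 < b := by
    by_contra! hc
    exact absurd hval (not_lt.2 (mul_nonneg_of_nonpos_of_nonpos (by linarith) (by linarith)))
  have hb0 : b < 0 := by
    by_contra! hc
    nlinarith [mul_nonneg hc (by linarith : (0 : ℝ) ≤ -a)]
  have ha3 : a ^ 3 < -1 := by nlinarith [mul_pos (by linarith : 0 < -a) (by linarith : 0 < -a)]
  have hb3 : b ^ 3 < 0 := by nlinarith [mul_pos (neg_pos.2 hb0) (neg_pos.2 hb0)]
  have hb31 : -1 < b ^ 3 := by nlinarith [mul_pos (neg_pos.2 hb0) (neg_pos.2 hb0)]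
  have key := aeval_charpoly_eq_zero_iff
    (finrank_sectionDirections_le h.c₁_lt h.c₂_lt) (f := f) (a := a ^ 3) (b := b ^ 3) (c := z ^ 3)
    (by linarith) (by linarith) (by linarith)
    (h.hasEigenvalue (by linarith) (mul_eq_zero_of_right _ (by
      rw [← hSdef]; linear_combination a * hsum - hprod)))
    (h.hasEigenvalue (by linarith) (mul_eq_zero_of_right _ (by
      rw [← hSdef]; linear_combination b * hsum - hprod)))
    (h.hasEigenvalue (by linarith) (by rw [sub_self, zero_mul]))
  have na : ‖((a ^ 3 : ℝ) : ℂ)‖ = -a ^ 3 := by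
    rw [Complex.norm_real, Real.norm_of_nonpos (by linarith)]
  have nb : ‖((b ^ 3 : ℝ) : ℂ)‖ = -b ^ 3 := by
    rw [Complex.norm_real, Real.norm_of_nonpos (by linarith)]
  have nz : ‖((z ^ 3 : ℝ) : ℂ)‖ = z ^ 3 := by
    rw [Complex.norm_real, Real.norm_of_nonneg (by linarith)]
  refine ⟨fun x hx => ?_, ⟨_, (key _).2 (Or.inl rfl), by rw [na]; linarith⟩,
    ⟨_, (key _).2 (Or.inr (Or.inr rfl)), by rw [nz]; linarith⟩⟩
  rcases (key x).1 hx with rfl | rfl | rfl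
  · rw [na]; linarith
  · rw [nb]; linarith
  · rw [nz]; linarith

end IsRatio

end ShapleyGame

namespace ShapleyGame

/-! ### The section and the return map -/

variable {o : Orient} {β z : ℝ}

variable (o β) in
/-- The open set of states in which strategy `m` is the only best response of both players, in the
numbering of the strategies that belongs to the orientation. -/
def own (m : Fin 3) : Set State := {x | StrictA β (o.step * m) x ∧ StrictB β (1 + o.step * m) x}

theorem isOpen_own (m : Fin 3) : IsOpen (own o β m) :=
  (isOpen_strictA β _).inter (isOpen_strictB β _)

theorem mem_own_iff {m : Fin 3} {x : State} : x ∈ own o β m ↔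
    (uA o β (m + 1) x < uA o β m x ∧ uA o β (m + 2) x < uA o β m x) ∧
      uB o β (m + 1) x < uB o β m x ∧ uB o β (m + 2) x < uB o β m x := by
  rw [← strictA_iff, ← strictB_iff]; rfl

theorem turn_mem_own_iff {m : Fin 3} {x : State} :
    turn o x ∈ own o β m ↔ x ∈ own o β (m + 1) := by
  rw [mem_own_iff, mem_own_iff]
  simp only [uA_turn, uB_turn, add_right_comm _ _ (1 : Fin 3)]

theorem notMem_own_of_mem_zone_zero {x : State} (hx : x ∈ zone o β 0 0) {m : Fin 3} (hm : m ≠ 0) :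
    x ∉ own o β m := by
  intro h
  have h1 := (strictA_iff.1 hx.2.1)
  rw [mem_own_iff] at h
  fin_cases m
  · exact hm rfl
  · exact lt_asymm h1.1 h.1.2
  · exact lt_asymm h1.2 h.1.1

theorem notMem_own_of_mem_zone_one {x : State} (hx : x ∈ zone o β 1 0) (m : Fin 3) :
    x ∉ own o β m := by
  intro h
  have h1 := (strictA_iff.1 hx.2.1)
  have h2 := (strictB_iff.1 hx.2.2)
  rw [mem_own_iff] at h
  fin_cases m
  · exact lt_asymm h1.2 h.1.1
  · exact lt_asymm h2.1 h.2.2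
  · exact lt_asymm h2.2 h.2.1

/-- A state at which A is indifferent and B prefers `0` belongs to none of the sets `own`. -/
theorem notMem_own_of_tie {x : State} (hA : uA o β 0 x = uA o β 1 x)
    (hB : uB o β 2 x < uB o β 0 x) (m : Fin 3) :
    x ∉ own o β m := by
  intro h
  rw [mem_own_iff] at h
  fin_cases m
  · exact h.1.1.ne hA.symm
  · exact h.1.2.ne hA
  · exact lt_asymm hB h.2.1

variable (β) in
/-- There is a single solution from `x` on `[0, T]`; it arrives at `y` at time `T`, and avoids `D`
in between. -/
def Flows (D : Set State) (T : ℝ) (x y : State) : Prop :=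
  ∃ p, IsUniqueSolution β T p ∧ p 0 = x ∧ p T = y ∧ ∀ s ∈ Ioo 0 T, p s ∉ D

namespace Flows

variable {D : Set State} {T S : ℝ} {x y w : State}

theorem nonneg (h : Flows β D T x y) : 0 ≤ T := h.choose_spec.1.nonneg

theorem mem (h : Flows β D T x y) : y ∈ phaseSpace := by
  obtain ⟨p, hp, -, rfl, -⟩ := h
  exact hp.isSolutionOn.1 T ⟨hp.nonneg, le_rfl⟩

theorem trans (h : Flows β D T x y) (h' : Flows β D S y w) (hy : y ∉ D) :
    Flows β D (T + S) x w := by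
  obtain ⟨p, hp, p0, pT, pD⟩ := h
  obtain ⟨q, hq, q0, qS, qD⟩ := h'
  refine ⟨_, hp.append hq (pT.trans q0.symm), ?_, ?_, fun s hs => ?_⟩
  · simp only [if_pos hp.nonneg, p0]
  · rcases hq.nonneg.eq_or_lt with hS | hS
    · simp only [← hS, add_zero, le_refl, if_true]
      rw [pT, ← q0, ← qS, hS]
    · simp only [add_le_iff_nonpos_right, not_le.2 hS, if_false, add_sub_cancel_left, qS]
  · split_ifs with hsT
    · rcases hsT.eq_or_lt with rfl | hsT
      · rwa [pT]
      · exact pD s ⟨hs.1, hsT⟩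
    · exact qD _ ⟨by linarith, by linarith [hs.2]⟩

theorem turn (h : Flows β (turn o ⁻¹' D) T x y) : Flows β D T (turn o x) (turn o y) := by
  obtain ⟨p, hp, p0, pT, pD⟩ := h
  exact ⟨_, hp.turn (o := o), by simp only [p0], by simp only [pT], pD⟩

theorem turn_own {m : Fin 3} (h : Flows β (own o β (m + 1)) T x y) :
    Flows β (own o β m) T (ShapleyGame.turn o x) (ShapleyGame.turn o y) := by
  refine Flows.turn ?_
  have : ShapleyGame.turn o ⁻¹' own o β m = own o β (m + 1) :=
    Set.ext fun x => turn_mem_own_iff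
  rwa [this]

theorem mono {D' : Set State} (h : Flows β D T x y) (hD : D' ⊆ D) : Flows β D' T x y := by
  obtain ⟨p, hp, p0, pT, pD⟩ := h
  exact ⟨p, hp, p0, pT, fun s hs hD' => pD s hs (hD hD')⟩

end Flows

theorem flows_go {D : Set State} {δ : ℝ} {x : State} {m k : Fin 3} (hδ : 0 ≤ δ)
    (hm : x ∈ phaseSpace) (hx : StrictA β (o.step * m) x ∨ StrictB β (1 + o.step * k) x)
    (hreg : ∀ ε ∈ Ioo 0 δ, go o m k x ε ∈ zone o β m k) (hD : ∀ ε ∈ Ioo 0 δ, go o m k x ε ∉ D) :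
    Flows β D (Real.log (1 + δ)) x (go o m k x δ) := by
  refine ⟨_, isUniqueSolution_go hδ hm hx hreg, by simp [go_zero], ?_, fun s hs => hD _ ?_⟩
  · rw [Real.exp_log (by linarith), add_sub_cancel_left]
  · have := (Real.lt_log_iff_exp_lt (by linarith)).1 hs.2
    exact ⟨by simpa using hs.1, by linarith⟩

theorem coords_go (x : State) (δ : ℝ) : coords o (go o 0 0 x δ) = (1 + δ)⁻¹ • coords o x := by
  simp [coords, wA_go, wB_go, div_eq_inv_mul]

theorem level_go (x : State) (δ : ℝ) : level o β (go o 0 0 x δ) = (1 + δ)⁻¹ * level o β x := by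
  rw [level_apply, coords_go, height_smul, level_apply]

theorem go_point {v : ℝ × ℝ × ℝ × ℝ} (hv : height o β v ≠ 0) {δ : ℝ} (hδ : 0 ≤ δ) :
    go o 0 0 (point o β v) δ = pt o 0 0 0 0 + ptL o (((1 + δ)⁻¹ / height o β v) • v) := by
  have h1 : 1 + δ ≠ 0 := by positivity
  rw [ptL_apply, add_sub_cancel, point]
  refine state_ext (o := o) (fun m => ?_) (fun m => ?_)
  · rw [wA_go, wA_pt, wA_pt]
    fin_cases m <;> simp <;> field_simp; ring
  · rw [wB_go, wB_pt, wB_pt]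
    fin_cases m <;> simp <;> field_simp; ring

theorem waitA_go (hα : 0 < o.α₁ β) (x : State) {δ : ℝ} (hδ : 0 ≤ δ) :
    waitA o β (go o 0 0 x δ) = (waitA o β x - δ) / (1 + δ) := by
  obtain ⟨e0, e1, -⟩ := uA_go_zero (o := o) (β := β) 0 x δ
  have h3 : 1 + δ ≠ 0 := by positivity
  have h2 := hα.ne'
  rw [waitA, e0, e1, waitA]
  field_simp
  ring

/-- The first leg ends in the same state, wherever on the leg one starts. -/
theorem go_waitA_go (hα : 0 < o.α₁ β) {x : State} {δ : ℝ} (hδ : 0 ≤ δ) (hx : 0 ≤ waitA o β x) :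
    go o 0 0 (go o 0 0 x δ) (waitA o β (go o 0 0 x δ)) = go o 0 0 x (waitA o β x) := by
  rw [waitA_go hα x hδ, go_go _ _ _ hδ hx]

theorem sectionMap_go (hα : 0 < o.α₁ β) {x : State} {δ : ℝ} (hδ : 0 ≤ δ) (hx : 0 ≤ waitA o β x) :
    sectionMap o β (go o 0 0 x δ) = sectionMap o β x := by
  rw [sectionMap, go_waitA_go hα hδ hx, sectionMap]

namespace IsRatio

variable (o β z) in
/-- The time of motion, in the scale in which legs are traversed with unit speed, from the base
point to the section of the return map: half of the first leg. -/
noncomputable def lag : ℝ := (gain o β z - 1) / 2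

variable (o β z) in
/-- The middle of the first leg. -/
noncomputable def crossPt : State := go o 0 0 (base o β z) (lag o β z)

variable (o β z) in
/-- The return map of the level set of `level` through `crossPt`. -/
noncomputable def returnMap (x : State) : State :=
  pt o 0 0 0 0 + ptL o (((1 + lag o β z)⁻¹ / height o β (scaled o β z (coords o x) 3)) •
    scaled o β z (coords o x) 3)

theorem lag_pos (h : IsRatio o β z) : 0 < lag o β z := by
  rw [lag]; linarith [h.one_lt_gain]

theorem lag_lt (h : IsRatio o β z) : lag o β z < gain o β z - 1 := by
  rw [lag]; linarith [h.one_lt_gain]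

theorem coords_crossPt : coords o (crossPt o β z) = (1 + lag o β z)⁻¹ • baseV o β z := by
  rw [crossPt, coords_go, coords_base]

theorem level_crossPt (h : IsRatio o β z) : level o β (crossPt o β z) = (1 + lag o β z)⁻¹ := by
  rw [level_apply, coords_crossPt, height_smul, h.height_baseV, mul_one]

theorem crossPt_mem_zone (h : IsRatio o β z) : crossPt o β z ∈ zone o β 0 0 :=
  h.zone_first _ ⟨h.lag_pos, h.lag_lt⟩

theorem crossPt_mem_segment (h : IsRatio o β z) :
    crossPt o β z ∈ segment ℝ (base o β z) (mid o β z) := by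
  rw [mid, go, ← image_toward_Icc _ _ _ (by linarith [h.one_lt_gain])]
  exact ⟨_, ⟨h.lag_pos.le, h.lag_lt.le⟩, rfl⟩

theorem returnMap_crossPt (h : IsRatio o β z) :
    returnMap o β z (crossPt o β z) = crossPt o β z := by
  have h1 : 0 < 1 + lag o β z := by linarith [h.lag_pos]
  have h2 := go_point (o := o) (β := β) (v := baseV o β z) (by rw [h.height_baseV]; simp)
    h.lag_pos.le
  rw [returnMap, coords_crossPt, scaled_smul, h.scaled_baseV, height_smul, h.height_baseV,
    mul_one, div_self (inv_pos.2 h1).ne', one_smul]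
  rw [h.point_baseV, h.height_baseV, div_one] at h2
  exact h2.symm

/-- The return map is a central projection of a linear map, hence its derivative at the fixed point
is that linear map followed by the linear projection along `baseV`. -/
theorem hasFDerivAt_returnMap (h : IsRatio o β z) :
    HasFDerivAt (returnMap o β z) (returnDeriv o β z) (crossPt o β z) := by
  have h1 : 0 < 1 + lag o β z := by linarith [h.lag_pos]
  set c := (1 + lag o β z)⁻¹ with hc
  have hc0 : c ≠ 0 := (inv_pos.2 h1).ne'
  have hS : HasFDerivAt (fun x => scaled o β z (coords o x) 3)
      ((scaledL o β z).comp (coordsL o)) (crossPt o β z) :=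
    ((scaledL o β z).comp (coordsL o)).hasFDerivAt
  have hS0 : scaled o β z (coords o (crossPt o β z)) 3 = c • baseV o β z := by
    rw [coords_crossPt, scaled_smul, h.scaled_baseV]
  have hh : HasFDerivAt (fun x => height o β (scaled o β z (coords o x) 3))
      ((heightL o β).comp ((scaledL o β z).comp (coordsL o))) (crossPt o β z) :=
    ((heightL o β).comp ((scaledL o β z).comp (coordsL o))).hasFDerivAt
  have hh0 : height o β (scaled o β z (coords o (crossPt o β z)) 3) = c := by
    rw [hS0, height_smul, h.height_baseV, mul_one]
  have hd := ((hasDerivAt_inv (by rw [hh0]; exact hc0)).comp_hasFDerivAt _ hh).const_mul c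
  have hP := ((ptL o).hasFDerivAt.comp _ (hd.smul hS)).const_add (pt o 0 0 0 0)
  refine HasFDerivAt.congr_fderiv (f := returnMap o β z) hP ?_
  refine ContinuousLinearMap.ext fun v => ?_
  change ptL o ((c * (height o β (scaled o β z (coords o (crossPt o β z)) 3))⁻¹) •
      scaled o β z (coords o v) 3 +
    (c * (-(height o β (scaled o β z (coords o (crossPt o β z)) 3) ^ 2)⁻¹ *
      height o β (scaled o β z (coords o v) 3))) •
      scaled o β z (coords o (crossPt o β z)) 3) = _
  rw [returnDeriv_apply, hh0, hS0, mul_inv_cancel₀ hc0, one_smul, smul_smul, sub_eq_add_neg,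
    ← neg_smul]
  congr 3
  field_simp

end IsRatio

end ShapleyGame

namespace ShapleyGame

/-! ### The orbit of saddle type -/

variable {o : Orient} {β z : ℝ}

namespace IsRatio

/-- Motion from a point near the first leg to the end of the second leg. -/
theorem eventually_flows (h : IsRatio o β z) {y : State}
    (hy : y ∈ segment ℝ (base o β z) (mid o β z)) :
    ∀ᶠ x in 𝓝 y, x ∈ phaseSpace → uB o β 2 x ≤ uB o β 0 x → uA o β 1 x ≤ uA o β 0 x →
      0 ≤ waitA o β x ∧ 0 ≤ waitB o β (go o 0 0 x (waitA o β x)) ∧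
      (StrictA β (o.step * 0) x ∨ StrictB β (1 + o.step * 0) x) ∧
      (∀ ε ∈ Ioo 0 (waitA o β x), go o 0 0 x ε ∈ zone o β 0 0) ∧
      ∀ D : Set State, (∀ y ∈ D, ∃ m, y ∈ own o β m) →
        (∀ ε ∈ Ioo 0 (waitA o β x), go o 0 0 x ε ∉ D) →
        ∃ T, Flows β D T x (turn o (turn o (sectionMap o β x))) := by
  have hm := left_mem_segment ℝ (mid o β z) (endPt o β z)
  have e1 := (continuous_uB 1).continuousAt.eventually_lt (continuous_uB 0).continuousAt h.uB_mid.1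
  have e2 := (continuous_uB 2).continuousAt.eventually_lt (continuous_uB 0).continuousAt h.uB_mid.2
  filter_upwards [h.eventually_first hy one_pos, (h.tendsto_go_first hy).eventually
    (e1.and (e2.and (h.eventually_second hm one_pos)))] with x h1 h2 hp hB hA
  obtain ⟨b1, b2, h2⟩ := h2
  obtain ⟨w1, -, s1, z1⟩ := h1 hp hB hA
  have tie := uA_go_waitA h.α₁_pos 0 x
  obtain ⟨w2, -, s2, z2⟩ := h2 (go_mem hp w1) tie.le b1.le
  refine ⟨w1, w2, s1, z1, fun D hD hx => ?_⟩
  rw [sectionMap, turn_turn_turn]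
  refine ⟨_, (flows_go w1 hp s1 z1 hx).trans
    (flows_go w2 (go_mem hp w1) s2 z2 fun ε hε hεD => ?_) ?_⟩
  · obtain ⟨m, hm⟩ := hD _ hεD
    exact notMem_own_of_mem_zone_one (z2 ε hε) m hm
  · intro hxD
    obtain ⟨m, hm⟩ := hD _ hxD
    exact notMem_own_of_tie tie b2 m hm

theorem tendsto_sectionMap (h : IsRatio o β z) {y : State}
    (hy : y ∈ segment ℝ (base o β z) (mid o β z)) :
    Tendsto (sectionMap o β) (𝓝 y) (𝓝 (base o β z)) := by
  have h1 := (h.tendsto_go_second (left_mem_segment ℝ _ _)).comp (h.tendsto_go_first hy)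
  have h2 := (continuous_turn (o := o)).continuousAt.tendsto.comp h1
  rwa [h.turn_end] at h2

/-- The three thirds of a revolution that starts on the section of the return map. -/
theorem eventually_revolution (h : IsRatio o β z) :
    ∀ᶠ x in 𝓝 (crossPt o β z), x ∈ phaseSpace → level o β x = (1 + lag o β z)⁻¹ →
      ∃ T > 0, Flows β (own o β 0 ∩ {x | level o β x = (1 + lag o β z)⁻¹}) T x
        (returnMap o β z x) ∧ returnMap o β z x ∈ own o β 0 ∧
        level o β (returnMap o β z x) = (1 + lag o β z)⁻¹ := by
  have hl := h.lag_pos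
  have hc : 0 < (1 + lag o β z)⁻¹ := inv_pos.2 (by linarith)
  have hb := left_mem_segment ℝ (base o β z) (mid o β z)
  have hx := h.crossPt_mem_segment
  have zA := strictA_iff.1 h.crossPt_mem_zone.2.1
  have zB := strictB_iff.1 h.crossPt_mem_zone.2.2
  have t1 := h.tendsto_sectionMap hx
  have t2 := (h.tendsto_sectionMap hb).comp t1
  have t3 := (h.tendsto_sectionMap hb).comp t2
  -- a third of the revolution, from points of the section of the base point
  have ez : ∀ᶠ x in 𝓝 (base o β z), x ∈ phaseSpace → uB o β 2 x = uB o β 0 x →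
      0 ≤ waitA o β x ∧ 0 ≤ waitB o β (go o 0 0 x (waitA o β x)) ∧
      (StrictA β (o.step * 0) x ∨ StrictB β (1 + o.step * 0) x) ∧ lag o β z < waitA o β x ∧
      (∀ ε ∈ Ioo 0 (waitA o β x), go o 0 0 x ε ∈ zone o β 0 0) ∧
      (∀ k ≠ 0, ∃ T, Flows β (own o β k) T x (turn o (turn o (sectionMap o β x)))) ∧
      ∀ k, x ∉ own o β k := by
    have e3 : ∀ᶠ x in 𝓝 (base o β z), lag o β z < waitA o β x := by
      refine continuous_waitA.continuousAt.eventually (lt_mem_nhds ?_)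
      rw [h.waitA_base]
      exact h.lag_lt
    filter_upwards [(continuous_uA 1).continuousAt.eventually_lt (continuous_uA 0).continuousAt
      h.uA_one_lt, (continuous_uB 1).continuousAt.eventually_lt (continuous_uB 0).continuousAt
      h.uB_one_lt, e3, h.eventually_flows hb] with x a1 b1 w hx hp tie
    obtain ⟨wA, wB, s, z, f⟩ := hx hp tie.le a1.le
    refine ⟨wA, wB, s, w, z, fun k hk => f _ (fun y hy => ⟨k, hy⟩) fun ε hε =>
      notMem_own_of_mem_zone_zero (z ε hε) hk, fun k hk => ?_⟩
    rw [mem_own_iff] at hk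
    fin_cases k
    · exact hk.2.2.ne tie
    · exact lt_asymm b1 hk.2.2
    · exact hk.2.1.ne tie.symm
  have eh (n : ℕ) : ∀ᶠ x in 𝓝 (crossPt o β z), 0 < height o β (scaled o β z (coords o x) n) := by
    refine (continuous_height.comp ((continuous_scaled n).comp
      continuous_coords)).continuousAt.eventually (lt_mem_nhds ?_)
    simp only [Function.comp, coords_crossPt, scaled_smul, h.scaled_baseV, height_smul,
      h.height_baseV, mul_one]
    exact hc
  filter_upwards [(continuous_uA 1).continuousAt.eventually_lt (continuous_uA 0).continuousAt zA.1,
    (continuous_uB 2).continuousAt.eventually_lt (continuous_uB 0).continuousAt zB.2,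
    h.eventually_flows hx, t1.eventually ez, t2.eventually ez, t3.eventually ez, eh 1, eh 2, eh 3]
    with x a0 b0 f0 k1 k2 k3 H1 H2 H3 hp hlev
  simp only [Function.comp] at k2 k3
  set c := (1 + lag o β z)⁻¹ with hcdef
  set x₁ := sectionMap o β x with hx₁
  set x₂ := sectionMap o β x₁ with hx₂
  set x₃ := sectionMap o β x₂ with hx₃
  have tie₁ : uB o β 2 x₁ = uB o β 0 x₁ := h.uB_sectionMap x
  have tie₂ : uB o β 2 x₂ = uB o β 0 x₂ := h.uB_sectionMap x₁
  have tie₃ : uB o β 2 x₃ = uB o β 0 x₃ := h.uB_sectionMap x₂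
  -- the legs of the motion
  obtain ⟨wA0, wB0, -, -, f0⟩ := f0 hp b0.le a0.le
  obtain ⟨T₀, F0⟩ := f0 (own o β 0 ∩ {x | level o β x = c}) (fun y hy => ⟨0, hy.1⟩)
    fun ε hε hεD => by
      have h1 : level o β (go o 0 0 x ε) = c := hεD.2
      rw [level_go, hlev, mul_eq_right₀ hc.ne', inv_eq_one] at h1
      linarith [hε.1]
  have m1 : x₁ ∈ phaseSpace := turn_mem_iff.1 (turn_mem_iff.1 F0.mem)
  obtain ⟨wA1, wB1, -, -, -, f1, n1⟩ := k1 m1 tie₁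
  obtain ⟨T₁, F1⟩ := f1 2 (by decide)
  have m2 : x₂ ∈ phaseSpace := turn_mem_iff.1 (turn_mem_iff.1 F1.mem)
  obtain ⟨wA2, wB2, -, -, -, f2, n2⟩ := k2 m2 tie₂
  obtain ⟨T₂, F2⟩ := f2 1 (by decide)
  have m3 : x₃ ∈ phaseSpace := turn_mem_iff.1 (turn_mem_iff.1 F2.mem)
  obtain ⟨wA3, -, s3, l3, z3, -, n3⟩ := k3 m3 tie₃
  have lev3 : level o β x₃ = 1 := height_coords h.c₁_lt m3 tie₃
  have F3 : Flows β (own o β 0 ∩ {x | level o β x = c}) (Real.log (1 + lag o β z)) x₃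
      (go o 0 0 x₃ (lag o β z)) := by
    refine flows_go hl.le m3 s3 (fun ε hε => z3 ε ⟨hε.1, hε.2.trans l3⟩) fun ε hε hεD => ?_
    have h1 : level o β (go o 0 0 x₃ ε) = c := hεD.2
    rw [level_go, lev3, mul_one, hcdef, inv_inj] at h1
    linarith [hε.2]
  have F1' : Flows β (own o β 0) T₁ (turn o (turn o x₁)) (turn o x₂) := by
    have := (Flows.turn_own (m := 0) (Flows.turn_own (m := 1) F1))
    rwa [turn_turn_turn] at this
  have F2' : Flows β (own o β 0) T₂ (turn o x₂) x₃ := by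
    have := Flows.turn_own (m := 0) F2
    rwa [turn_turn_turn] at this
  have F := ((F0.trans (F1'.mono inter_subset_left) fun hD => n1 2
    (turn_mem_own_iff.1 (turn_mem_own_iff.1 hD.1))).trans (F2'.mono inter_subset_left)
    fun hD => n2 1 (turn_mem_own_iff.1 hD.1)).trans F3 fun hD => n3 0 hD.1
  -- the final state
  have e0 : height o β (coords o x) = c := hlev
  have q0 : go o 0 0 (point o β (coords o x)) (lag o β z) = x := by
    rw [go_point (by rw [e0]; exact hc.ne') hl.le, e0, div_self hc.ne', one_smul, ptL_apply,
      add_sub_cancel]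
    exact (eq_pt hp).symm
  have w0 := waitA_go h.α₁_pos (point o β (coords o x)) hl.le
  rw [q0, eq_div_iff (by linarith)] at w0
  have w0' : 0 ≤ waitA o β (point o β (coords o x)) := by
    linarith [mul_nonneg wA0 (by linarith : 0 ≤ 1 + lag o β z)]
  have g0 := go_waitA_go h.α₁_pos hl.le w0'
  rw [q0] at g0
  have p1 : x₁ = point o β (scaled o β z (coords o x) 1) := by
    have := sectionMap_go h.α₁_pos hl.le w0'
    rw [q0, sectionMap_point h.α₁_pos h.c₁_lt (by rw [e0]; exact hc) w0' (by rwa [← g0])] at this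
    rw [hx₁, this, scaled_succ, point_smul h.pos.ne']
    rfl
  have p2 : x₂ = point o β (scaled o β z (coords o x) 2) := by
    rw [p1] at wA1 wB1
    rw [hx₂, p1, sectionMap_point h.α₁_pos h.c₁_lt H1 wA1 wB1, scaled_succ _ 1,
      point_smul h.pos.ne']
  have p3 : x₃ = point o β (scaled o β z (coords o x) 3) := by
    rw [p2] at wA2 wB2
    rw [hx₃, p2, sectionMap_point h.α₁_pos h.c₁_lt H2 wA2 wB2, scaled_succ _ 2,
      point_smul h.pos.ne']
  have hP : returnMap o β z x = go o 0 0 x₃ (lag o β z) := by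
    rw [p3, go_point H3.ne' hl.le]
    rfl
  rw [hP]
  have hlog : 0 < Real.log (1 + lag o β z) := Real.log_pos (by linarith)
  refine ⟨_, ?_, F, ?_, ?_⟩
  · linarith [F0.nonneg, F1.nonneg, F2.nonneg]
  · exact (z3 _ ⟨hl, l3⟩).2
  · rw [level_go, lev3, mul_one]

theorem utilities_first (h : IsRatio o β z) {y : State}
    (hy : y ∈ segment ℝ (base o β z) (mid o β z)) :
    uA o β 1 y ≤ uA o β 0 y ∧ uA o β 2 y < uA o β 0 y := by
  obtain ⟨δ, hδ, rfl⟩ := h.exists_eq_go_first hy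
  have hp : 0 < 1 + δ := by linarith [hδ.1]
  have hw := h.waitA_first hδ.1
  have hw0 : 0 ≤ (gain o β z - 1 - δ) / (1 + δ) := div_nonneg (by linarith [hδ.2]) hp.le
  obtain ⟨a0, -, a2⟩ := uA_go_zero (o := o) (β := β) 0 (base o β z) δ
  constructor
  · rw [← hw, waitA] at hw0
    rw [le_div_iff₀ h.α₁_pos, zero_mul] at hw0
    exact sub_nonneg.1 hw0
  · rw [a2, a0]
    exact div_lt_div_of_pos_right
      (by linarith [h.uA_two_lt', mul_le_mul_of_nonneg_left hδ.2 h.α₂_nonneg]) hp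

theorem utilities_second (h : IsRatio o β z) {y : State}
    (hy : y ∈ segment ℝ (mid o β z) (endPt o β z)) :
    uA o β 0 y ≤ uA o β 1 y ∧ uA o β 2 y < uA o β 1 y ∧ uB o β 1 y ≤ uB o β 0 y := by
  obtain ⟨δ, hδ, rfl⟩ := h.exists_eq_go_second hy
  have hp : 0 < 1 + δ := by linarith [hδ.1]
  set w := 1 / z / gain o β z - 1 with hwdef
  have hw := h.waitB_second hδ.1
  rw [← hwdef] at hw
  have hw0 : 0 ≤ (w - δ) / (1 + δ) := div_nonneg (by linarith [hδ.2]) hp.le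
  have hq : 0 < 1 + w := by linarith [h.wait_second_pos]
  obtain ⟨a0, a1, a2⟩ := uA_go_zero (o := o) (β := β) 1 (mid o β z) δ
  refine ⟨?_, ?_, ?_⟩
  · rw [a0, a1]
    exact div_le_div_of_nonneg_right
      (by linarith [h.uA_mid.1, mul_nonneg h.α₁_pos.le hδ.1]) hp.le
  · obtain ⟨-, d1, d2⟩ := uA_go_zero (o := o) (β := β) 1 (mid o β z) w
    have := h.uA_endPt.2
    rw [endPt, d1, d2, div_lt_div_iff_of_pos_right hq] at this
    rw [a2, a1]
    exact div_lt_div_of_pos_right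
      (lt_of_affine_Icc (h.uA_mid.2.trans_eq h.uA_mid.1.symm) this hδ) hp
  · rw [← hw, waitB] at hw0
    rw [le_div_iff₀ (by linarith [h.c₁_lt]), zero_mul] at hw0
    exact sub_nonneg.1 hw0

/-- The orbit meets the section of the return map only once: the section is chosen inside `own 0`,
and only the first leg of the orbit enters this set. -/
theorem own_inter_range (h : IsRatio o β z) :
    range (orbit o β z) ∩ crossSection (level o β) (crossPt o β z) ∩ own o β 0 =
      {crossPt o β z} := by
  have hl := h.lag_pos
  apply Subset.antisymm
  · rintro y ⟨⟨hy, -, hlev⟩, hown⟩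
    obtain ⟨n, hn⟩ := h.exists_turn_mem hy
    have hper : Function.IsPeriodicPt (turn o) 3 y := turn_turn_turn y
    rw [← hper.iterate_mod_apply] at hn
    have hn3 : n % 3 < 3 := Nat.mod_lt _ (by norm_num)
    generalize n % 3 = k at hn hn3
    obtain ⟨⟨o1, o2⟩, -, o3⟩ := mem_own_iff.1 hown
    simp only [zero_add] at o1 o2 o3
    interval_cases k <;> rcases hn with hn | hn
    · obtain ⟨δ, hδ, rfl⟩ := h.exists_eq_go_first hn
      rw [h.level_crossPt, level_go, level_apply, coords_base, h.height_baseV, mul_one, inv_inj,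
        add_right_inj] at hlev
      rw [hlev]
      rfl
    · exact absurd o1 (h.utilities_second hn).1.not_gt
    · have := (h.utilities_first hn).2
      simp only [Function.iterate_one, uA_turn] at this
      exact absurd o1 this.not_gt
    · have := (h.utilities_second hn).2.1
      simp only [Function.iterate_one, uA_turn] at this
      exact absurd o2 this.not_gt
    · have := (h.utilities_first hn).1
      simp only [Function.iterate_succ, Function.comp, Function.iterate_zero, id, uA_turn] at this
      exact absurd o2 this.not_gt
    · have := (h.utilities_second hn).2.2
      simp only [Function.iterate_succ, Function.comp, Function.iterate_zero, id, uB_turn] at this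
      exact absurd o3 (not_lt.2 this)
  · rintro _ rfl
    refine ⟨⟨h.segment_first_subset h.crossPt_mem_segment, h.crossPt_mem_zone.1, rfl⟩,
      h.crossPt_mem_zone.2⟩

theorem isReturnMap (h : IsRatio o β z) : IsReturnMap β (range (orbit o β z)) (crossPt o β z)
    (level o β) (own o β 0) (returnMap o β z) := by
  have hl := h.lag_pos
  have hc : 0 < (1 + lag o β z)⁻¹ := inv_pos.2 (by linarith)
  refine ⟨h.segment_first_subset h.crossPt_mem_segment, fun i => ?_, ?_, isOpen_own 0,
    h.own_inter_range, h.returnMap_crossPt, ?_⟩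
  · have hA (m : Fin 3) : 0 < wA o m (crossPt o β z) := by
      rw [crossPt, wA_go]
      refine div_pos (add_pos_of_pos_of_nonneg (h.wA_pos m) ?_) (by linarith)
      split_ifs <;> linarith
    have hB (m : Fin 3) : 0 < wB o m (crossPt o β z) := by
      rw [crossPt, wB_go]
      refine div_pos (add_pos_of_pos_of_nonneg (h.wB_pos m) ?_) (by linarith)
      split_ifs <;> linarith
    have e : o.step * o.step = 1 := by cases o <;> rfl
    have h1 := hA (o.step * i)
    have h2 := hB (o.step * (i - 1))
    rw [wA, ← mul_assoc, e, one_mul] at h1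
    rw [wB, ← mul_assoc, e, one_mul, add_sub_cancel] at h2
    exact ⟨h1, h2⟩
  · refine ⟨o.step * 0, 1 + o.step * 0, h.crossPt_mem_zone, ?_⟩
    have hv : level o β (Pi.single (o.step * 0) 1, Pi.single (1 + o.step * 0) 1) = 0 := by
      have : coords o (Pi.single (o.step * 0) 1, Pi.single (1 + o.step * 0) 1) = 0 := by
        cases o <;> simp [coords, wA, wB, Orient.step]
      rw [level_apply, this, ← heightL_apply, map_zero]
    rw [map_sub, hv, h.level_crossPt, zero_sub]
    exact neg_ne_zero.2 hc.ne'
  · rw [eventually_nhdsWithin_iff]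
    filter_upwards [h.eventually_revolution] with x hx hxc
    obtain ⟨T, hT, ⟨p, hp, p0, pT, pD⟩, h2, h3⟩ := hx hxc.1 (hxc.2.trans h.level_crossPt)
    refine ⟨T, hT, p, hp.isSolutionOn, p0, fun q hq hq0 => hp.eqOn q hq (hq0.trans p0.symm), pT,
      ⟨⟨?_, h3.trans h.level_crossPt.symm⟩, h2⟩, fun s hs hsD => pD s hs
        ⟨hsD.2, hsD.1.2.trans h.level_crossPt⟩⟩
    rw [← pT]
    exact hp.isSolutionOn.1 T ⟨hT.le, le_rfl⟩

/-- If the derivative of the transition map has an eigenvalue below `-1`, the orbit is of saddle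
type. -/
theorem isSaddleType (h : IsRatio o β z) (hS : 1 + z ^ 3 + slope o β z < 0) :
    IsSaddleType β (range (orbit o β z)) :=
  ⟨_, _, _, _, h.isReturnMap, _, fun v _ => h.returnDeriv_mem v,
    h.hasFDerivAt_returnMap.hasFDerivWithinAt, h.eigenvalues hS⟩

end IsRatio

end ShapleyGame

theorem theorem3 :
    -- the clockwise orbits
    (∃ (γ : ℝ → ℝ → State) (T : ℝ → ℝ),
      (∀ β ∈ Ico 0 σ, IsShapley β (γ β) (T β) ∧ IsSymmetric (range (γ β)) ∧
        IsAttracting β (range (γ β))) ∧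
      ContinuousOn T (Ico 0 σ) ∧
      ContinuousOn (fun q : ℝ × ℝ => γ q.1 q.2) (Ico 0 σ ×ˢ univ) ∧
      ShrinksTo (fun β => range (γ β)) (𝓝[<] σ) E) ∧
    -- the anticlockwise orbits
    (∃ (γ : ℝ → ℝ → State) (T : ℝ → ℝ),
      (∀ β ∈ Ioo σ 1, IsAntiShapley β (γ β) (T β) ∧ IsSymmetric (range (γ β)) ∧
        ∀ γ' T', IsAntiShapley β γ' T' → IsSymmetric (range γ') → range γ' = range (γ β)) ∧
      ShrinksTo (fun β => range (γ β)) (𝓝[>] σ) E ∧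
      ∃ τ : ℝ, 0.915 < τ ∧ τ < 0.9155 ∧
        (∀ β ∈ Ioo σ 1, ∃ μ ∈ Ioo 0 (1 / 3 : ℝ), antiCubic β μ = 0 ∧
          (∃ x ∈ range (γ β), vA β x 0 = antiN₁ β μ ∧ vA β x 1 = antiN₂ β μ ∧
            vB β x 1 = μ ∧ vB β x 2 = μ) ∧
          (eigMinus β (antiN₁ β μ) (antiN₂ β μ) = -1 ↔ β = τ)) ∧
        (∀ β ∈ Ioo τ 1, IsAttracting β (range (γ β))) ∧
        (∀ β ∈ Ioo σ τ, IsSaddleType β (range (γ β)))) ∧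
    -- there is no anticlockwise orbit below the golden mean
    (∀ β ∈ Ioo (-1) σ, ¬ ∃ (γ : ℝ → State) (T : ℝ), IsAntiShapley β γ T) := by
  refine ⟨exists_clockwise, ?_, fun β hβ ⟨γ, T, hγ⟩ => not_isAntiShapley hβ hγ⟩
  obtain ⟨ζ, hζ, hlim⟩ := exists_ratio_acw
  obtain ⟨τ, w, hτ, hτ', hw, hcrit, hsign⟩ := exists_critical
  have hσ := σ_pos
  have hσ' := σ_lt
  have pos {β : ℝ} (hβ : β ∈ Ioo σ 1) : 0 < β := by linarith [hβ.1]
  have hr {β : ℝ} (hβ : β ∈ Ioo σ 1) : IsRatio .acw β (ζ β) :=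
    isRatio_acw (pos hβ) hβ.2 (hζ β hβ).1 (hζ β hβ).2
  have hlt {β : ℝ} (hβ : β ∈ Ioo σ 1) : ζ β < w ↔ τ < β :=
    ratio_lt_iff (pos hβ) (by linarith) (hr hβ).pos hw.1 (hζ β hβ).2 hcrit
  have hgt {β : ℝ} (hβ : β ∈ Ioo σ 1) : w < ζ β ↔ β < τ :=
    ratio_lt_iff (by linarith) (pos hβ) hw.1 (hr hβ).pos hcrit (hζ β hβ).2
  refine ⟨fun β => orbit .acw β (ζ β), fun β => -3 * Real.log (ζ β), fun β hβ =>
    ⟨(hr hβ).isAntiShapley, (hr hβ).isSymmetric, fun γ' T' hγ' _ =>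
      hγ'.range_eq hβ.2 (hζ β hβ).1 (hζ β hβ).2⟩, ?_, τ, hτ, hτ', fun β hβ => ?_,
    fun β hβ => ?_, fun β hβ => ?_⟩
  · refine shrinksTo_orbit (β := id) ?_ hlim
    filter_upwards [Ioo_mem_nhdsGT (by linarith : σ < 1)] with β hβ using (hζ β hβ).1
  · obtain ⟨h1, h2, h3, h4⟩ := mu_props (by linarith [hβ.1]) hβ.2 (hζ β hβ).1 (hζ β hβ).2 rfl
    obtain ⟨u1, u2, u3, u4⟩ := utilities_base (hr hβ)
    refine ⟨_, h1, h2, ⟨_, (hr hβ).base_mem_range, u1.trans h3.symm, ?_, u3, u4⟩, ?_⟩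
    · rw [u2, h4, h3]
    · rw [h4, eigMinus_eq_neg_one_iff (pos hβ) (hζ β hβ).1 (hζ β hβ).2 h3]
      obtain ⟨k1, k2⟩ := hsign _ (hζ β hβ).1
      rw [hlt hβ] at k1
      rw [hgt hβ] at k2
      constructor
      · intro h
        exact le_antisymm (not_lt.1 fun h' => (k1.2 h').ne' h) (not_lt.1 fun h' => (k2.2 h').ne h)
      · rintro rfl
        exact le_antisymm (not_lt.1 fun h' => (k1.1 h').false) (not_lt.1 fun h' => (k2.1 h').false)
  · have hβ' : β ∈ Ioo σ 1 := ⟨by linarith [hβ.1], hβ.2⟩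
    exact (hr hβ').isAttracting (abs_slope_acw (pos hβ') (hζ β hβ').1 (hζ β hβ').2
      ((hsign _ (hζ β hβ').1).1.2 ((hlt hβ').2 hβ.1)))
  · have hβ' : β ∈ Ioo σ 1 := ⟨hβ.1, by linarith [hβ.2]⟩
    have h1 := (hsign _ (hζ β hβ').1).2.2 ((hgt hβ').2 hβ.2)
    rw [← slope_add (pos hβ') (hζ β hβ').1 (hζ β hβ').2] at h1
    exact (hr hβ').isSaddleType (neg_of_mul_neg_left h1 (by linarith [(hζ β hβ').1.1]))
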